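/- Let $A\in\mathbb R^{s\times s}$ and $\mathbf b\in\mathbb R^s$ ($s\ge 1$) be the coefficients of a Runge–Kutta method, let $\mathbb 1=(1,\dots,1)^T$, and let $r(z)=1+z\,\mathbf b^T(I-zA)^{-1}\mathbb 1$ be its stability function. Assume that $A$ is invertible with all eigenvalues in the open right half-plane, that the method is A-stable ($|r(z)|\le 1$ for $\operatorname{Re}z\le 0$) with $|r(iy)|<1$ for all real $y\neq 0$, and that it is stiffly accurate, $\mathbf b^TA^{-1}=(0,\dots,0,1)$. Put $\Delta(\zeta)=\bigl(A+\tfrac{\zeta}{1-\zeta}\mathbb 1\mathbf b^T\bigr)^{-1}$. Let $D\in\{1,2,3\}$ and $x\in\mathbb R^D$, with $x\ne0$ if $D\in\{2,3\}$. The transfer operator of the free Schrödinger equation is, for $z\in\mathbb C\setminus(-\infty,0]$ and with $\sqrt{z/i}:=e^{-i\pi/4}\sqrt z$ (principal square root of $z$), $$K(z,x)=\begin{cases}\dfrac{1}{2\sqrt{z/i}}\,e^{-|x|\sqrt{z/i}}, & D=1,\\[1ex] \dfrac1{2\pi}K_0\bigl(\|x\|\sqrt{z/i}\bigr), & D=2,\\[1ex]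 \dfrac1{4\pi\|x\|}\,e^{-\|x\|\sqrt{z/i}}, & D=3,\end{cases}$$ where $K_0$ is the principal branch of the modified Bessel function of the second kind. For $\lambda>0$, $K(\lambda e^{\pm i\pi},x)$ denotes the boundary value of $K(\cdot,x)$ at $-\lambda$ from the upper ($+$), respectively lower ($-$), side of the cut, i.e. the value obtained with $\sqrt z=\sqrt\lambda\,e^{\pm i\pi/2}$. For a step size $h>0$, let $W_n(x)$ and $\mathbf E_n(z)$ (for $\operatorname{Re}z\le 0$) be the coefficients of the power expansions about $\zeta=0$ $$K\Bigl(\frac{\Delta(\zeta)}h,x\Bigr)=\sum_{n\ge0}W_n(x)\zeta^n,\qquad(\Delta(\zeta)-zI)^{-1}=\sum_{n\ge0}\mathbf E_n(z)\zeta^n,$$ and let the convolution quadrature weights $\boldsymbol\omega_n(x)$ and the row vectors $\mathbf e_n(z)$ be the last rows of $W_n(x)$ and $\mathbf E_n(z)$. (These expansions exist and converge for $\zeta$ near $0$.) Then for all $h>0$, $\xi>0$ and $n\ge1$, $$\boldsymbol\omega_n(x)=\frac h{2\pi i}\int_{\Gamma_+\cup\Gamma_-}K(z,x)\,\mathbf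 e_n(hz)\,dz+\frac h{2\pi i}\int_0^\xi G(\lambda,x)\,\mathbf e_n(-h\lambda)\,d\lambda,$$ with absolutely convergent integrals, where $\Gamma_\pm=\{-\xi\pm iy:y>0\}$ are both oriented in the direction of increasing imaginary part and $G(\lambda,x)=K(\lambda e^{-i\pi},x)-K(\lambda e^{i\pi},x)$. Moreover, for all $\lambda>0$, $$G(\lambda,x)=\begin{cases}\dfrac{i\,e^{i\pi/4}}{\sqrt\lambda}\cosh\bigl(|x|e^{i\pi/4}\sqrt\lambda\bigr), & D=1,\\[1ex] \dfrac i2\,J_0\bigl(e^{-i\pi/4}\sqrt\lambda\,\|x\|\bigr), & D=2,\\[1ex] \dfrac1{2\pi\|x\|}\sinh\bigl(\|x\|e^{i\pi/4}\sqrt\lambda\bigr), & D=3.\end{cases}$$ -/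

import Mathlib

open Filter Topology MeasureTheory Set
open scoped Matrix Nat

noncomputable section

namespace SchrodingerCQ

/-! ### Bessel functions of order zero (power series, principal logarithm) -/

/-- The Bessel function `J₀(z) = ∑ (-1)^k (z²/4)^k / (k!)²`. -/
def besselJ0 (z : ℂ) : ℂ :=
  ∑' k : ℕ, (-1 : ℂ) ^ k * (z ^ 2 / 4) ^ k / ((k ! : ℂ) ^ 2)

/-- The modified Bessel function of the first kind `I₀(z) = ∑ (z²/4)^k / (k!)²`. -/
def besselI0 (z : ℂ) : ℂ :=
  ∑' k : ℕ, (z ^ 2 / 4) ^ k / ((k ! : ℂ) ^ 2)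

/-- The principal branch, on `ℂ ∖ (-∞, 0]`, of the modified Bessel function of the second kind:
`K₀(z) = -(log (z/2) + γ) I₀(z) + ∑ H_k (z²/4)^k / (k!)²`, where `γ` is the Euler-Mascheroni
constant and `H_k` is the `k`-th harmonic number. -/
def besselK0 (z : ℂ) : ℂ :=
  -(Complex.log (z / 2) + (Real.eulerMascheroniConstant : ℂ)) * besselI0 z
    + ∑' k : ℕ, ((harmonic k : ℚ) : ℂ) * (z ^ 2 / 4) ^ k / ((k ! : ℂ) ^ 2)

/-! ### The transfer operator of the free Schrödinger equation in dimension `D = 1, 2, 3` -/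

/-- The transfer operator in dimension `D` at distance `d = ‖x‖`, as a function of a value `s`
of the square root of `z`; here `w = e^{-iπ/4} s` is the corresponding value of `√(z/i)`. -/
def transferOfRoot (D : ℕ) (d : ℝ) (s : ℂ) : ℂ :=
  let w : ℂ := Complex.exp (-(Real.pi / 4 : ℂ) * Complex.I) * s
  match D with
  | 1 => 1 / (2 * w) * Complex.exp (-(d : ℂ) * w)
  | 2 => 1 / (2 * (Real.pi : ℂ)) * besselK0 ((d : ℂ) * w)
  | 3 => 1 / (4 * (Real.pi : ℂ) * (d : ℂ)) * Complex.exp (-(d : ℂ) * w)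
  | _ => 0

/-- `K(z, x)` for `z` in the cut plane `ℂ ∖ (-∞, 0]`, with the principal square root of `z`. -/
def transferK (D : ℕ) (d : ℝ) (z : ℂ) : ℂ :=
  transferOfRoot D d (z ^ (1 / 2 : ℂ))

/-- `K(ρ e^{iθ}, x)` for `ρ > 0` and `-π ≤ θ ≤ π`, with the square root `√ρ e^{iθ/2}`. The angles
`θ = π` and `θ = -π` give the boundary values on the upper and the lower side of the cut. -/
def transferPolar (D : ℕ) (d : ℝ) (ρ θ : ℝ) : ℂ :=
  transferOfRoot D d ((Real.sqrt ρ : ℂ) * Complex.exp ((θ / 2 : ℂ) * Complex.I))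

/-- Off the cut, the two descriptions of `K` agree. -/
theorem transferPolar_eq_transferK (D : ℕ) (d : ℝ) {ρ θ : ℝ} (hρ : 0 < ρ)
    (h1 : -Real.pi < θ) (h2 : θ < Real.pi) :
    transferPolar D d ρ θ = transferK D d ((ρ : ℂ) * Complex.exp ((θ : ℂ) * Complex.I)) := by
  unfold transferPolar transferK
  congr 1
  have hne : ((ρ : ℂ) * Complex.exp ((θ : ℂ) * Complex.I)) ≠ 0 :=
    mul_ne_zero (by exact_mod_cast hρ.ne') (Complex.exp_ne_zero _)
  have hlog : Complex.log ((ρ : ℂ) * Complex.exp ((θ : ℂ) * Complex.I))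
      = (Real.log ρ : ℂ) + (θ : ℂ) * Complex.I := by
    rw [Complex.log_ofReal_mul hρ (Complex.exp_ne_zero _), Complex.log_exp]
    · simpa using h1
    · simpa using h2.le
  rw [Complex.cpow_def_of_ne_zero hne, hlog, Real.sqrt_eq_rpow, Real.rpow_def_of_pos hρ]
  push_cast
  rw [← Complex.exp_add]
  congr 1
  ring

/-- The jump `G(lam, x) = K(lam e^{-iπ}, x) - K(lam e^{iπ}, x)` across the cut. -/
def jumpG (D : ℕ) (d : ℝ) (lam : ℝ) : ℂ :=
  transferPolar D d lam (-Real.pi) - transferPolar D d lam Real.pi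

/-! ### Functions of matrices -/

/-- `N = f(M)`: `f` is analytic at the eigenvalues of `M`, and `N = p(M)` for a polynomial `p`
whose derivatives agree with those of `f` at each eigenvalue, up to its multiplicity. -/
def IsMatrixFunction {ι : Type*} [Fintype ι] [DecidableEq ι] (f : ℂ → ℂ)
    (M N : Matrix ι ι ℂ) : Prop :=
  (∀ μ ∈ spectrum ℂ M, AnalyticAt ℂ f μ) ∧
  ∃ p : Polynomial ℂ,
    (∀ μ : ℂ, ∀ j < M.charpoly.rootMultiplicity μ,
      (Polynomial.derivative^[j] p).eval μ = iteratedDeriv j f μ) ∧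
    N = Polynomial.aeval M p

open Classical in
/-- The matrix `f(M)` (and `0` if it is not defined). -/
def matrixFunction {ι : Type*} [Fintype ι] [DecidableEq ι] (f : ℂ → ℂ)
    (M : Matrix ι ι ℂ) : Matrix ι ι ℂ :=
  if h : ∃ N, IsMatrixFunction f M N then h.choose else 0

/-- The `n`-th coefficient of the power expansion at `0` of a matrix-valued function. -/
def powerCoeff {ι : Type*} (F : ℂ → Matrix ι ι ℂ) (n : ℕ) : Matrix ι ι ℂ :=
  Matrix.of fun i j => iteratedDeriv n (fun ζ => F ζ i j) 0 / (n ! : ℂ)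

/-! ### Runge-Kutta convolution quadrature -/

/-- The coefficients of a Runge-Kutta method with `m + 1` stages. -/
structure RKMethod (m : ℕ) where
  A : Matrix (Fin (m + 1)) (Fin (m + 1)) ℝ
  b : Fin (m + 1) → ℝ

namespace RKMethod

variable {m : ℕ} (M : RKMethod m)

/-- The coefficient matrix, with complex entries. -/
def AC : Matrix (Fin (m + 1)) (Fin (m + 1)) ℂ := M.A.map Complex.ofReal

/-- The weight vector, with complex entries. -/
def bC : Fin (m + 1) → ℂ := fun i => (M.b i : ℂ)

/-- The stability function `r(z) = 1 + z bᵀ (I - z A)⁻¹ 𝟙`. -/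
def r (z : ℂ) : ℂ := 1 + z * (M.bC ⬝ᵥ ((1 - z • M.AC)⁻¹ *ᵥ 1))

/-- The assumptions on the method: A-stability, with the eigenvalues of `A` in the open right
half-plane; strict stability on the imaginary axis away from `0`; invertibility of `A`; and stiff
accuracy `bᵀ A⁻¹ = (0, …, 0, 1)`. -/
structure Admissible : Prop where
  eigenvalues_pos : ∀ μ ∈ spectrum ℂ M.AC, 0 < μ.re
  aStable : ∀ z : ℂ, z.re ≤ 0 → ‖M.r z‖ ≤ 1
  strict : ∀ y : ℝ, y ≠ 0 → ‖M.r (Complex.I * y)‖ < 1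
  invertible : IsUnit M.A.det
  stifflyAccurate : M.b ᵥ* M.A⁻¹ = Pi.single (Fin.last m) 1

/-- The symbol `Δ(ζ) = (A + ζ/(1-ζ) 𝟙 bᵀ)⁻¹`. -/
def symbol (ζ : ℂ) : Matrix (Fin (m + 1)) (Fin (m + 1)) ℂ :=
  (M.AC + (ζ / (1 - ζ)) • Matrix.vecMulVec 1 M.bC)⁻¹

/-- The resolvent `(Δ(ζ) - z I)⁻¹` of the symbol. -/
def resolvent (z ζ : ℂ) : Matrix (Fin (m + 1)) (Fin (m + 1)) ℂ :=
  (M.symbol ζ - z • (1 : Matrix (Fin (m + 1)) (Fin (m + 1)) ℂ))⁻¹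

/-- `E_n(z)`: the coefficients of `(Δ(ζ) - z I)⁻¹ = ∑ E_n(z) ζ^n`. -/
def E (n : ℕ) (z : ℂ) : Matrix (Fin (m + 1)) (Fin (m + 1)) ℂ :=
  powerCoeff (M.resolvent z) n

/-- `e_n(z)`: the last row of `E_n(z)`. -/
def e (n : ℕ) (z : ℂ) : Fin (m + 1) → ℂ := M.E n z (Fin.last m)

/-- The matrix `K(Δ(ζ)/h)`. -/
def cqMatrix (K : ℂ → ℂ) (h : ℝ) (ζ : ℂ) : Matrix (Fin (m + 1)) (Fin (m + 1)) ℂ :=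
  matrixFunction K ((h : ℂ)⁻¹ • M.symbol ζ)

/-- The weight matrices `W_n`: the coefficients of `K(Δ(ζ)/h) = ∑ W_n ζ^n`. -/
def W (K : ℂ → ℂ) (h : ℝ) (n : ℕ) : Matrix (Fin (m + 1)) (Fin (m + 1)) ℂ :=
  powerCoeff (M.cqMatrix K h) n

/-- The convolution quadrature weights `ω_n`: the last row of `W_n`. -/
def omega (K : ℂ → ℂ) (h : ℝ) (n : ℕ) : Fin (m + 1) → ℂ := M.W K h n (Fin.last m)

end RKMethod

/-- The integral of `F` over `Γ₊ ∪ Γ₋`, `Γ± = {-ξ ± iy : y > 0}`, both half-lines being oriented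
upwards, so that `dz = i dy` on both when `Γ₋` is written as an integral over `y ∈ (0, ∞)`. -/
def verticalIntegral (ξ : ℝ) (F : ℂ → ℂ) : ℂ :=
  (∫ y in Ioi (0 : ℝ), F (-(ξ : ℂ) + Complex.I * (y : ℂ)) * Complex.I)
    + ∫ y in Ioi (0 : ℝ), F (-(ξ : ℂ) - Complex.I * (y : ℂ)) * Complex.I

end SchrodingerCQ

end

/-!
By stiff accuracy the symbol is a rank-one perturbation that is affine in `ζ`,
`Δ(ζ) = A⁻¹ - ζ A⁻¹ 𝟙 eᵀ` with `e = (0, …, 0, 1)`. The Sherman-Morrison formula therefore gives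
`E_n(z) = s(z)^(n-1) R(z) A⁻¹ 𝟙 eᵀ R(z)` for `n ≥ 1`, where `R(z) = (A⁻¹ - z)⁻¹` and
`s(z) = eᵀ R(z) A⁻¹ 𝟙`. This is holomorphic off the spectrum of `A⁻¹`, which lies in the open right
half-plane, and it is `O(|z|^(-2))` at infinity.

The circles of Apollonius of the points `±1`, which are the Cayley images of the circles `|u| = ρ`
with `ρ < 1`, eventually surround the spectrum of `Δ(ζ) / h`. Cauchy's integral formula over such a
circle, expanded in powers of `ζ`, expresses `ω_n` by an integral of `K(z) e_n(hz)`. For `n ≥ 1` the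
decay of `e_n` and the integrability of `K` at the origin allow `ρ → 1`, where the circle becomes
the imaginary axis, and then the shift of the axis to `Re z = -ξ`, which leaves the two sides of the
cut `[-ξ, 0]` behind. In the root `s = √z` they are the points `±i√λ`, and `G` is the difference of
the values there.

For `D = 2` the necessary bound on `K₀` comes from the Laplace-type representation
`K₀(w) = e^(-w) ∫ e^(-τ) τ^(-1/2) (τ + 2 w)^(-1/2) dτ`. Both sides solve the modified Bessel
equation, and the solutions are determined by their behaviour at the origin.
-/

namespace SchrodingerCQ

/-! ### Hermite interpolation and functions of matrices -/

section PowerSeries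

theorem iteratedDeriv_div_factorial_of_hasSum {F : ℂ → ℂ} {c : ℕ → ℂ}
    (h : ∀ᶠ ζ in 𝓝 (0 : ℂ), HasSum (fun n => ζ ^ n * c n) (F ζ)) (n : ℕ) :
    iteratedDeriv n F 0 / (n ! : ℂ) = c n := by
  have hF : HasFPowerSeriesAt F (FormalMultilinearSeries.ofScalars ℂ c) 0 := by
    rw [hasFPowerSeriesAt_iff]
    simpa [FormalMultilinearSeries.coeff_ofScalars] using h
  have hcoeff := congrArg (fun p => p.coeff n)
    (hF.analyticAt.hasFPowerSeriesAt.eq_formalMultilinearSeries hF)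
  simpa [FormalMultilinearSeries.coeff_ofScalars] using hcoeff

theorem powerCoeff_eq_of_hasSum {ι : Type*} {F : ℂ → Matrix ι ι ℂ} {c : ℕ → Matrix ι ι ℂ}
    (h : ∀ᶠ ζ in 𝓝 (0 : ℂ), HasSum (fun n => ζ ^ n • c n) (F ζ)) : powerCoeff F = c := by
  ext n i j
  refine iteratedDeriv_div_factorial_of_hasSum (c := fun n => c n i j) ?_ n
  filter_upwards [h] with ζ hζ
  exact Pi.hasSum.1 (Pi.hasSum.1 hζ i) j

open Asymptotics in
theorem natCast_le_analyticOrderAt_of_isBigO {f : ℂ → ℂ} {μ : ℂ} (hf : AnalyticAt ℂ f μ) {n : ℕ}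
    (h : f =O[𝓝 μ] fun w => (w - μ) ^ n) : n ≤ analyticOrderAt f μ := by
  by_contra! hlt
  obtain ⟨k, hk⟩ := ENat.ne_top_iff_exists.1 hlt.ne_top
  rw [← hk, Nat.cast_lt] at hlt
  obtain ⟨g, hg, hgμ, hfg⟩ := hf.analyticOrderAt_eq_natCast.1 hk.symm
  have hg_inv : (fun w => (g w)⁻¹) =O[𝓝 μ] fun _ => (1 : ℂ) :=
    (hg.continuousAt.inv₀ hgμ).isBigO_one ℂ
  have hpow : (fun w => (w - μ) ^ k) =O[𝓝 μ] f := by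
    refine (hg_inv.mul (isBigO_refl f (𝓝 μ))).congr' ?_ (by simp)
    filter_upwards [hfg, hg.continuousAt.eventually_ne hgμ] with w hw hgw
    rw [hw, smul_eq_mul]
    field_simp
  have hirrefl : (fun w => (w - μ) ^ k) =o[𝓝 μ] fun w => (w - μ) ^ k :=
    (hpow.trans h).trans_isLittleO <| isLittleO_norm_norm.1 <| by
      simpa only [norm_pow] using isLittleO_pow_sub_pow_sub μ hlt
  refine isLittleO_irrefl ?_ hirrefl
  have hne : ∃ᶠ w in 𝓝[≠] μ, (w - μ) ^ k ≠ 0 :=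
    Eventually.frequently <| eventually_mem_nhdsWithin.mono fun w hw =>
      pow_ne_zero k (sub_ne_zero.2 hw)
  exact hne.filter_mono nhdsWithin_le_nhds

end PowerSeries

section Hermite

open Polynomial

theorem dvd_of_eval_iterate_derivative_eq_zero {k : Type*} [Field k] [CharZero k] {p q : k[X]}
    (hq : q.Splits) (hq0 : q ≠ 0)
    (h : ∀ μ, ∀ j < q.rootMultiplicity μ, (derivative^[j] p).eval μ = 0) : q ∣ p := by
  classical
  rcases eq_or_ne p 0 with rfl | hp
  · exact dvd_zero q
  refine hq.dvd_of_roots_le_roots hq0 (Multiset.le_iff_count.2 fun μ => ?_)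
  rw [count_roots, count_roots]
  rcases hμ : q.rootMultiplicity μ with _ | j
  · exact Nat.zero_le _
  · exact (lt_rootMultiplicity_iff_isRoot_iterate_derivative hp).2 fun l hl => h μ l (by lia)

theorem iteratedDeriv_polynomial_eval {k : Type*} [NontriviallyNormedField k] (p : k[X]) (n : ℕ) :
    iteratedDeriv n (fun w => p.eval w) = fun w => (derivative^[n] p).eval w := by
  induction n with
  | zero => simp
  | succ n ih =>
    rw [iteratedDeriv_succ, ih, Function.iterate_succ_apply']
    exact funext fun w => Polynomial.deriv _

theorem X_sub_C_mul_divByMonic_X_sub_C {R : Type*} [CommRing R] (q : R[X]) (z : R) :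
    (X - C z) * (q /ₘ (X - C z)) = q - C (q.eval z) := by
  rw [eq_sub_iff_add_eq, ← modByMonic_X_sub_C_eq_C_eval, add_comm]
  exact modByMonic_add_div q (X - C z)

theorem isBigO_eval_pow_rootMultiplicity (q : ℂ[X]) (μ : ℂ) :
    (fun w => q.eval w) =O[𝓝 μ] fun w => (w - μ) ^ q.rootMultiplicity μ := by
  obtain ⟨g, hg⟩ := q.pow_rootMultiplicity_dvd μ
  have hbdd : (fun w => g.eval w) =O[𝓝 μ] fun _ => (1 : ℂ) :=
    g.continuous.continuousAt.isBigO_one ℂ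
  refine ((Asymptotics.isBigO_refl (fun w => (w - μ) ^ q.rootMultiplicity μ) _).mul hbdd).congr
    (fun w => ?_) (by simp)
  conv_rhs => rw [hg]
  simp

variable {ψ γ : ℝ → ℂ} {a b : ℝ} {q : ℂ[X]}

/-- The Hermite interpolation polynomial, at the zeros of `q`, of the Cauchy integral
`w ↦ ∫ ψ(θ) / (w - γ(θ)) dθ`: the integral of the interpolants
`-(q(γ) - q(w)) / (γ - w) / q(γ)` of the Cauchy kernels `1 / (w - γ)`. -/
noncomputable def hermiteInterpolant (q : ℂ[X]) (ψ γ : ℝ → ℂ) (a b : ℝ) : ℂ[X] :=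
  ∑ j ∈ Finset.range (q.natDegree + 1),
    C (-∫ θ in a..b, ψ θ / q.eval (γ θ) * (q /ₘ (X - C (γ θ))).coeff j) * X ^ j

theorem continuous_coeff_divByMonic_X_sub_C (q : ℂ[X]) (hγ : Continuous γ) (j : ℕ) :
    Continuous fun θ => (q /ₘ (X - C (γ θ))).coeff j := by
  simp only [coeff_divByMonic_X_sub_C]
  fun_prop

theorem map_divByMonic_X_sub_C (q : ℂ[X]) (L : ℂ[X] →ₗ[ℂ] ℂ) (z : ℂ) :
    L (q /ₘ (X - C z)) =
      ∑ j ∈ Finset.range (q.natDegree + 1), (q /ₘ (X - C z)).coeff j * L (X ^ j) := by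
  have hdeg : (q /ₘ (X - C z)).natDegree < q.natDegree + 1 := by
    rw [natDegree_divByMonic _ (monic_X_sub_C z)]
    lia
  conv_lhs => rw [as_sum_range_C_mul_X_pow' _ hdeg]
  simp only [map_sum, C_mul', map_smul, smul_eq_mul]

theorem continuous_map_divByMonic_X_sub_C (q : ℂ[X]) (hγ : Continuous γ) (L : ℂ[X] →ₗ[ℂ] ℂ) :
    Continuous fun θ => L (q /ₘ (X - C (γ θ))) := by
  simp only [map_divByMonic_X_sub_C]
  exact continuous_finsetSum _ fun j _ =>
    (continuous_coeff_divByMonic_X_sub_C q hγ j).mul continuous_const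

theorem continuous_div_eval (hψ : Continuous ψ) (hγ : Continuous γ)
    (hq : ∀ θ, q.eval (γ θ) ≠ 0) : Continuous fun θ => ψ θ / q.eval (γ θ) :=
  hψ.div (q.continuous.comp hγ) hq

theorem map_hermiteInterpolant (hψ : Continuous ψ) (hγ : Continuous γ)
    (hq : ∀ θ, q.eval (γ θ) ≠ 0) (L : ℂ[X] →ₗ[ℂ] ℂ) :
    L (hermiteInterpolant q ψ γ a b) =
      -∫ θ in a..b, ψ θ / q.eval (γ θ) * L (q /ₘ (X - C (γ θ))) := by
  have hint : ∀ j, IntervalIntegrable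
      (fun θ => ψ θ / q.eval (γ θ) * (q /ₘ (X - C (γ θ))).coeff j) volume a b := fun j =>
    ((continuous_div_eval hψ hγ hq).mul
      (continuous_coeff_divByMonic_X_sub_C q hγ j)).intervalIntegrable a b
  simp only [hermiteInterpolant, map_sum, C_mul', map_smul, smul_eq_mul, neg_mul,
    Finset.sum_neg_distrib, ← intervalIntegral.integral_mul_const]
  rw [← intervalIntegral.integral_finsetSum fun j _ => (hint j).mul_const _]
  simp only [map_divByMonic_X_sub_C, Finset.mul_sum, mul_assoc]

theorem integral_sub_eval_hermiteInterpolant (hψ : Continuous ψ) (hγ : Continuous γ)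
    (hq : ∀ θ, q.eval (γ θ) ≠ 0) {w : ℂ} (hw : ∀ θ, γ θ ≠ w) :
    (∫ θ in a..b, ψ θ / (w - γ θ)) - (hermiteInterpolant q ψ γ a b).eval w =
      q.eval w * ∫ θ in a..b, ψ θ / q.eval (γ θ) / (w - γ θ) := by
  have hne : ∀ θ, w - γ θ ≠ 0 := fun θ => sub_ne_zero.2 (hw θ).symm
  have hdivided : ∀ θ, (w - γ θ) * (q /ₘ (X - C (γ θ))).eval w = q.eval w - q.eval (γ θ) :=
    fun θ => by simpa using congrArg (eval w) (X_sub_C_mul_divByMonic_X_sub_C q (γ θ))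
  have heval := map_hermiteInterpolant (a := a) (b := b) hψ hγ hq (leval w)
  simp only [leval_apply] at heval
  rw [heval, sub_neg_eq_add, ← intervalIntegral.integral_add, ← intervalIntegral.integral_const_mul]
  · refine intervalIntegral.integral_congr fun θ _ => ?_
    have hneθ := hne θ
    have hqθ := hq θ
    rw [eq_add_of_sub_eq (hdivided θ).symm]
    field_simp
    ring
  · exact (hψ.div (by fun_prop) hne).intervalIntegrable a b
  · exact ((continuous_div_eval hψ hγ hq).mul
      (continuous_map_divByMonic_X_sub_C q hγ (leval w))).intervalIntegrable a b

theorem isBigO_integral_div_sub_one (hψ : Continuous ψ) {V : Set ℂ}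
    (hV : IsOpen V) (hγV : ∀ θ, γ θ ∉ V) {μ : ℂ} (hμ : μ ∈ V) :
    (fun w => ∫ θ in a..b, ψ θ / (w - γ θ)) =O[𝓝 μ] fun _ => (1 : ℂ) := by
  obtain ⟨δ, hδ, hball⟩ := Metric.isOpen_iff.1 hV μ hμ
  obtain ⟨B, hB⟩ := (isCompact_uIcc (a := a) (b := b)).exists_bound_of_continuousOn hψ.continuousOn
  refine Asymptotics.IsBigO.of_bound (B / (δ / 2) * |b - a|) ?_
  filter_upwards [Metric.ball_mem_nhds μ (half_pos hδ)] with w hw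
  rw [norm_one, mul_one]
  refine intervalIntegral.norm_integral_le_of_norm_le_const fun θ hθ => ?_
  have hBθ := hB θ (uIoc_subset_uIcc hθ)
  have hdist : δ / 2 ≤ ‖w - γ θ‖ := by
    have hγμ : δ ≤ dist (γ θ) μ := by
      by_contra! hlt
      exact hγV θ (hball hlt)
    have htri := dist_triangle_left (γ θ) μ w
    rw [dist_eq_norm w (γ θ)] at htri
    rw [Metric.mem_ball] at hw
    linarith
  rw [norm_div]
  exact div_le_div₀ ((norm_nonneg _).trans hBθ) hBθ (half_pos hδ) hdist

variable {ι : Type*} [Fintype ι] [DecidableEq ι] {f : ℂ → ℂ} {M N N' : Matrix ι ι ℂ}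

theorem inv_sub_smul_one_eq_aeval_divByMonic {z : ℂ} (hz : M.charpoly.eval z ≠ 0) :
    (M - z • (1 : Matrix ι ι ℂ))⁻¹ =
      -((M.charpoly.eval z)⁻¹ • aeval M (M.charpoly /ₘ (X - C z))) := by
  refine Matrix.inv_eq_right_inv ?_
  have hdiv := congrArg (aeval M) (X_sub_C_mul_divByMonic_X_sub_C M.charpoly z)
  rw [map_mul, map_sub, map_sub, Matrix.aeval_self_charpoly, aeval_X, aeval_C, aeval_C,
    zero_sub, Algebra.algebraMap_eq_smul_one, Algebra.algebraMap_eq_smul_one] at hdiv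
  rw [mul_neg, mul_smul_comm, hdiv, smul_neg, neg_neg, smul_smul, inv_mul_cancel₀ hz, one_smul]

theorem aeval_hermiteInterpolant_charpoly (hψ : Continuous ψ) (hγ : Continuous γ)
    (hM : ∀ θ, M.charpoly.eval (γ θ) ≠ 0) (i j : ι) :
    aeval M (hermiteInterpolant M.charpoly ψ γ a b) i j =
      ∫ θ in a..b, ψ θ * (M - γ θ • (1 : Matrix ι ι ℂ))⁻¹ i j := by
  have hmap := map_hermiteInterpolant (a := a) (b := b) hψ hγ hM
    (Matrix.entryLinearMap ℂ ℂ i j ∘ₗ (aeval M).toLinearMap)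
  simp only [LinearMap.comp_apply, AlgHom.toLinearMap_apply, Matrix.entryLinearMap_apply] at hmap
  rw [hmap, ← intervalIntegral.integral_neg]
  refine intervalIntegral.integral_congr fun θ _ => ?_
  simp only [inv_sub_smul_one_eq_aeval_divByMonic (hM θ), Matrix.neg_apply, Matrix.smul_apply,
    smul_eq_mul]
  ring

theorem isMatrixFunction_of_cauchy (hψ : Continuous ψ) (hγ : Continuous γ) {V : Set ℂ}
    (hV : IsOpen V) (hγV : ∀ θ, γ θ ∉ V) (hMV : spectrum ℂ M ⊆ V) (hfV : AnalyticOnNhd ℂ f V)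
    (hcauchy : ∀ w ∈ V, ∫ θ in a..b, ψ θ / (w - γ θ) = f w) :
    IsMatrixFunction f M
      (Matrix.of fun i j => ∫ θ in a..b, ψ θ * (M - γ θ • (1 : Matrix ι ι ℂ))⁻¹ i j) := by
  have hMγ : ∀ θ, M.charpoly.eval (γ θ) ≠ 0 := fun θ h0 =>
    hγV θ (hMV (Matrix.mem_spectrum_of_isRoot_charpoly h0))
  refine ⟨fun μ hμ => hfV μ (hMV hμ), hermiteInterpolant M.charpoly ψ γ a b, fun μ j hj => ?_,
    Matrix.ext fun i j => (aeval_hermiteInterpolant_charpoly hψ hγ hMγ i j).symm⟩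
  set p := hermiteInterpolant M.charpoly ψ γ a b
  have hroot : M.charpoly.IsRoot μ := (rootMultiplicity_pos'.1 (j.zero_le.trans_lt hj)).2
  have hμ : μ ∈ V := hMV (Matrix.mem_spectrum_of_isRoot_charpoly hroot)
  have hp : AnalyticAt ℂ (fun w => p.eval w) μ := AnalyticOnNhd.eval_polynomial p μ (mem_univ μ)
  have hvanish : (f - fun w => p.eval w) =O[𝓝 μ]
      fun w => (w - μ) ^ M.charpoly.rootMultiplicity μ := by
    refine ((isBigO_eval_pow_rootMultiplicity M.charpoly μ).mul
      (isBigO_integral_div_sub_one (a := a) (b := b)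
        (continuous_div_eval hψ hγ hMγ) hV hγV hμ)).congr' ?_ (by simp)
    filter_upwards [hV.mem_nhds hμ] with w hw
    rw [Pi.sub_apply, ← hcauchy w hw]
    exact (integral_sub_eval_hermiteInterpolant hψ hγ hMγ fun θ h => hγV θ (h ▸ hw)).symm
  have hderiv := (natCast_le_analyticOrderAt_iff_iteratedDeriv_eq_zero ((hfV μ hμ).sub hp)).1
    (natCast_le_analyticOrderAt_of_isBigO ((hfV μ hμ).sub hp) hvanish) j hj
  rw [iteratedDeriv_sub (hfV μ hμ).contDiffAt hp.contDiffAt, sub_eq_zero,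
    iteratedDeriv_polynomial_eval] at hderiv
  exact hderiv.symm

theorem IsMatrixFunction.unique (h : IsMatrixFunction f M N) (h' : IsMatrixFunction f M N') :
    N = N' := by
  obtain ⟨-, p, hp, rfl⟩ := h
  obtain ⟨-, p', hp', rfl⟩ := h'
  obtain ⟨g, hg⟩ : M.charpoly ∣ p - p' :=
    dvd_of_eval_iterate_derivative_eq_zero (IsAlgClosed.splits _) M.charpoly_monic.ne_zero
      fun μ j hj => by
        rw [iterate_derivative_sub, eval_sub, hp μ j hj, hp' μ j hj, sub_self]
  rw [← sub_eq_zero, ← map_sub, hg, map_mul, Matrix.aeval_self_charpoly, zero_mul]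

theorem IsMatrixFunction.matrixFunction_eq (h : IsMatrixFunction f M N) :
    matrixFunction f M = N := by
  have hex : ∃ N, IsMatrixFunction f M N := ⟨N, h⟩
  rw [matrixFunction, dif_pos hex]
  exact hex.choose_spec.unique h

end Hermite

/-! ### Rank-one perturbations -/

section Resolvent

theorem exists_norm_resolvent_le {𝕜 A : Type*} [NontriviallyNormedField 𝕜] [ProperSpace 𝕜]
    [NormedRing A] [NormedAlgebra 𝕜 A] [CompleteSpace A] (a : A) {T : Set 𝕜} (hT : IsClosed T)
    (ha : Disjoint T (spectrum 𝕜 a)) : ∃ C, ∀ z ∈ T, ‖resolvent a z‖ ≤ C / (1 + ‖z‖) := by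
  obtain ⟨c, hc⟩ := (spectrum.resolvent_isBigO_inv (𝕜 := 𝕜) a).bound
  obtain ⟨R, hR⟩ := (Metric.hasBasis_cobounded_compl_closedBall (0 : 𝕜)).eventually_iff.1 hc
  have hfar : ∀ z : 𝕜, max R 1 < ‖z‖ → ‖resolvent a z‖ ≤ c * ‖z‖⁻¹ := fun z hz => by
    simpa using hR.2 (x := z) (by simpa using (le_max_left R 1).trans_lt hz)
  have hcont : ContinuousOn (fun z => (1 + ‖z‖) * ‖resolvent a z‖)
      (T ∩ Metric.closedBall 0 (max R 1)) := fun z hz => by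
    have hres : ContinuousAt (resolvent a) z :=
      (spectrum.hasDerivAt_resolvent_const_left (spectrum.notMem_iff.1
        (ha.notMem_of_mem_left hz.1))).continuousAt
    exact ((continuousAt_const.add continuous_norm.continuousAt).mul hres.norm).continuousWithinAt
  obtain ⟨C, hC⟩ := ((isCompact_closedBall 0 _).inter_left hT).exists_bound_of_continuousOn hcont
  refine ⟨max C (2 * c), fun z hz => ?_⟩
  rw [le_div_iff₀' (by positivity)]
  rcases le_or_gt ‖z‖ (max R 1) with hnear | hlarge
  · exact ((le_abs_self _).trans (hC z ⟨hz, by simpa using hnear⟩)).trans (le_max_left _ _)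
  · have hz1 : 1 < ‖z‖ := (le_max_right R 1).trans_lt hlarge
    have : 0 ≤ c * ‖z‖⁻¹ := (norm_nonneg _).trans (hfar z hlarge)
    calc (1 + ‖z‖) * ‖resolvent a z‖ ≤ (‖z‖ + ‖z‖) * (c * ‖z‖⁻¹) := by
          gcongr
          exact hfar z hlarge
      _ = 2 * c := by field_simp; ring
      _ ≤ max C (2 * c) := le_max_right _ _

end Resolvent

section RankOnePerturbation

open Matrix

variable {ι 𝕜 : Type*} [Fintype ι] [DecidableEq ι]

/-- The bilinear form `vᵀ B⁻¹ u` of the inverse of a matrix. With `v` or `u` a standard basis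
vector it is an entry of `B⁻¹ u` or of `vᵀ B⁻¹`. -/
noncomputable def invForm [CommRing 𝕜] (B : Matrix ι ι 𝕜) (v u : ι → 𝕜) : 𝕜 := v ⬝ᵥ B⁻¹ *ᵥ u

/-- The coefficients of the expansion of `(B - ζ u vᵀ)⁻¹` in powers of `ζ`. -/
noncomputable def rankOneCoeff [CommRing 𝕜] (B : Matrix ι ι 𝕜) (u v : ι → 𝕜) :
    ℕ → Matrix ι ι 𝕜
  | 0 => B⁻¹
  | n + 1 => invForm B v u ^ n • (B⁻¹ * vecMulVec u v * B⁻¹)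

section Algebra

variable [CommRing 𝕜] (B : Matrix ι ι 𝕜) (u v : ι → 𝕜)

theorem rankOneCoeff_zero_apply (i j : ι) :
    rankOneCoeff B u v 0 i j = invForm B (Pi.single i 1) (Pi.single j 1) := by
  simp [rankOneCoeff, invForm]

theorem rankOneCoeff_succ_apply (n : ℕ) (i j : ι) :
    rankOneCoeff B u v (n + 1) i j =
      invForm B v u ^ n * (invForm B (Pi.single i 1) u * invForm B v (Pi.single j 1)) := by
  rw [rankOneCoeff, mul_vecMulVec, vecMulVec_mul, Matrix.smul_apply, vecMulVec_apply, smul_eq_mul]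
  rw [invForm, invForm, invForm, single_one_dotProduct,
    dotProduct_mulVec v B⁻¹ (Pi.single j 1), dotProduct_single_one]

end Algebra

section Field

variable [Field 𝕜] (B : Matrix ι ι 𝕜) (u v : ι → 𝕜)

theorem rankOneCoeff_smul_smul {c : 𝕜} (hc : c ≠ 0) (hB : IsUnit B.det) (n : ℕ) :
    rankOneCoeff (c • B) (c • u) v n = c⁻¹ • rankOneCoeff B u v n := by
  have hinv : (c • B)⁻¹ = c⁻¹ • B⁻¹ := by
    simpa [Units.smul_def] using inv_smul' B (Units.mk0 c hc) hB
  have hform : invForm (c • B) v (c • u) = invForm B v u := by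
    simp [invForm, hinv, smul_mulVec, mulVec_smul, hc]
  rcases n with _ | n
  · exact hinv
  · simp [rankOneCoeff, hform, hinv, smul_vecMulVec, hc, smul_comm c⁻¹]

variable {B u v} in
theorem sherman_morrison {ζ : 𝕜} (hB : IsUnit B.det) (hζ : 1 - ζ * invForm B v u ≠ 0) :
    (B - ζ • vecMulVec u v) *
      (B⁻¹ + (ζ * (1 - ζ * invForm B v u)⁻¹) • (B⁻¹ * vecMulVec u v * B⁻¹)) = 1 := by
  set P := vecMulVec u v
  set s := invForm B v u
  have hBP : B * (B⁻¹ * P * B⁻¹) = P * B⁻¹ := by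
    rw [mul_assoc, mul_nonsing_inv_cancel_left B _ hB]
  have hPP : P * (B⁻¹ * P * B⁻¹) = s • (P * B⁻¹) := by
    simp only [P, s, invForm, ← mul_assoc, vecMulVec_mul, vecMul_vecMulVec, dotProduct_mulVec,
      vecMulVec_smul, smul_mul_assoc]
  have hcoeff : ζ * (1 - ζ * s)⁻¹ - ζ - ζ * (1 - ζ * s)⁻¹ * ζ * s = 0 := by field_simp; ring
  calc (B - ζ • P) * (B⁻¹ + (ζ * (1 - ζ * s)⁻¹) • (B⁻¹ * P * B⁻¹))
      = 1 + (ζ * (1 - ζ * s)⁻¹ - ζ - ζ * (1 - ζ * s)⁻¹ * ζ * s) • (P * B⁻¹) := by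
        rw [mul_add, sub_mul, mul_nonsing_inv B hB, mul_smul_comm, sub_mul, hBP, smul_mul_assoc,
          smul_mul_assoc, hPP]
        module
    _ = 1 := by rw [hcoeff, zero_smul, add_zero]

end Field

section Normed

variable [NormedField 𝕜] {B : Matrix ι ι 𝕜} {u v : ι → 𝕜} {ζ : 𝕜}

theorem one_sub_ne_zero_of_norm_lt_one {x : 𝕜} (hx : ‖x‖ < 1) : 1 - x ≠ 0 := fun h => by
  rw [← sub_eq_zero.1 h, norm_one] at hx
  exact lt_irrefl 1 hx

theorem isUnit_sub_smul_vecMulVec (hB : IsUnit B.det) (hζ : ‖ζ * invForm B v u‖ < 1) :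
    IsUnit (B - ζ • vecMulVec u v) :=
  .of_mul_eq_one _ (sherman_morrison hB (one_sub_ne_zero_of_norm_lt_one hζ))

theorem hasSum_rankOneCoeff (hB : IsUnit B.det) (hζ : ‖ζ * invForm B v u‖ < 1) :
    HasSum (fun n => ζ ^ n • rankOneCoeff B u v n) (B - ζ • vecMulVec u v)⁻¹ := by
  rw [inv_eq_right_inv (sherman_morrison hB (one_sub_ne_zero_of_norm_lt_one hζ)),
    ← hasSum_nat_add_iff' 1]
  have hgeom := ((hasSum_geometric_of_norm_lt_one hζ).mul_left ζ).smul_const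
    (B⁻¹ * vecMulVec u v * B⁻¹)
  have hterm (n : ℕ) : ζ ^ (n + 1) * invForm B v u ^ n = ζ * (ζ * invForm B v u) ^ n := by ring
  simpa only [Finset.sum_range_one, pow_zero, one_smul, rankOneCoeff, add_sub_cancel_left,
    smul_smul, hterm] using hgeom

end Normed

section Spectrum

variable {B : Matrix ι ι ℂ} {T : Set ℂ} {u v : ι → ℂ}

theorem isUnit_det_sub_smul_one {z : ℂ} (hz : z ∉ spectrum ℂ B) :
    IsUnit (B - z • (1 : Matrix ι ι ℂ)).det := by
  rw [← isUnit_iff_isUnit_det, ← neg_sub, IsUnit.neg_iff, ← Algebra.algebraMap_eq_smul_one]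
  exact spectrum.notMem_iff.1 hz

theorem inv_sub_smul_one_eq_neg_resolvent {z : ℂ} (hz : z ∉ spectrum ℂ B) :
    (B - z • (1 : Matrix ι ι ℂ))⁻¹ = -resolvent B z := by
  refine inv_eq_right_inv ?_
  rw [mul_neg, ← neg_mul, neg_sub, resolvent, ← Algebra.algebraMap_eq_smul_one]
  exact Ring.mul_inverse_cancel _ (spectrum.notMem_iff.1 hz)

/-- The linear functional `M ↦ vᵀ M u` on matrices. -/
noncomputable def matrixPairing (v u : ι → ℂ) : Matrix ι ι ℂ →ₗ[ℂ] ℂ :=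
  dotProductBilin ℂ ℂ v ∘ₗ (mulVecBilin ℂ ℂ).flip u

theorem invForm_sub_smul_one (v u : ι → ℂ) {z : ℂ} (hz : z ∉ spectrum ℂ B) :
    invForm (B - z • (1 : Matrix ι ι ℂ)) v u = -matrixPairing v u (resolvent B z) := by
  rw [invForm, inv_sub_smul_one_eq_neg_resolvent hz, neg_mulVec, dotProduct_neg]
  rfl

attribute [local instance] Matrix.linftyOpNormedRing Matrix.linftyOpNormedAlgebra in
theorem differentiableAt_invForm_sub_smul_one (v u : ι → ℂ) {z : ℂ} (hz : z ∉ spectrum ℂ B) :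
    DifferentiableAt ℂ (fun z => invForm (B - z • (1 : Matrix ι ι ℂ)) v u) z := by
  have hres : DifferentiableAt ℂ (resolvent B) z :=
    (spectrum.hasDerivAt_resolvent_const_left (spectrum.notMem_iff.1 hz)).differentiableAt
  refine ((matrixPairing v u).toContinuousLinearMap.differentiableAt.comp z
    hres).neg.congr_of_eventuallyEq ?_
  filter_upwards [(spectrum.isClosed B).isOpen_compl.mem_nhds hz] with w hw
  exact invForm_sub_smul_one v u hw

attribute [local instance] Matrix.linftyOpNormedRing Matrix.linftyOpNormedAlgebra in
theorem exists_norm_invForm_sub_smul_one_le (v u : ι → ℂ) (hT : IsClosed T)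
    (hB : Disjoint T (spectrum ℂ B)) :
    ∃ C, ∀ z ∈ T, ‖invForm (B - z • (1 : Matrix ι ι ℂ)) v u‖ ≤ C / (1 + ‖z‖) := by
  obtain ⟨C, hC⟩ := exists_norm_resolvent_le B hT hB
  obtain ⟨L, hL, hbound⟩ := SemilinearMapClass.bound_of_continuous (matrixPairing v u)
    (matrixPairing v u).continuous_of_finiteDimensional
  refine ⟨L * C, fun z hz => ?_⟩
  rw [invForm_sub_smul_one v u (hB.notMem_of_mem_left hz), norm_neg, mul_div_assoc]
  exact (hbound _).trans (by gcongr; exact hC z hz)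

theorem differentiableAt_rankOneCoeff (n : ℕ) (i j : ι) {z : ℂ} (hz : z ∉ spectrum ℂ B) :
    DifferentiableAt ℂ (fun z => rankOneCoeff (B - z • (1 : Matrix ι ι ℂ)) u v n i j) z := by
  have hdiff (v' u' : ι → ℂ) := differentiableAt_invForm_sub_smul_one v' u' hz
  rcases n with _ | n
  · simpa only [rankOneCoeff_zero_apply] using hdiff _ _
  · simpa only [rankOneCoeff_succ_apply] using
      ((hdiff _ _).fun_pow n).fun_mul ((hdiff _ _).fun_mul (hdiff _ _))

theorem exists_norm_rankOneCoeff_le (u v : ι → ℂ) (hT : IsClosed T)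
    (hB : Disjoint T (spectrum ℂ B)) (i j : ι) :
    ∃ C, ∀ n, ∀ z ∈ T, ‖rankOneCoeff (B - z • (1 : Matrix ι ι ℂ)) u v n i j‖ ≤
      (C / (1 + ‖z‖)) ^ (n + 1) := by
  have hbound (v' u' : ι → ℂ) := exists_norm_invForm_sub_smul_one_le v' u' hT hB
  obtain ⟨C₀, h₀⟩ := hbound (Pi.single i 1) (Pi.single j 1)
  obtain ⟨C₁, h₁⟩ := hbound v u
  obtain ⟨C₂, h₂⟩ := hbound (Pi.single i 1) u
  obtain ⟨C₃, h₃⟩ := hbound v (Pi.single j 1)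
  refine ⟨max (max C₀ C₁) (max C₂ C₃), fun n z hz => ?_⟩
  set q := max (max C₀ C₁) (max C₂ C₃) / (1 + ‖z‖) with hq
  have hle {C : ℝ} (hC : C ≤ max (max C₀ C₁) (max C₂ C₃)) : C / (1 + ‖z‖) ≤ q := by
    rw [hq]; gcongr
  rcases n with _ | n
  · rw [rankOneCoeff_zero_apply, zero_add, pow_one]
    exact (h₀ z hz).trans (hle (by simp))
  · have h₁' := (h₁ z hz).trans (hle (by simp))
    have h₂' := (h₂ z hz).trans (hle (by simp))
    have h₃' := (h₃ z hz).trans (hle (by simp))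
    have hq0 : 0 ≤ q := (norm_nonneg _).trans h₁'
    calc ‖rankOneCoeff (B - z • (1 : Matrix ι ι ℂ)) u v (n + 1) i j‖
        ≤ q ^ n * (q * q) := by
          rw [rankOneCoeff_succ_apply, norm_mul, norm_mul, norm_pow]
          gcongr
      _ = q ^ (n + 1 + 1) := by ring

theorem eventually_norm_mul_invForm_lt_one (u v : ι → ℂ) (hT : IsClosed T)
    (hB : Disjoint T (spectrum ℂ B)) :
    ∀ᶠ ζ : ℂ in 𝓝 0, ∀ z ∈ T, ‖ζ * invForm (B - z • (1 : Matrix ι ι ℂ)) v u‖ < 1 := by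
  obtain ⟨C, hC⟩ := exists_norm_invForm_sub_smul_one_le v u hT hB
  have hsmall : Tendsto (fun ζ : ℂ => ‖ζ‖ * |C|) (𝓝 0) (𝓝 0) := by
    have : Continuous fun ζ : ℂ => ‖ζ‖ * |C| := by fun_prop
    simpa using this.tendsto 0
  filter_upwards [hsmall.eventually_lt_const one_pos] with ζ hζ z hz
  calc ‖ζ * invForm (B - z • (1 : Matrix ι ι ℂ)) v u‖ ≤ ‖ζ‖ * (|C| / (1 + ‖z‖)) := by
        rw [norm_mul]
        gcongr
        exact (hC z hz).trans (by gcongr; exact le_abs_self C)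
    _ ≤ ‖ζ‖ * |C| := by gcongr; exact div_le_self (abs_nonneg C) (by simp)
    _ < 1 := hζ

theorem spectrum_sub_smul_vecMulVec_subset {ζ : ℂ} (hB : Disjoint T (spectrum ℂ B))
    (hζ : ∀ z ∈ T, ‖ζ * invForm (B - z • (1 : Matrix ι ι ℂ)) v u‖ < 1) :
    spectrum ℂ (B - ζ • vecMulVec u v) ⊆ Tᶜ := by
  intro μ hμ hμT
  refine spectrum.mem_iff.1 hμ ?_
  rw [← IsUnit.neg_iff, neg_sub, Algebra.algebraMap_eq_smul_one, sub_right_comm]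
  exact isUnit_sub_smul_vecMulVec (isUnit_det_sub_smul_one (hB.notMem_of_mem_left hμT)) (hζ μ hμT)

end Spectrum

end RankOnePerturbation

section PerturbedMatrixFunction

open Matrix

variable {ι : Type*} [Fintype ι] [DecidableEq ι] {B : Matrix ι ι ℂ} {ψ γ : ℝ → ℂ} {a b : ℝ}

theorem continuous_rankOneCoeff_comp (u v : ι → ℂ) (hγ : Continuous γ)
    (hγB : ∀ θ, γ θ ∉ spectrum ℂ B) (n : ℕ) (i j : ι) :
    Continuous fun θ => rankOneCoeff (B - γ θ • (1 : Matrix ι ι ℂ)) u v n i j :=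
  continuous_iff_continuousAt.2 fun θ =>
    ((differentiableAt_rankOneCoeff n i j (hγB θ)).continuousAt).comp (f := γ) hγ.continuousAt

theorem eventually_hasSum_integral_rankOneCoeff (u v : ι → ℂ) (hψ : Continuous ψ)
    (hγ : Continuous γ) {T : Set ℂ} (hT : IsClosed T) (hB : Disjoint T (spectrum ℂ B))
    (hγT : ∀ θ, γ θ ∈ T) (i j : ι) :
    ∀ᶠ ζ : ℂ in 𝓝 0, HasSum
      (fun n => ζ ^ n *
        ∫ θ in a..b, ψ θ * rankOneCoeff (B - γ θ • (1 : Matrix ι ι ℂ)) u v n i j)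
      (∫ θ in a..b, ψ θ * (B - ζ • vecMulVec u v - γ θ • (1 : Matrix ι ι ℂ))⁻¹ i j) := by
  obtain ⟨C, hC⟩ := exists_norm_rankOneCoeff_le u v hT hB i j
  obtain ⟨K, hK⟩ := (isCompact_uIcc (a := a) (b := b)).exists_bound_of_continuousOn hψ.continuousOn
  have hsmall : ∀ᶠ ζ : ℂ in 𝓝 0, ‖ζ‖ * |C| < 1 := by
    have : Continuous fun ζ : ℂ => ‖ζ‖ * |C| := by fun_prop
    exact (this.tendsto 0).eventually_lt_const (by simp)
  filter_upwards [hsmall, eventually_norm_mul_invForm_lt_one u v hT hB] with ζ hζ hζ'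
  have hterm (n : ℕ) (θ : ℝ) :
      ‖ζ ^ n * rankOneCoeff (B - γ θ • (1 : Matrix ι ι ℂ)) u v n i j‖ ≤
        (‖ζ‖ * |C|) ^ n * |C| := by
    rw [norm_mul, norm_pow, mul_pow, mul_assoc, ← pow_succ]
    refine mul_le_mul_of_nonneg_left ((hC n _ (hγT θ)).trans ?_) (by positivity)
    refine (le_abs_self _).trans ?_
    rw [abs_pow, abs_div, abs_of_pos (by positivity : 0 < 1 + ‖γ θ‖)]
    gcongr
    exact div_le_self (abs_nonneg C) (by simp)
  simp only [← intervalIntegral.integral_const_mul, mul_left_comm (ζ ^ _)]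
  refine intervalIntegral.hasSum_integral_of_dominated_convergence
    (fun n _ => K * ((‖ζ‖ * |C|) ^ n * |C|)) (fun n => ?_) (fun n => ?_) ?_ ?_ ?_
  · exact (hψ.mul (continuous_const.mul (continuous_rankOneCoeff_comp u v hγ
      (fun θ => hB.notMem_of_mem_left (hγT θ)) n i j))).aestronglyMeasurable
  · refine Eventually.of_forall fun θ hθ => ?_
    have hKθ := hK θ (uIoc_subset_uIcc hθ)
    rw [norm_mul]
    exact mul_le_mul hKθ (hterm n θ) (norm_nonneg _) ((norm_nonneg _).trans hKθ)
  · exact Eventually.of_forall fun θ _ =>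
      ((summable_geometric_of_lt_one (by positivity) hζ).mul_right _).mul_left _
  · exact intervalIntegrable_const
  · refine Eventually.of_forall fun θ _ => HasSum.mul_left _ ?_
    have hmatrix := hasSum_rankOneCoeff
      (isUnit_det_sub_smul_one (hB.notMem_of_mem_left (hγT θ))) (hζ' _ (hγT θ))
    rw [sub_right_comm]
    exact Pi.hasSum.1 (Pi.hasSum.1 hmatrix i) j

theorem eventually_hasSum_matrixFunction (u v : ι → ℂ) {f : ℂ → ℂ} (hψ : Continuous ψ)
    (hγ : Continuous γ) {V : Set ℂ} (hV : IsOpen V) (hγV : ∀ θ, γ θ ∉ V)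
    (hBV : spectrum ℂ B ⊆ V) (hfV : AnalyticOnNhd ℂ f V)
    (hcauchy : ∀ w ∈ V, ∫ θ in a..b, ψ θ / (w - γ θ) = f w) :
    ∀ᶠ ζ : ℂ in 𝓝 0,
      IsMatrixFunction f (B - ζ • vecMulVec u v) (matrixFunction f (B - ζ • vecMulVec u v)) ∧
      HasSum
        (fun n => ζ ^ n • Matrix.of fun i j =>
          ∫ θ in a..b, ψ θ * rankOneCoeff (B - γ θ • (1 : Matrix ι ι ℂ)) u v n i j)
        (matrixFunction f (B - ζ • vecMulVec u v)) := by
  have hT : Disjoint Vᶜ (spectrum ℂ B) := disjoint_compl_left_iff_subset.2 hBV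
  have hsum := eventually_all.2 fun i => eventually_all.2 fun j =>
    eventually_hasSum_integral_rankOneCoeff (a := a) (b := b) u v hψ hγ hV.isClosed_compl hT hγV i j
  filter_upwards [hsum, eventually_norm_mul_invForm_lt_one u v hV.isClosed_compl hT] with ζ hζ hζ'
  have hspec := spectrum_sub_smul_vecMulVec_subset hT hζ'
  rw [compl_compl] at hspec
  have hmf := isMatrixFunction_of_cauchy hψ hγ hV hγV hspec hfV hcauchy
  rw [hmf.matrixFunction_eq]
  exact ⟨hmf, Pi.hasSum.2 fun i => Pi.hasSum.2 fun j => hζ i j⟩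

end PerturbedMatrixFunction

section Cayley

/-- The Cayley transform, which maps the unit disc onto the right half-plane. -/
noncomputable def cayley (u : ℂ) : ℂ := (1 + u) / (1 - u)

/-- The disc bounded by a circle of Apollonius of the points `1` and `-1`. For `0 < ρ < 1` it is
the image under `cayley` of the disc of radius `ρ`; these discs exhaust the right half-plane. -/
def apolloniusDisc (ρ : ℝ) : Set ℂ := {z | ‖z - 1‖ < ρ * ‖z + 1‖}

/-- The boundary of `apolloniusDisc ρ`. -/
noncomputable def cayleyContour (ρ θ : ℝ) : ℂ := cayley (circleMap 0 ρ θ)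

/-- The density of `dz / (2πi)` along `cayleyContour ρ`, traversed clockwise so that the limiting
imaginary axis runs upwards. -/
noncomputable def cayleyDensity (ρ θ : ℝ) : ℂ :=
  -(circleMap 0 ρ θ / (Real.pi * (1 - circleMap 0 ρ θ) ^ 2))

/-- The integral of `F(z) dz / (2πi)` over the boundary of `apolloniusDisc ρ`, clockwise. -/
noncomputable def cayleyIntegral (ρ : ℝ) (F : ℂ → ℂ) : ℂ :=
  ∫ θ in (0 : ℝ)..2 * Real.pi, cayleyDensity ρ θ * F (cayleyContour ρ θ)

variable {ρ : ℝ} {u z : ℂ}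

theorem norm_sub_one_lt_norm_add_one_iff : ‖z - 1‖ < ‖z + 1‖ ↔ 0 < z.re := by
  rw [← sq_lt_sq₀ (norm_nonneg _) (norm_nonneg _), ← Complex.normSq_eq_norm_sq,
    ← Complex.normSq_eq_norm_sq, Complex.normSq_sub, Complex.normSq_add]
  simp only [map_one, mul_one]
  constructor <;> intro h <;> linarith

theorem isOpen_apolloniusDisc (ρ : ℝ) : IsOpen (apolloniusDisc ρ) :=
  isOpen_lt (by fun_prop) (by fun_prop)

theorem apolloniusDisc_mono : Monotone apolloniusDisc := fun _ _ h _ hz =>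
  lt_of_lt_of_le hz (mul_le_mul_of_nonneg_right h (norm_nonneg _))

theorem re_pos_of_mem_apolloniusDisc (hρ : ρ ≤ 1) (hz : z ∈ apolloniusDisc ρ) : 0 < z.re := by
  have hz1 : ‖z - 1‖ < 1 * ‖z + 1‖ := apolloniusDisc_mono hρ hz
  rwa [one_mul, norm_sub_one_lt_norm_add_one_iff] at hz1

theorem exists_subset_apolloniusDisc {S : Set ℂ} (hS : S.Finite) (hre : ∀ z ∈ S, 0 < z.re) :
    ∃ ρ ∈ Ioo (0 : ℝ) 1, S ⊆ apolloniusDisc ρ := by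
  have hev : ∀ᶠ ρ in 𝓝[<] (1 : ℝ), S ⊆ apolloniusDisc ρ := by
    refine (eventually_all_finite hS).2 fun z hz => ?_
    have hlim : Tendsto (fun ρ : ℝ => ρ * ‖z + 1‖) (𝓝[<] 1) (𝓝 (1 * ‖z + 1‖)) :=
      (Continuous.tendsto (by fun_prop) 1).mono_left nhdsWithin_le_nhds
    refine hlim.eventually_const_lt ?_
    rw [one_mul]
    exact norm_sub_one_lt_norm_add_one_iff.2 (hre z hz)
  obtain ⟨ρ, hSρ, hρ⟩ := (hev.and (Ioo_mem_nhdsLT (zero_lt_one (α := ℝ)))).exists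
  exact ⟨ρ, hρ, hSρ⟩

theorem cayley_sub_one (hu : 1 - u ≠ 0) : cayley u - 1 = 2 * u / (1 - u) := by
  rw [cayley]; field_simp; ring

theorem cayley_add_one (hu : 1 - u ≠ 0) : cayley u + 1 = 2 / (1 - u) := by
  rw [cayley]; field_simp; ring

theorem norm_cayley_sub_one (hu : 1 - u ≠ 0) : ‖cayley u - 1‖ = ‖u‖ * ‖cayley u + 1‖ := by
  rw [cayley_sub_one hu, cayley_add_one hu, norm_div, norm_mul, norm_div]; ring

theorem re_cayley_pos (hu : ‖u‖ < 1) : 0 < (cayley u).re := by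
  have hu1 := one_sub_ne_zero_of_norm_lt_one hu
  rw [← norm_sub_one_lt_norm_add_one_iff, norm_cayley_sub_one hu1]
  refine mul_lt_of_lt_one_left (norm_pos_iff.2 ?_) hu
  rw [cayley_add_one hu1]
  exact div_ne_zero two_ne_zero hu1

theorem differentiableAt_cayley (hu : 1 - u ≠ 0) : DifferentiableAt ℂ cayley u :=
  (by fun_prop : DifferentiableAt ℂ (fun u : ℂ => 1 + u) u).div (by fun_prop) hu

theorem norm_circleMap_zero_of_pos (hρ : 0 < ρ) (θ : ℝ) : ‖circleMap 0 ρ θ‖ = ρ := by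
  rw [norm_circleMap_zero, abs_of_pos hρ]

theorem one_sub_circleMap_ne_zero (hρ : ρ ∈ Ioo (0 : ℝ) 1) (θ : ℝ) : 1 - circleMap 0 ρ θ ≠ 0 :=
  one_sub_ne_zero_of_norm_lt_one (by rw [norm_circleMap_zero_of_pos hρ.1]; exact hρ.2)

theorem re_cayleyContour_pos (hρ : ρ ∈ Ioo (0 : ℝ) 1) (θ : ℝ) : 0 < (cayleyContour ρ θ).re :=
  re_cayley_pos (by rw [norm_circleMap_zero_of_pos hρ.1]; exact hρ.2)

theorem cayleyContour_notMem_apolloniusDisc (hρ : ρ ∈ Ioo (0 : ℝ) 1) (θ : ℝ) :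
    cayleyContour ρ θ ∉ apolloniusDisc ρ := fun h => by
  have hlt : ‖cayleyContour ρ θ - 1‖ < ρ * ‖cayleyContour ρ θ + 1‖ := h
  rw [cayleyContour, norm_cayley_sub_one (one_sub_circleMap_ne_zero hρ θ),
    norm_circleMap_zero_of_pos hρ.1] at hlt
  exact lt_irrefl _ hlt

theorem continuous_cayleyContour (hρ : ρ ∈ Ioo (0 : ℝ) 1) : Continuous (cayleyContour ρ) :=
  continuous_iff_continuousAt.2 fun θ =>
    (differentiableAt_cayley (one_sub_circleMap_ne_zero hρ θ)).continuousAt.comp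
      (continuous_circleMap 0 ρ).continuousAt

theorem continuous_cayleyDensity (hρ : ρ ∈ Ioo (0 : ℝ) 1) : Continuous (cayleyDensity ρ) :=
  ((continuous_circleMap 0 ρ).div (by fun_prop) fun θ =>
    mul_ne_zero (by exact_mod_cast Real.pi_ne_zero)
      (pow_ne_zero 2 (one_sub_circleMap_ne_zero hρ θ))).neg

theorem exists_cayley_eq {w : ℂ} (hρ : ρ < 1) (hw : w ∈ apolloniusDisc ρ) :
    ∃ v, ‖v‖ < ρ ∧ 1 - v ≠ 0 ∧ cayley v = w := by
  have hw1 : w + 1 ≠ 0 := fun h => by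
    have hlt : ‖w - 1‖ < ρ * ‖w + 1‖ := hw
    rw [h, norm_zero, mul_zero] at hlt
    exact absurd hlt (norm_nonneg _).not_gt
  have hv : ‖(w - 1) / (w + 1)‖ < ρ := by
    rw [norm_div, div_lt_iff₀ (norm_pos_iff.2 hw1)]
    exact hw
  have hv1 := one_sub_ne_zero_of_norm_lt_one (hv.trans hρ)
  refine ⟨_, hv, hv1, ?_⟩
  rw [cayley, div_eq_iff hv1]
  field_simp
  ring

theorem cayleyIntegral_cauchy (hρ : ρ ∈ Ioo (0 : ℝ) 1) {f : ℂ → ℂ}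
    (hf : ∀ z : ℂ, 0 < z.re → DifferentiableAt ℂ f z) {w : ℂ} (hw : w ∈ apolloniusDisc ρ) :
    cayleyIntegral ρ (fun z => f z / (w - z)) = f w := by
  obtain ⟨v, hvρ, hv1, rfl⟩ := exists_cayley_eq hρ.2 hw
  have hF : DifferentiableOn ℂ (fun u => f (cayley u) * ((1 - v) / (1 - u)))
      (Metric.closedBall 0 ρ) := fun u hu => by
    have hu1 : ‖u‖ < 1 := (mem_closedBall_zero_iff.1 hu).trans_lt hρ.2
    have hu2 := one_sub_ne_zero_of_norm_lt_one hu1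
    exact (((hf _ (re_cayley_pos hu1)).comp u (differentiableAt_cayley hu2)).mul
      ((differentiableAt_const _).div (by fun_prop) hu2)).differentiableWithinAt
  have hcauchy := hF.circleIntegral_sub_inv_smul (mem_ball_zero_iff.2 hvρ)
  rw [smul_eq_mul, div_self hv1, mul_one, ← inv_mul_eq_iff_eq_mul₀ Complex.two_pi_I_ne_zero,
    circleIntegral, ← intervalIntegral.integral_const_mul] at hcauchy
  rw [← hcauchy, cayleyIntegral]
  refine intervalIntegral.integral_congr fun θ _ => ?_
  simp only [deriv_circleMap, cayleyDensity, cayleyContour, smul_eq_mul]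
  have hu := one_sub_circleMap_ne_zero hρ θ
  have huv : circleMap 0 ρ θ - v ≠ 0 := fun h => by
    rw [← sub_eq_zero.1 h, norm_circleMap_zero_of_pos hρ.1] at hvρ
    exact lt_irrefl _ hvρ
  have hpi : (Real.pi : ℂ) ≠ 0 := by exact_mod_cast Real.pi_ne_zero
  generalize circleMap 0 ρ θ = u at *
  have hsub : cayley v - cayley u = -(2 * (u - v) / ((1 - u) * (1 - v))) := by
    rw [cayley, cayley]; field_simp; ring
  rw [hsub]
  field_simp

open Matrix in
theorem eventually_hasSum_matrixFunction_cayleyIntegral {ι : Type*} [Fintype ι] [DecidableEq ι]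
    {B : Matrix ι ι ℂ} (u v : ι → ℂ) {f : ℂ → ℂ} (hf : ∀ z : ℂ, 0 < z.re → AnalyticAt ℂ f z)
    (hρ : ρ ∈ Ioo (0 : ℝ) 1) (hB : spectrum ℂ B ⊆ apolloniusDisc ρ) :
    ∀ᶠ ζ : ℂ in 𝓝 0,
      IsMatrixFunction f (B - ζ • vecMulVec u v) (matrixFunction f (B - ζ • vecMulVec u v)) ∧
      HasSum
        (fun n => ζ ^ n • Matrix.of fun i j => cayleyIntegral ρ fun z =>
          f z * rankOneCoeff (B - z • (1 : Matrix ι ι ℂ)) u v n i j)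
        (matrixFunction f (B - ζ • vecMulVec u v)) := by
  have hψ : Continuous fun θ => cayleyDensity ρ θ * f (cayleyContour ρ θ) :=
    (continuous_cayleyDensity hρ).mul <| continuous_iff_continuousAt.2 fun θ =>
      (hf _ (re_cayleyContour_pos hρ θ)).continuousAt.comp
        (continuous_cayleyContour hρ).continuousAt
  have hcauchy : ∀ w ∈ apolloniusDisc ρ, ∫ θ in (0 : ℝ)..2 * Real.pi,
      cayleyDensity ρ θ * f (cayleyContour ρ θ) / (w - cayleyContour ρ θ) = f w := fun w hw => by
    simpa only [cayleyIntegral, mul_div_assoc] using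
      cayleyIntegral_cauchy hρ (fun z hz => (hf z hz).differentiableAt) hw
  simpa only [cayleyIntegral, mul_assoc] using eventually_hasSum_matrixFunction u v hψ
    (continuous_cayleyContour hρ) (isOpen_apolloniusDisc ρ) (cayleyContour_notMem_apolloniusDisc hρ)
    hB (fun z hz => hf z (re_pos_of_mem_apolloniusDisc hρ.2.le hz)) hcauchy

end Cayley

/-! ### Contour deformation -/

section SqrtDecay

/-- The majorant `(1 + t^{-1/2}) / (1 + t)²` of the integrands, as a function of `t = |z|`. -/
noncomputable def sqrtDecay (t : ℝ) : ℝ := (1 + t ^ (-(1 / 2) : ℝ)) / (1 + t) ^ 2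

theorem sqrtDecay_nonneg {t : ℝ} (ht : 0 ≤ t) : 0 ≤ sqrtDecay t := by
  unfold sqrtDecay; positivity

theorem sqrtDecay_anti {s t : ℝ} (hs : 0 < s) (hst : s ≤ t) : sqrtDecay t ≤ sqrtDecay s := by
  unfold sqrtDecay
  have hpow := Real.rpow_le_rpow_of_nonpos hs hst (by norm_num : (-(1 / 2) : ℝ) ≤ 0)
  gcongr

theorem tendsto_sqrtDecay : Tendsto sqrtDecay atTop (𝓝 0) := by
  refine tendsto_of_tendsto_of_tendsto_of_le_of_le' tendsto_const_nhds
    (tendsto_const_nhds.div_atTop tendsto_id : Tendsto (fun t : ℝ => 2 / t) atTop (𝓝 0)) ?_ ?_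
  · filter_upwards [eventually_ge_atTop 0] with t ht using sqrtDecay_nonneg ht
  · filter_upwards [eventually_ge_atTop 1] with t ht
    have hpow : t ^ (-(1 / 2) : ℝ) ≤ 1 := Real.rpow_le_one_of_one_le_of_nonpos ht (by norm_num)
    unfold sqrtDecay
    rw [div_le_div_iff₀ (by positivity) (by positivity)]
    nlinarith

theorem intervalIntegrable_abs_rpow_neg_half (a b : ℝ) :
    IntervalIntegrable (fun x : ℝ => |x| ^ (-(1 / 2) : ℝ)) volume a b := by
  have h := (intervalIntegral.intervalIntegrable_cpow' (a := a) (b := b)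
    (r := ((-(1 / 2) : ℝ) : ℂ)) (by rw [Complex.ofReal_re]; norm_num)).norm
  simpa only [Complex.norm_cpow_real, Complex.norm_real, Real.norm_eq_abs] using h

theorem sqrtDecay_abs_le (y : ℝ) : sqrtDecay |y| ≤
    (Ioc (-1) 1).indicator (fun y => |y| ^ (-(1 / 2) : ℝ)) y + 2 * (1 + y ^ 2)⁻¹ := by
  have hp : 0 ≤ |y| ^ (-(1 / 2) : ℝ) := Real.rpow_nonneg (abs_nonneg _) _
  have hsq : 1 + y ^ 2 ≤ (1 + |y|) ^ 2 := by nlinarith [abs_nonneg y, sq_abs y]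
  have hinv : 1 / (1 + |y|) ^ 2 ≤ (1 + y ^ 2)⁻¹ := by
    rw [one_div]; exact inv_anti₀ (by positivity) hsq
  have hinv0 : 0 ≤ (1 + y ^ 2)⁻¹ := by positivity
  rw [sqrtDecay, add_div]
  by_cases hy : y ∈ Ioc (-1 : ℝ) 1
  · rw [indicator_of_mem hy]
    have : |y| ^ (-(1 / 2) : ℝ) / (1 + |y|) ^ 2 ≤ |y| ^ (-(1 / 2) : ℝ) :=
      div_le_self hp (by nlinarith [abs_nonneg y])
    linarith
  · rw [indicator_of_notMem hy]
    have hy1 : 1 ≤ |y| := by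
      by_contra! hlt
      exact hy ⟨(abs_lt.1 hlt).1, (abs_lt.1 hlt).2.le⟩
    have hpow : |y| ^ (-(1 / 2) : ℝ) ≤ 1 := Real.rpow_le_one_of_one_le_of_nonpos hy1 (by norm_num)
    have : |y| ^ (-(1 / 2) : ℝ) / (1 + |y|) ^ 2 ≤ 1 / (1 + |y|) ^ 2 := by gcongr
    linarith

theorem integrable_sqrtDecay_abs : Integrable fun y : ℝ => sqrtDecay |y| := by
  have hnear : IntegrableOn (fun y : ℝ => |y| ^ (-(1 / 2) : ℝ)) (Ioc (-1) 1) :=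
    (intervalIntegrable_iff_integrableOn_Ioc_of_le (by norm_num)).1
      (intervalIntegrable_abs_rpow_neg_half (-1) 1)
  refine ((hnear.integrable_indicator measurableSet_Ioc).add
    (integrable_inv_one_add_sq.const_mul 2)).mono' ?_ (Eventually.of_forall fun y => ?_)
  · unfold sqrtDecay
    exact Measurable.aestronglyMeasurable (by fun_prop)
  · rw [Real.norm_of_nonneg (sqrtDecay_nonneg (abs_nonneg y))]
    exact sqrtDecay_abs_le y

end SqrtDecay

section HalfStrip

open scoped ComplexConjugate

theorem tendsto_integral_inv_Ioi {f : ℝ → ℂ} (hf : IntegrableOn f (Ioi 0)) :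
    Tendsto (fun Y : ℝ => ∫ y in Y⁻¹..Y, f y) atTop (𝓝 (∫ y in Ioi 0, f y)) := by
  have hcover : AECover (volume.restrict (Ioi (0 : ℝ))) atTop fun Y : ℝ => Ioc Y⁻¹ Y :=
    (aecover_Ioi_of_Ioi tendsto_inv_atTop_zero).inter (aecover_Iic tendsto_id).restrict
  refine (hcover.integral_tendsto_of_countably_generated hf).congr' ?_
  filter_upwards [eventually_ge_atTop 1] with Y hY
  have hY0 : 0 < Y⁻¹ := by positivity
  rw [intervalIntegral.integral_of_le ((inv_le_one_of_one_le₀ hY).trans hY),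
    Measure.restrict_restrict measurableSet_Ioc,
    inter_eq_self_of_subset_left (Ioc_subset_Ioi_self.trans (Ioi_subset_Ioi hY0.le))]

/-- `g` is holomorphic on the half-strip `-ξ ≤ Re z ≤ 0 < Im z`, where it is `O(|z|^{-1/2})` at the
origin and `O(|z|^{-2})` at infinity, and has the boundary values `g₀ λ` at the points `-λ` of the
open base. -/
structure HasHalfStripBoundary (ξ C : ℝ) (g : ℂ → ℂ) (g₀ : ℝ → ℂ) : Prop where
  differentiableAt : ∀ z : ℂ, z.re ∈ Icc (-ξ) 0 → 0 < z.im → DifferentiableAt ℂ g z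
  norm_le : ∀ z : ℂ, z.re ∈ Icc (-ξ) 0 → 0 < z.im → ‖g z‖ ≤ C * sqrtDecay ‖z‖
  tendsto : ∀ lam ∈ Ioo 0 ξ,
    Tendsto (fun y : ℝ => g (-(lam : ℂ) + Complex.I * y)) (𝓝[>] 0) (𝓝 (g₀ lam))

namespace HasHalfStripBoundary

variable {ξ C x y : ℝ} {g : ℂ → ℂ} {g₀ : ℝ → ℂ}

theorem continuousAt_ofReal_add_I_mul (h : HasHalfStripBoundary ξ C g g₀) (hx : x ∈ Icc (-ξ) 0)
    (hy : 0 < y) : ContinuousAt g (x + Complex.I * y) :=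
  (h.differentiableAt _ (by simpa using hx) (by simpa using hy)).continuousAt

theorem norm_le_im (h : HasHalfStripBoundary ξ C g g₀) (hC : 0 ≤ C) (hx : x ∈ Icc (-ξ) 0)
    (hy : 0 < y) : ‖g (x + Complex.I * y)‖ ≤ C * sqrtDecay |y| := by
  refine (h.norm_le _ (by simpa using hx) (by simpa using hy)).trans ?_
  have hle := Complex.abs_im_le_norm ((x : ℂ) + Complex.I * y)
  have him : ((x : ℂ) + Complex.I * y).im = y := by simp
  rw [him] at hle
  exact mul_le_mul_of_nonneg_left (sqrtDecay_anti (abs_pos.2 hy.ne') hle) hC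

theorem norm_le_re (h : HasHalfStripBoundary ξ C g g₀) (hC : 0 ≤ C) (hx : x ∈ Ico (-ξ) 0)
    (hy : 0 < y) : ‖g (x + Complex.I * y)‖ ≤ C * sqrtDecay |x| := by
  refine (h.norm_le _ (by simpa using ⟨hx.1, hx.2.le⟩) (by simpa using hy)).trans ?_
  have hle := Complex.abs_re_le_norm ((x : ℂ) + Complex.I * y)
  have hre : ((x : ℂ) + Complex.I * y).re = x := by simp
  rw [hre] at hle
  exact mul_le_mul_of_nonneg_left (sqrtDecay_anti (abs_pos.2 hx.2.ne) hle) hC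

theorem integrableOn_vertical (h : HasHalfStripBoundary ξ C g g₀) (hC : 0 ≤ C)
    (hx : x ∈ Icc (-ξ) 0) : IntegrableOn (fun y : ℝ => g (x + Complex.I * y)) (Ioi 0) := by
  refine Integrable.mono' (integrable_sqrtDecay_abs.integrableOn.const_mul C) ?_ ?_
  · refine ContinuousOn.aestronglyMeasurable (fun y hy => ?_) measurableSet_Ioi
    exact (ContinuousAt.comp (f := fun y : ℝ => (x : ℂ) + Complex.I * y)
      (h.continuousAt_ofReal_add_I_mul hx hy) (by fun_prop)).continuousWithinAt
  · rw [ae_restrict_iff' measurableSet_Ioi]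
    exact Eventually.of_forall fun y hy => h.norm_le_im hC hx hy

theorem integrableOn_vertical_conj {g' : ℂ → ℂ} (h : HasHalfStripBoundary ξ C g g₀)
    (hconj : ∀ z : ℂ, 0 < z.im → g' (conj z) = conj (g z)) (hC : 0 ≤ C) (hx : x ∈ Icc (-ξ) 0) :
    IntegrableOn (fun y : ℝ => g' (x - Complex.I * y)) (Ioi 0) := by
  refine (Complex.conjCLE.toContinuousLinearMap.integrable_comp
    (h.integrableOn_vertical hC hx)).congr ?_
  filter_upwards [ae_restrict_mem measurableSet_Ioi] with y hy
  rw [ContinuousLinearEquiv.coe_coe, Complex.conjCLE_apply, ← hconj _ (by simpa using hy)]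
  simp [sub_eq_add_neg]

theorem aestronglyMeasurable_horizontal (h : HasHalfStripBoundary ξ C g g₀) (hy : 0 < y) :
    AEStronglyMeasurable (fun lam : ℝ => g (-(lam : ℂ) + Complex.I * y))
      (volume.restrict (Ioc 0 ξ)) := by
  refine ContinuousOn.aestronglyMeasurable (fun lam hlam => ?_) measurableSet_Ioc
  have hg := h.continuousAt_ofReal_add_I_mul (x := -lam)
    ⟨by linarith [hlam.2], by linarith [hlam.1]⟩ hy
  rw [Complex.ofReal_neg] at hg
  exact (ContinuousAt.comp (f := fun lam : ℝ => -(lam : ℂ) + Complex.I * y) hg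
    (by fun_prop)).continuousWithinAt

theorem norm_le_of_mem_Ioc (h : HasHalfStripBoundary ξ C g g₀) (hC : 0 ≤ C) {lam : ℝ}
    (hlam : lam ∈ Ioc 0 ξ) (hy : 0 < y) :
    ‖g (-(lam : ℂ) + Complex.I * y)‖ ≤ C * sqrtDecay |lam| := by
  have hle := h.norm_le_re hC (x := -lam) ⟨by linarith [hlam.2], by linarith [hlam.1]⟩ hy
  rwa [Complex.ofReal_neg, abs_neg] at hle

theorem ae_tendsto (h : HasHalfStripBoundary ξ C g g₀) : ∀ᵐ lam : ℝ ∂volume.restrict (Ioc 0 ξ),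
    Tendsto (fun y : ℝ => g (-(lam : ℂ) + Complex.I * y)) (𝓝[>] 0) (𝓝 (g₀ lam)) := by
  rw [ae_restrict_iff' measurableSet_Ioc]
  filter_upwards [Measure.ae_ne volume ξ] with lam hne hlam
  exact h.tendsto lam ⟨hlam.1, lt_of_le_of_ne hlam.2 hne⟩

theorem intervalIntegrable_boundary (h : HasHalfStripBoundary ξ C g g₀) (hξ : 0 < ξ)
    (hC : 0 ≤ C) : IntervalIntegrable g₀ volume 0 ξ := by
  refine (integrable_sqrtDecay_abs.const_mul C).intervalIntegrable.mono_fun' ?_ ?_ <;>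
    rw [uIoc_of_le hξ.le]
  · refine aestronglyMeasurable_of_tendsto_ae (atTop : Filter ℝ)
      (f := fun (Y lam : ℝ) => g (-(lam : ℂ) + Complex.I * ((max 1 Y)⁻¹ : ℝ)))
      (fun Y => h.aestronglyMeasurable_horizontal (by positivity)) ?_
    filter_upwards [h.ae_tendsto] with lam hlim
    exact hlim.comp (tendsto_inv_atTop_nhdsGT_zero.comp
      (tendsto_atTop_mono (fun Y => le_max_right 1 Y) tendsto_id))
  · filter_upwards [h.ae_tendsto, ae_restrict_mem measurableSet_Ioc] with lam hlim hlam
    refine le_of_tendsto hlim.norm ?_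
    filter_upwards [self_mem_nhdsWithin] with y hy using h.norm_le_of_mem_Ioc hC hlam hy

theorem intervalIntegrable_conj_boundary (h : HasHalfStripBoundary ξ C g g₀) (hξ : 0 < ξ)
    (hC : 0 ≤ C) : IntervalIntegrable (fun lam => conj (g₀ lam)) volume 0 ξ :=
  intervalIntegrable_iff.2 (Complex.conjCLE.toContinuousLinearMap.integrable_comp
    (intervalIntegrable_iff.1 (h.intervalIntegrable_boundary hξ hC)))

theorem tendsto_integral_bottom (h : HasHalfStripBoundary ξ C g g₀) (hξ : 0 < ξ) (hC : 0 ≤ C) :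
    Tendsto (fun y : ℝ => ∫ lam in (0 : ℝ)..ξ, g (-(lam : ℂ) + Complex.I * y)) (𝓝[>] 0)
      (𝓝 (∫ lam in (0 : ℝ)..ξ, g₀ lam)) := by
  have hIoc : uIoc 0 ξ = Ioc 0 ξ := uIoc_of_le hξ.le
  refine intervalIntegral.tendsto_integral_filter_of_dominated_convergence _ ?_ ?_
    (integrable_sqrtDecay_abs.const_mul C).intervalIntegrable ?_
  · filter_upwards [self_mem_nhdsWithin] with y hy
    rw [hIoc]
    exact h.aestronglyMeasurable_horizontal hy
  · filter_upwards [self_mem_nhdsWithin] with y hy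
    rw [hIoc]
    exact Eventually.of_forall fun lam hlam => h.norm_le_of_mem_Ioc hC hlam hy
  · rw [hIoc, ← ae_restrict_iff' measurableSet_Ioc]
    exact h.ae_tendsto

theorem tendsto_integral_top (h : HasHalfStripBoundary ξ C g g₀) (hξ : 0 < ξ) (hC : 0 ≤ C) :
    Tendsto (fun y : ℝ => ∫ lam in (0 : ℝ)..ξ, g (-(lam : ℂ) + Complex.I * y)) atTop (𝓝 0) := by
  have hmaj : Tendsto (fun y : ℝ => C * sqrtDecay |y| * |ξ - 0|) atTop (𝓝 0) := by
    simpa using ((tendsto_sqrtDecay.comp tendsto_abs_atTop_atTop).const_mul C).mul_const |ξ - 0|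
  refine squeeze_zero_norm' ?_ hmaj
  filter_upwards [eventually_gt_atTop 0] with y hy
  refine intervalIntegral.norm_integral_le_of_norm_le_const fun lam hlam => ?_
  rw [uIoc_of_le hξ.le] at hlam
  simpa using h.norm_le_im hC (x := -lam) ⟨by linarith [hlam.2], by linarith [hlam.1]⟩ hy

theorem integral_rectangle (h : HasHalfStripBoundary ξ C g g₀) (hξ : 0 < ξ) {a b : ℝ} (ha : 0 < a)
    (hab : a ≤ b) :
    (∫ lam in (0 : ℝ)..ξ, g (-(lam : ℂ) + Complex.I * a)) -
      (∫ lam in (0 : ℝ)..ξ, g (-(lam : ℂ) + Complex.I * b)) +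
      Complex.I * (∫ y in a..b, g (((0 : ℝ) : ℂ) + Complex.I * y)) -
      Complex.I * (∫ y in a..b, g (((-ξ : ℝ) : ℂ) + Complex.I * y)) = 0 := by
  have hrect := Complex.integral_boundary_rect_eq_zero_of_differentiableOn g ⟨-ξ, a⟩ ⟨0, b⟩
    fun z hz => by
      rw [Complex.mem_reProdIm] at hz
      simp only [uIcc_of_le (neg_nonpos.2 hξ.le), uIcc_of_le hab] at hz
      exact (h.differentiableAt z hz.1 (ha.trans_le hz.2.1)).differentiableWithinAt
  have hflip : ∀ y : ℝ, ∫ lam in (0 : ℝ)..ξ, g (-(lam : ℂ) + Complex.I * y) =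
      ∫ x in -ξ..0, g (x + y * Complex.I) := fun y => by
    have hneg := intervalIntegral.integral_comp_neg (a := 0) (b := ξ)
      fun x : ℝ => g (x + y * Complex.I)
    simpa only [neg_zero, Complex.ofReal_neg, mul_comm Complex.I] using hneg
  rw [hflip, hflip]
  simpa only [smul_eq_mul, mul_comm Complex.I] using hrect

theorem integral_vertical (h : HasHalfStripBoundary ξ C g g₀) (hξ : 0 < ξ) (hC : 0 ≤ C) :
    Complex.I * ∫ y in Ioi (0 : ℝ), g (((-ξ : ℝ) : ℂ) + Complex.I * y) =
      Complex.I * (∫ y in Ioi (0 : ℝ), g (((0 : ℝ) : ℂ) + Complex.I * y)) +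
        ∫ lam in (0 : ℝ)..ξ, g₀ lam := by
  have hbottom := (h.tendsto_integral_bottom hξ hC).comp tendsto_inv_atTop_nhdsGT_zero
  have hright := (tendsto_integral_inv_Ioi (h.integrableOn_vertical hC
    (right_mem_Icc.2 (neg_nonpos.2 hξ.le)))).const_mul Complex.I
  have hleft := (tendsto_integral_inv_Ioi (h.integrableOn_vertical hC
    (left_mem_Icc.2 (neg_nonpos.2 hξ.le)))).const_mul Complex.I
  have hlim := ((hbottom.sub (h.tendsto_integral_top hξ hC)).add hright).sub hleft
  have hzero := hlim.congr' (f₂ := fun _ => 0) <| by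
    filter_upwards [eventually_ge_atTop 1] with Y hY
    have hY0 : 0 < Y := by positivity
    exact h.integral_rectangle hξ (inv_pos.2 hY0) ((inv_le_one_of_one_le₀ hY).trans hY)
  linear_combination -tendsto_nhds_unique hzero tendsto_const_nhds

end HasHalfStripBoundary

/-- Cauchy's theorem for the strip `-ξ < Re z < 0` slit along the negative real axis. The lower
half is the mirror image of the upper half, in which `g'` is the reflection of `g`. -/
theorem verticalIntegral_zero_eq {ξ C : ℝ} {g g' : ℂ → ℂ} {g₀ g₀' : ℝ → ℂ}
    (h : HasHalfStripBoundary ξ C g g₀) (h' : HasHalfStripBoundary ξ C g' g₀')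
    (hconj : ∀ z : ℂ, 0 < z.im → g (conj z) = conj (g' z)) (hξ : 0 < ξ) (hC : 0 ≤ C) :
    verticalIntegral 0 g =
      verticalIntegral ξ g + ∫ lam in (0 : ℝ)..ξ, (conj (g₀' lam) - g₀ lam) := by
  have hreflect : ∀ x : ℝ, ∫ y in Ioi (0 : ℝ), g (x - Complex.I * y) =
      conj (∫ y in Ioi (0 : ℝ), g' (x + Complex.I * y)) := fun x => by
    rw [← integral_conj]
    refine setIntegral_congr_fun measurableSet_Ioi fun y hy => ?_
    rw [← hconj _ (by simpa using hy)]
    simp [sub_eq_add_neg]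
  have hvert : ∀ t : ℝ, verticalIntegral t g =
      Complex.I * (∫ y in Ioi (0 : ℝ), g (((-t : ℝ) : ℂ) + Complex.I * y)) +
        Complex.I * conj (∫ y in Ioi (0 : ℝ), g' (((-t : ℝ) : ℂ) + Complex.I * y)) := fun t => by
    rw [← hreflect, verticalIntegral, integral_mul_const, integral_mul_const, mul_comm,
      mul_comm _ Complex.I]
    push_cast
    rfl
  have hupper := h.integral_vertical hξ hC
  have hlower := congrArg conj (h'.integral_vertical hξ hC)
  simp only [map_mul, map_add, Complex.conj_I] at hlower
  have hconj_int : conj (∫ lam in (0 : ℝ)..ξ, g₀' lam) = ∫ lam in (0 : ℝ)..ξ, conj (g₀' lam) := by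
    simp only [intervalIntegral.integral_of_le hξ.le, integral_conj]
  rw [hvert, hvert, intervalIntegral.integral_sub (h'.intervalIntegrable_conj_boundary hξ hC)
    (h.intervalIntegrable_boundary hξ hC), ← hconj_int, neg_zero]
  linear_combination hlower - hupper

end HalfStrip

section CayleyLimit

variable {ρ ρ₀ θ : ℝ}

theorem abs_sub_pi_le_norm_one_add_circleMap (hρ : ρ ∈ Ioc (0 : ℝ) 1)
    (hθ : θ ∈ Icc 0 (2 * Real.pi)) : |θ - Real.pi| / Real.pi ≤ ‖1 + circleMap 0 ρ θ‖ := by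
  have hsin : |θ - Real.pi| / Real.pi ≤ |Real.sin ((θ - Real.pi) / 2)| := by
    have hjordan := Real.mul_abs_le_abs_sin (x := (θ - Real.pi) / 2)
      (abs_le.2 ⟨by linarith [hθ.1], by linarith [hθ.2]⟩)
    have hpi := Real.pi_pos
    rwa [abs_div, abs_two, div_mul_div_comm, mul_comm Real.pi, mul_div_mul_left _ _ two_ne_zero]
      at hjordan
  have hsin_sq : Real.sin ((θ - Real.pi) / 2) ^ 2 = (1 + Real.cos θ) / 2 := by
    rw [sub_div, Real.sin_sub_pi_div_two, neg_sq, Real.cos_sq]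
    ring_nf
  have hnorm_sq : ‖1 + circleMap 0 ρ θ‖ ^ 2 = 1 + 2 * ρ * Real.cos θ + ρ ^ 2 := by
    have hre : (1 + circleMap 0 ρ θ).re = 1 + ρ * Real.cos θ := by
      simp [circleMap, Complex.exp_ofReal_mul_I_re]
    have him : (1 + circleMap 0 ρ θ).im = ρ * Real.sin θ := by
      simp [circleMap, Complex.exp_ofReal_mul_I_im]
    rw [← Complex.normSq_eq_norm_sq, Complex.normSq_apply, hre, him]
    linear_combination ρ ^ 2 * Real.sin_sq_add_cos_sq θ
  have hsq : Real.sin ((θ - Real.pi) / 2) ^ 2 ≤ ‖1 + circleMap 0 ρ θ‖ ^ 2 := by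
    rw [hsin_sq, hnorm_sq]
    rcases le_total 0 (Real.cos θ) with hc | hc
    · nlinarith [mul_nonneg hρ.1.le hc, Real.cos_le_one θ, sq_nonneg ρ]
    · nlinarith [sq_nonneg (ρ + Real.cos θ), Real.neg_one_le_cos θ]
  exact hsin.trans (abs_le_of_sq_le_sq hsq (norm_nonneg _))

theorem abs_sub_pi_le_norm_cayleyContour (hρ : ρ ∈ Ioc (0 : ℝ) 1) (hne : 1 - circleMap 0 ρ θ ≠ 0)
    (hθ : θ ∈ Icc 0 (2 * Real.pi)) :
    |θ - Real.pi| / (2 * Real.pi) ≤ ‖cayleyContour ρ θ‖ := by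
  have hden : ‖1 - circleMap 0 ρ θ‖ ≤ 2 := (norm_sub_le _ _).trans (by
    rw [norm_circleMap_zero_of_pos hρ.1, norm_one]
    linarith [hρ.2])
  rw [cayleyContour, cayley, norm_div, le_div_iff₀ (norm_pos_iff.2 hne)]
  have := Real.pi_pos
  calc |θ - Real.pi| / (2 * Real.pi) * ‖1 - circleMap 0 ρ θ‖
      ≤ |θ - Real.pi| / (2 * Real.pi) * 2 := by gcongr
    _ = |θ - Real.pi| / Real.pi := by field_simp
    _ ≤ ‖1 + circleMap 0 ρ θ‖ := abs_sub_pi_le_norm_one_add_circleMap hρ hθ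

theorem norm_cayleyDensity_le (hρ : ρ ∈ Ioo (0 : ℝ) 1) (θ : ℝ) :
    ‖cayleyDensity ρ θ‖ ≤ (1 + ‖cayleyContour ρ θ‖) ^ 2 := by
  have hdist : 2 / ‖1 - circleMap 0 ρ θ‖ ≤ 1 + ‖cayleyContour ρ θ‖ := by
    have h := cayley_add_one (one_sub_circleMap_ne_zero hρ θ)
    rw [← Complex.norm_two, ← norm_div, ← h, add_comm]
    exact (norm_add_le _ _).trans_eq (by rw [norm_one, cayleyContour])
  calc ‖cayleyDensity ρ θ‖
      = ρ / Real.pi * (1 / ‖1 - circleMap 0 ρ θ‖ ^ 2) := by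
        rw [cayleyDensity, norm_neg, norm_div, norm_mul, norm_pow,
          norm_circleMap_zero_of_pos hρ.1, Complex.norm_real, Real.norm_eq_abs,
          abs_of_pos Real.pi_pos, div_mul_div_comm, mul_one]
    _ ≤ 1 * (4 / ‖1 - circleMap 0 ρ θ‖ ^ 2) := by
        gcongr
        · exact (div_le_one Real.pi_pos).2 (by linarith [hρ.2, Real.pi_gt_three])
        · norm_num
    _ = (2 / ‖1 - circleMap 0 ρ θ‖) ^ 2 := by rw [one_mul, div_pow]; norm_num
    _ ≤ (1 + ‖cayleyContour ρ θ‖) ^ 2 := by gcongr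

theorem circleMap_two_mul_add_pi (t : ℝ) :
    circleMap 0 1 (2 * t + Real.pi) = -Complex.exp (t * Complex.I) ^ 2 := by
  rw [circleMap, ← Complex.exp_nat_mul]
  push_cast
  rw [add_mul, Complex.exp_add, Complex.exp_pi_mul_I]
  ring_nf

theorem one_add_exp_mul_I_sq (z : ℂ) :
    1 + Complex.exp (z * Complex.I) ^ 2 = 2 * Complex.cos z * Complex.exp (z * Complex.I) := by
  rw [Complex.cos, neg_mul, Complex.exp_neg]
  field_simp
  ring

theorem one_sub_exp_mul_I_sq (z : ℂ) :
    1 - Complex.exp (z * Complex.I) ^ 2 =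
      -(Complex.I * (2 * Complex.sin z * Complex.exp (z * Complex.I))) := by
  rw [Complex.sin, neg_mul, Complex.exp_neg]
  field_simp
  rw [Complex.I_sq]
  ring

theorem cayleyContour_one_two_mul_add_pi (t : ℝ) :
    cayleyContour 1 (2 * t + Real.pi) = -(Complex.I * Real.tan t) := by
  rw [cayleyContour, cayley, circleMap_two_mul_add_pi, sub_neg_eq_add, ← sub_eq_add_neg,
    one_add_exp_mul_I_sq, one_sub_exp_mul_I_sq, neg_div, mul_div_assoc,
    mul_div_mul_right _ _ (Complex.exp_ne_zero _), mul_div_mul_left _ _ two_ne_zero,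
    Complex.ofReal_tan, Complex.tan]

theorem cayleyDensity_one_two_mul_add_pi (t : ℝ) :
    cayleyDensity 1 (2 * t + Real.pi) = ((4 * Real.pi * Real.cos t ^ 2)⁻¹ : ℝ) := by
  rw [cayleyDensity, circleMap_two_mul_add_pi, sub_neg_eq_add, one_add_exp_mul_I_sq, mul_pow,
    neg_div, neg_neg, ← mul_assoc]
  rw [div_mul_cancel_right₀ (pow_ne_zero 2 (Complex.exp_ne_zero _))]
  push_cast
  ring

theorem re_cayleyContour_one (θ : ℝ) : (cayleyContour 1 θ).re = 0 := by
  have h := cayleyContour_one_two_mul_add_pi ((θ - Real.pi) / 2)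
  rw [mul_div_cancel₀ _ two_ne_zero, sub_add_cancel] at h
  rw [h, Complex.neg_re, Complex.I_mul_re, Complex.ofReal_im, neg_zero, neg_zero]

theorem one_sub_circleMap_one_ne_zero (hθ : θ ∈ Ioo 0 (2 * Real.pi)) :
    1 - circleMap 0 1 θ ≠ 0 := by
  intro h
  have hcos : Real.cos θ = 1 := by
    have := congrArg Complex.re (sub_eq_zero.1 h).symm
    simpa [circleMap, Complex.exp_ofReal_mul_I_re] using this
  rw [Real.cos_eq_one_iff_of_lt_of_lt (by linarith [hθ.1, Real.pi_pos]) hθ.2] at hcos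
  exact hθ.1.ne' hcos

theorem ae_mem_Ioo_ne_pi :
    ∀ᵐ θ : ℝ, θ ∈ uIoc 0 (2 * Real.pi) → θ ∈ Ioo 0 (2 * Real.pi) ∧ 0 < |θ - Real.pi| := by
  filter_upwards [Measure.ae_ne volume (2 * Real.pi), Measure.ae_ne volume Real.pi]
    with θ hne hne' hθ
  rw [uIoc_of_le Real.two_pi_pos.le] at hθ
  exact ⟨⟨hθ.1, lt_of_le_of_ne hθ.2 hne⟩, abs_pos.2 (sub_ne_zero.2 hne')⟩

theorem continuousAt_circleMap_radius (θ : ℝ) : ContinuousAt (fun ρ : ℝ => circleMap 0 ρ θ) 1 := by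
  unfold circleMap
  fun_prop

theorem continuousAt_cayleyContour_radius (hθ : θ ∈ Ioo 0 (2 * Real.pi)) :
    ContinuousAt (fun ρ => cayleyContour ρ θ) 1 :=
  (differentiableAt_cayley (one_sub_circleMap_one_ne_zero hθ)).continuousAt.comp
    (f := fun ρ => circleMap 0 ρ θ) (continuousAt_circleMap_radius θ)

theorem continuousAt_cayleyDensity_radius (hθ : θ ∈ Ioo 0 (2 * Real.pi)) :
    ContinuousAt (fun ρ => cayleyDensity ρ θ) 1 := by
  have hcircle := continuousAt_circleMap_radius θ
  exact (hcircle.div (continuousAt_const.mul ((continuousAt_const.sub hcircle).pow 2))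
    (mul_ne_zero (Complex.ofReal_ne_zero.2 Real.pi_ne_zero)
      (pow_ne_zero 2 (one_sub_circleMap_one_ne_zero hθ)))).neg

section Limit

variable {g : ℂ → ℂ} {C : ℝ}

theorem norm_cayleyDensity_mul_le (hρ : ρ ∈ Ioo (0 : ℝ) 1) (hC : 0 ≤ C)
    (hθ : θ ∈ Ioo 0 (2 * Real.pi)) (hθ' : 0 < |θ - Real.pi|)
    (hg : ‖g (cayleyContour ρ θ)‖ ≤ C * sqrtDecay ‖cayleyContour ρ θ‖) :
    ‖cayleyDensity ρ θ * g (cayleyContour ρ θ)‖ ≤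
      C * (1 + |θ - Real.pi| ^ (-(1 / 2) : ℝ) / (2 * Real.pi) ^ (-(1 / 2) : ℝ)) := by
  have hpi := Real.two_pi_pos
  have hlow := abs_sub_pi_le_norm_cayleyContour ⟨hρ.1, hρ.2.le⟩ (one_sub_circleMap_ne_zero hρ θ)
    (Ioo_subset_Icc_self hθ)
  rw [norm_mul]
  calc ‖cayleyDensity ρ θ‖ * ‖g (cayleyContour ρ θ)‖
      ≤ (1 + ‖cayleyContour ρ θ‖) ^ 2 * (C * sqrtDecay ‖cayleyContour ρ θ‖) := by
        gcongr
        exact norm_cayleyDensity_le hρ θ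
    _ = C * (1 + ‖cayleyContour ρ θ‖ ^ (-(1 / 2) : ℝ)) := by
        unfold sqrtDecay
        field_simp
    _ ≤ C * (1 + (|θ - Real.pi| / (2 * Real.pi)) ^ (-(1 / 2) : ℝ)) := by
        gcongr C * (1 + ?_)
        exact Real.rpow_le_rpow_of_nonpos (by positivity) hlow (by norm_num)
    _ = _ := by rw [Real.div_rpow (abs_nonneg _) hpi.le]

theorem tendsto_cayleyIntegral (hρ₀ : ρ₀ ∈ Ioo (0 : ℝ) 1) (hC : 0 ≤ C)
    (hcont : ∀ z, 0 ≤ z.re → z ≠ 0 → z ∉ apolloniusDisc ρ₀ → ContinuousAt g z)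
    (hbound : ∀ z, 0 ≤ z.re → z ≠ 0 → z ∉ apolloniusDisc ρ₀ → ‖g z‖ ≤ C * sqrtDecay ‖z‖) :
    Tendsto (fun ρ => cayleyIntegral ρ g) (𝓝[<] 1) (𝓝 (cayleyIntegral 1 g)) := by
  have hradius : ∀ᶠ ρ in 𝓝[<] (1 : ℝ), ρ ∈ Ioo ρ₀ 1 := Ioo_mem_nhdsLT hρ₀.2
  have hcircle : ∀ ρ ∈ Ioo ρ₀ 1, ρ ∈ Ioo (0 : ℝ) 1 := fun ρ hρ => ⟨hρ₀.1.trans hρ.1, hρ.2⟩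
  have hout : ∀ ρ ∈ Ioo ρ₀ 1, ∀ θ, 0 ≤ (cayleyContour ρ θ).re ∧ cayleyContour ρ θ ≠ 0 ∧
      cayleyContour ρ θ ∉ apolloniusDisc ρ₀ := fun ρ hρ θ => by
    have hre := re_cayleyContour_pos (hcircle ρ hρ) θ
    refine ⟨hre.le, fun h => by simp [h] at hre, fun hmem => ?_⟩
    exact cayleyContour_notMem_apolloniusDisc (hcircle ρ hρ) θ (apolloniusDisc_mono hρ.1.le hmem)
  refine intervalIntegral.tendsto_integral_filter_of_dominated_convergence
    (fun θ => C * (1 + |θ - Real.pi| ^ (-(1 / 2) : ℝ) / (2 * Real.pi) ^ (-(1 / 2) : ℝ)))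
    ?_ ?_ ?_ ?_
  · filter_upwards [hradius] with ρ hρ
    refine Continuous.aestronglyMeasurable ((continuous_cayleyDensity (hcircle ρ hρ)).mul
      (continuous_iff_continuousAt.2 fun θ => ?_))
    obtain ⟨hre, hne, hmem⟩ := hout ρ hρ θ
    exact ContinuousAt.comp (hcont _ hre hne hmem)
      (continuous_cayleyContour (hcircle ρ hρ)).continuousAt
  · filter_upwards [hradius] with ρ hρ
    filter_upwards [ae_mem_Ioo_ne_pi] with θ hae hθ
    obtain ⟨hre, hne, hmem⟩ := hout ρ hρ θ
    exact norm_cayleyDensity_mul_le (hcircle ρ hρ) hC (hae hθ).1 (hae hθ).2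
      (hbound _ hre hne hmem)
  · refine (intervalIntegrable_const.add (IntervalIntegrable.div_const ?_ _)).const_mul _
    simpa using (intervalIntegrable_abs_rpow_neg_half (0 - Real.pi)
      (2 * Real.pi - Real.pi)).comp_sub_right Real.pi
  · filter_upwards [ae_mem_Ioo_ne_pi] with θ hae hθ
    obtain ⟨hθ, hθ'⟩ := hae hθ
    have hne : cayleyContour 1 θ ≠ 0 := norm_pos_iff.1 <|
      (div_pos hθ' Real.two_pi_pos).trans_le <| abs_sub_pi_le_norm_cayleyContour
        ⟨one_pos, le_rfl⟩ (one_sub_circleMap_one_ne_zero hθ) (Ioo_subset_Icc_self hθ)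
    have hlim := hcont _ (re_cayleyContour_one θ).ge hne fun hmem =>
      (re_pos_of_mem_apolloniusDisc hρ₀.2.le hmem).ne' (re_cayleyContour_one θ)
    exact ((continuousAt_cayleyDensity_radius hθ).mul (hlim.comp
      (f := fun ρ => cayleyContour ρ θ) (continuousAt_cayleyContour_radius hθ))).tendsto.mono_left
        nhdsWithin_le_nhds

end Limit

theorem cayleyIntegral_one (g : ℂ → ℂ) :
    cayleyIntegral 1 g = (2 * Real.pi : ℂ)⁻¹ * ∫ y : ℝ, g (Complex.I * y) := by
  have htan := integral_image_eq_integral_abs_deriv_smul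
    (measurableSet_Ioo (a := -(Real.pi / 2)) (b := Real.pi / 2))
    (fun t ht => (Real.hasDerivAt_tan (Real.cos_pos_of_mem_Ioo ht).ne').hasDerivWithinAt)
    Real.injOn_tan (fun y : ℝ => g (-(Complex.I * y)))
  have hflip : ∫ y : ℝ, g (-(Complex.I * y)) = ∫ y : ℝ, g (Complex.I * y) := by
    simpa using integral_neg_eq_self (fun y : ℝ => g (Complex.I * y)) volume
  have hhalf := intervalIntegral.smul_integral_comp_mul_add (a := -(Real.pi / 2))
    (b := Real.pi / 2) (fun θ => cayleyDensity 1 θ * g (cayleyContour 1 θ)) 2 Real.pi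
  rw [mul_neg, mul_div_cancel₀ _ two_ne_zero, neg_add_cancel, ← two_mul] at hhalf
  rw [Real.image_tan_Ioo, Measure.restrict_univ] at htan
  rw [cayleyIntegral, ← hhalf, ← hflip, htan,
    intervalIntegral.integral_of_le (by linarith [Real.pi_pos]), integral_Ioc_eq_integral_Ioo,
    Complex.real_smul, ← integral_const_mul, ← integral_const_mul]
  refine setIntegral_congr_fun measurableSet_Ioo fun t ht => ?_
  have hcos : (Complex.cos t) ≠ 0 := by
    exact_mod_cast (Real.cos_pos_of_mem_Ioo ht).ne'
  rw [cayleyContour_one_two_mul_add_pi, cayleyDensity_one_two_mul_add_pi, Complex.real_smul,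
    abs_of_nonneg (by positivity)]
  push_cast
  field_simp
  ring

theorem verticalIntegral_zero {g : ℂ → ℂ}
    (hupper : IntegrableOn (fun y : ℝ => g (Complex.I * y)) (Ioi 0))
    (hlower : IntegrableOn (fun y : ℝ => g (-(Complex.I * y))) (Ioi 0)) :
    verticalIntegral 0 g = Complex.I * ∫ y : ℝ, g (Complex.I * y) := by
  have hlower' : IntegrableOn (fun y : ℝ => g (Complex.I * y)) (Iic 0) := by
    rw [← integrableOn_Ici_iff_integrableOn_Ioi, ← neg_zero] at hlower
    simpa using hlower.comp_neg_Iic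
  have hflip := integral_comp_neg_Ioi 0 fun y : ℝ => g (Complex.I * y)
  rw [neg_zero] at hflip
  rw [← intervalIntegral.integral_Iic_add_Ioi hlower' hupper, ← hflip, verticalIntegral]
  simp only [Complex.ofReal_zero, neg_zero, zero_add, zero_sub, integral_mul_const,
    Complex.ofReal_neg, mul_neg]
  ring

end CayleyLimit

section SlitPlane

open scoped ComplexConjugate

theorem cpow_half_sq (z : ℂ) : (z ^ (1 / 2 : ℂ)) ^ 2 = z := by simp

theorem re_cpow_half_nonneg (z : ℂ) : 0 ≤ (z ^ (1 / 2 : ℂ)).re := by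
  rw [one_div, Complex.cpow_inv_two_re]
  exact Real.sqrt_nonneg _

theorem cpow_half_ne_zero {z : ℂ} (hz : z ≠ 0) : z ^ (1 / 2 : ℂ) ≠ 0 := fun h =>
  hz (by rw [← cpow_half_sq z, h, zero_pow two_ne_zero])

theorem inv_norm_cpow_half (z : ℂ) : ‖z ^ (1 / 2 : ℂ)‖⁻¹ = ‖z‖ ^ (-(1 / 2) : ℝ) := by
  rw [Real.rpow_neg (norm_nonneg _), ← Complex.norm_cpow_real]
  norm_num

theorem conj_cpow_half {z : ℂ} (hz : z.im ≠ 0) :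
    (conj z) ^ (1 / 2 : ℂ) = conj (z ^ (1 / 2 : ℂ)) := by
  rw [Complex.conj_cpow _ _ fun h => hz (Complex.arg_eq_pi_iff.1 h).2, map_div₀, map_one,
    Complex.conj_ofNat]

theorem tendsto_cpow_half_upper {lam : ℝ} (hlam : 0 < lam) :
    Tendsto (fun y : ℝ => (-(lam : ℂ) + Complex.I * y) ^ (1 / 2 : ℂ)) (𝓝[>] 0)
      (𝓝 (Real.sqrt lam * Complex.I)) := by
  have hpath : Tendsto (fun y : ℝ => -(lam : ℂ) + Complex.I * y) (𝓝[>] 0)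
      (𝓝[{z | 0 ≤ z.im}] (-lam)) := by
    refine tendsto_nhdsWithin_iff.2 ⟨?_, ?_⟩
    · have hcont : Continuous fun y : ℝ => -(lam : ℂ) + Complex.I * y := by fun_prop
      simpa using (hcont.tendsto 0).mono_left nhdsWithin_le_nhds
    · filter_upwards [self_mem_nhdsWithin] with y hy
      simpa using (mem_Ioi.1 hy).le
  have hlog := (Complex.continuousWithinAt_log_of_re_neg_of_im_zero (z := -(lam : ℂ))
    (by simpa using hlam) (by simp)).tendsto.comp hpath
  have hvalue : Complex.exp (Complex.log (-(lam : ℂ)) * (1 / 2)) = Real.sqrt lam * Complex.I := by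
    have hroot : (lam : ℂ) ^ (1 / 2 : ℂ) = Real.sqrt lam := by
      rw [Real.sqrt_eq_rpow, Complex.ofReal_cpow hlam.le]
      norm_num
    rw [← Complex.cpow_def_of_ne_zero (by simpa using hlam.ne'), ← Complex.ofReal_neg,
      Complex.ofReal_cpow_of_nonpos (by linarith), Complex.ofReal_neg, neg_neg, hroot,
      mul_right_comm, mul_one_div, Complex.exp_pi_div_two_mul_I]
  rw [← hvalue]
  refine ((Complex.continuous_exp.tendsto _).comp (hlog.mul_const (1 / 2 : ℂ))).congr' ?_
  filter_upwards with y
  have hne : -(lam : ℂ) + Complex.I * y ≠ 0 := fun h => hlam.ne' (by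
    simpa using congrArg Complex.re h)
  simp only [Function.comp_apply, Complex.cpow_def_of_ne_zero hne]

/-- The function `z ↦ conj (f (conj z))`, holomorphic wherever `f` is at the mirror point. -/
def schwarzReflection (f : ℂ → ℂ) (z : ℂ) : ℂ := conj (f (conj z))

theorem differentiableAt_schwarzReflection {f : ℂ → ℂ} {z : ℂ}
    (hf : DifferentiableAt ℂ f (conj z)) : DifferentiableAt ℂ (schwarzReflection f) z := by
  have h := hf.conj_conj
  rwa [Complex.conj_conj] at h

theorem norm_schwarzReflection (f : ℂ → ℂ) (z : ℂ) : ‖schwarzReflection f z‖ = ‖f (conj z)‖ :=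
  Complex.norm_conj _

/-- A holomorphic function of the square root `s` of the spectral variable, on the closed right
half-plane punctured at the origin. It may grow like `1 / s` at `0`, and it is bounded at infinity
where the spectral variable `s ^ 2` stays to the right of `-ξ`. -/
structure IsRootKernel (ξ C : ℝ) (k : ℂ → ℂ) : Prop where
  differentiableAt : ∀ s : ℂ, 0 ≤ s.re → s ≠ 0 → DifferentiableAt ℂ k s
  norm_le : ∀ s : ℂ, 0 ≤ s.re → s ≠ 0 → -ξ ≤ (s ^ 2).re → ‖k s‖ ≤ C * (1 + ‖s‖⁻¹)

/-- A holomorphic function on the complement of the Apollonius disc of parameter `ρ`, decaying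
quadratically at infinity. -/
structure IsDecayingWeight (ρ C : ℝ) (q : ℂ → ℂ) : Prop where
  differentiableAt : ∀ z ∉ apolloniusDisc ρ, DifferentiableAt ℂ q z
  norm_le : ∀ z ∉ apolloniusDisc ρ, ‖q z‖ ≤ C / (1 + ‖z‖) ^ 2

variable {k q : ℂ → ℂ} {ρ ξ C C' : ℝ} {z : ℂ}

theorem IsRootKernel.schwarzReflection (hk : IsRootKernel ξ C k) :
    IsRootKernel ξ C (schwarzReflection k) where
  differentiableAt s hs hs0 := differentiableAt_schwarzReflection <|
    hk.differentiableAt _ (by simpa using hs) (by simpa using hs0)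
  norm_le s hs hs0 hre := by
    rw [norm_schwarzReflection, ← Complex.norm_conj s]
    exact hk.norm_le _ (by simpa using hs) (by simpa using hs0) (by
      rwa [← map_pow, Complex.conj_re])

theorem conj_mem_apolloniusDisc : conj z ∈ apolloniusDisc ρ ↔ z ∈ apolloniusDisc ρ := by
  have hadd : ‖conj z + 1‖ = ‖z + 1‖ := by rw [← Complex.norm_conj (z + 1), map_add, map_one]
  have hsub : ‖conj z - 1‖ = ‖z - 1‖ := by rw [← Complex.norm_conj (z - 1), map_sub, map_one]
  simp only [apolloniusDisc, mem_ofPred_eq, hadd, hsub]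

theorem IsDecayingWeight.schwarzReflection (hq : IsDecayingWeight ρ C q) :
    IsDecayingWeight ρ C (schwarzReflection q) where
  differentiableAt z hz := differentiableAt_schwarzReflection <|
    hq.differentiableAt _ (mt conj_mem_apolloniusDisc.1 hz)
  norm_le z hz := by
    rw [norm_schwarzReflection, ← Complex.norm_conj z]
    exact hq.norm_le _ (mt conj_mem_apolloniusDisc.1 hz)

namespace IsRootKernel

theorem differentiableAt_mul (hk : IsRootKernel ξ C k) (hz : z ∈ Complex.slitPlane)
    (hq : DifferentiableAt ℂ q z) : DifferentiableAt ℂ (fun z => k (z ^ (1 / 2 : ℂ)) * q z) z := by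
  have hroot : DifferentiableAt ℂ (fun z : ℂ => z ^ (1 / 2 : ℂ)) z :=
    differentiableAt_id.cpow_const hz
  exact (DifferentiableAt.comp (f := fun z : ℂ => z ^ (1 / 2 : ℂ)) z (hk.differentiableAt _
    (re_cpow_half_nonneg z) (cpow_half_ne_zero (Complex.slitPlane_ne_zero hz))) hroot).mul hq

theorem norm_mul_le (hk : IsRootKernel ξ C k) (hC : 0 ≤ C) (hz : z ≠ 0) (hre : -ξ ≤ z.re)
    (hq : ‖q z‖ ≤ C' / (1 + ‖z‖) ^ 2) :
    ‖k (z ^ (1 / 2 : ℂ)) * q z‖ ≤ C * C' * sqrtDecay ‖z‖ := by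
  have hkz := hk.norm_le (z ^ (1 / 2 : ℂ)) (re_cpow_half_nonneg z) (cpow_half_ne_zero hz)
    (by rwa [cpow_half_sq])
  rw [inv_norm_cpow_half] at hkz
  rw [norm_mul]
  calc ‖k (z ^ (1 / 2 : ℂ))‖ * ‖q z‖
      ≤ (C * (1 + ‖z‖ ^ (-(1 / 2) : ℝ))) * (C' / (1 + ‖z‖) ^ 2) := by gcongr
    _ = C * C' * sqrtDecay ‖z‖ := by unfold sqrtDecay; ring

theorem hasHalfStripBoundary (hk : IsRootKernel ξ C k) (hq : IsDecayingWeight ρ C' q) (hρ : ρ ≤ 1)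
    (hC : 0 ≤ C) :
    HasHalfStripBoundary ξ (C * C') (fun z => k (z ^ (1 / 2 : ℂ)) * q z)
      (fun lam => k (Real.sqrt lam * Complex.I) * q (-lam)) := by
  have hout : ∀ z : ℂ, z.re ≤ 0 → z ∉ apolloniusDisc ρ := fun z hz hmem =>
    hz.not_gt (re_pos_of_mem_apolloniusDisc hρ hmem)
  have hne : ∀ z : ℂ, 0 < z.im → z ≠ 0 := fun z hz h => by simp [h] at hz
  refine ⟨fun z hre him => ?_, fun z hre him => ?_, fun lam hlam => ?_⟩
  · exact hk.differentiableAt_mul (Or.inr him.ne') (hq.differentiableAt z (hout z hre.2))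
  · exact hk.norm_mul_le hC (hne z him) hre.1 (hq.norm_le z (hout z hre.2))
  · refine Tendsto.mul ?_ ?_
    · refine (hk.differentiableAt _ (by simp) ?_).continuousAt.tendsto.comp
        (tendsto_cpow_half_upper hlam.1)
      exact mul_ne_zero (by exact_mod_cast (Real.sqrt_pos.2 hlam.1).ne') Complex.I_ne_zero
    · have hpath : Continuous fun y : ℝ => -(lam : ℂ) + Complex.I * y := by fun_prop
      refine (hq.differentiableAt _ (hout _ ?_)).continuousAt.tendsto.comp ?_
      · simpa using hlam.1.le
      · simpa using (hpath.tendsto 0).mono_left nhdsWithin_le_nhds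

theorem tendsto_cayleyIntegral (hk : IsRootKernel ξ C k) (hq : IsDecayingWeight ρ C' q)
    (hρ : ρ ∈ Ioo (0 : ℝ) 1) (hξ : 0 ≤ ξ) (hC : 0 ≤ C) (hC' : 0 ≤ C') :
    Tendsto (fun r => cayleyIntegral r fun z => k (z ^ (1 / 2 : ℂ)) * q z) (𝓝[<] 1)
      (𝓝 (cayleyIntegral 1 fun z => k (z ^ (1 / 2 : ℂ)) * q z)) := by
  refine SchrodingerCQ.tendsto_cayleyIntegral hρ (mul_nonneg hC hC')
    (fun z hre hne hz => ?_) (fun z hre hne hz => ?_)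
  · refine (hk.differentiableAt_mul ?_ (hq.differentiableAt z hz)).continuousAt
    refine Complex.mem_slitPlane_iff.2 (hre.lt_or_eq.imp_right fun h him => hne ?_)
    exact Complex.ext h.symm him
  · exact hk.norm_mul_le hC hne (by linarith) (hq.norm_le z hz)

/-- Deforms the circles of Apollonius, through the imaginary axis, to a Hankel-type contour: two
vertical half-lines on `Re z = -ξ` and the two sides of the cut. -/
theorem eq_verticalIntegral_add_integral (hk : IsRootKernel ξ C k) (hq : IsDecayingWeight ρ C' q)
    (hρ : ρ ∈ Ioo (0 : ℝ) 1) (hξ : 0 < ξ) (hC : 0 ≤ C) (hC' : 0 ≤ C') {g : ℂ → ℂ} {c : ℂ}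
    (hg : ∀ z, g z = k (z ^ (1 / 2 : ℂ)) * q z)
    (hc : ∀ r ∈ Ioo ρ 1, cayleyIntegral r g = c) {jump : ℝ → ℂ}
    (hjump : ∀ lam, jump lam =
      (k (-(Real.sqrt lam * Complex.I)) - k (Real.sqrt lam * Complex.I)) * q (-lam)) :
    IntegrableOn (fun y : ℝ => g (-(ξ : ℂ) + Complex.I * y)) (Ioi 0) ∧
      IntegrableOn (fun y : ℝ => g (-(ξ : ℂ) - Complex.I * y)) (Ioi 0) ∧
      IntervalIntegrable jump volume 0 ξ ∧
      c = (2 * Real.pi * Complex.I)⁻¹ *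
        (verticalIntegral ξ g + ∫ lam in (0 : ℝ)..ξ, jump lam) := by
  have hCC : 0 ≤ C * C' := mul_nonneg hC hC'
  have hupper := hk.hasHalfStripBoundary hq hρ.2.le hC
  have hlower := hk.schwarzReflection.hasHalfStripBoundary hq.schwarzReflection hρ.2.le hC
  have haxis := hk.tendsto_cayleyIntegral hq hρ hξ.le hC hC'
  simp only [← hg] at hupper haxis
  have hconj : ∀ z : ℂ, 0 < z.im → g (conj z) = conj (SchrodingerCQ.schwarzReflection k
      (z ^ (1 / 2 : ℂ)) * SchrodingerCQ.schwarzReflection q z) := fun z hz => by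
    simp only [hg, SchrodingerCQ.schwarzReflection, map_mul, Complex.conj_conj,
      conj_cpow_half hz.ne']
  obtain rfl : jump = fun lam : ℝ => conj (SchrodingerCQ.schwarzReflection k (√lam * Complex.I) *
      SchrodingerCQ.schwarzReflection q (-lam)) - k (√lam * Complex.I) * q (-lam) := by
    ext lam
    simp [hjump, SchrodingerCQ.schwarzReflection, sub_mul]
  have hleft : -ξ ∈ Icc (-ξ) 0 := left_mem_Icc.2 (neg_nonpos.2 hξ.le)
  have hright : (0 : ℝ) ∈ Icc (-ξ) 0 := right_mem_Icc.2 (neg_nonpos.2 hξ.le)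
  have hvertical : verticalIntegral 0 g = Complex.I * ∫ y : ℝ, g (Complex.I * y) :=
    verticalIntegral_zero (by simpa using hupper.integrableOn_vertical hCC hright)
      (by simpa using hlower.integrableOn_vertical_conj hconj hCC hright)
  have hcircle : cayleyIntegral 1 g = c := tendsto_nhds_unique haxis <|
    tendsto_const_nhds.congr' <| by
      filter_upwards [Ioo_mem_nhdsLT hρ.2] with r hr using (hc r hr).symm
  refine ⟨by simpa using hupper.integrableOn_vertical hCC hleft,
    by simpa using hlower.integrableOn_vertical_conj hconj hCC hleft,
    (hlower.intervalIntegrable_conj_boundary hξ hCC).sub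
      (hupper.intervalIntegrable_boundary hξ hCC), ?_⟩
  rw [← verticalIntegral_zero_eq hupper hlower hconj hξ hCC, hvertical, ← hcircle,
    cayleyIntegral_one, mul_inv _ Complex.I, mul_assoc, inv_mul_cancel_left₀ Complex.I_ne_zero]

end IsRootKernel

end SlitPlane

/-! ### The modified Bessel function `K₀` -/

section BesselSeries

/-- The sum of the power series with coefficients `c`. -/
noncomputable def seriesSum (c : ℕ → ℂ) (q : ℂ) : ℂ := ∑' k, c k * q ^ k

/-- The coefficients of the derivative of the power series with coefficients `c`. -/
def derivCoeff (c : ℕ → ℂ) (k : ℕ) : ℂ := ((k : ℂ) + 1) * c (k + 1)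

variable {c : ℕ → ℂ}

theorem norm_natCast_add_one (k : ℕ) : ‖(k : ℂ) + 1‖ = (k : ℝ) + 1 := by
  rw [← Nat.cast_add_one, Complex.norm_natCast, Nat.cast_add_one]

theorem norm_derivCoeff_le (hc : ∀ k, ‖c k‖ ≤ 1 / (k ! : ℝ)) (k : ℕ) :
    ‖derivCoeff c k‖ ≤ 1 / (k ! : ℝ) :=
  calc ‖derivCoeff c k‖ ≤ ((k : ℝ) + 1) * (1 / ((k + 1)! : ℝ)) := by
        rw [derivCoeff, norm_mul, norm_natCast_add_one]
        gcongr
        exact hc (k + 1)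
    _ = 1 / (k ! : ℝ) := by
        rw [Nat.factorial_succ]
        push_cast
        field_simp

theorem summable_norm_mul_pow (hc : ∀ k, ‖c k‖ ≤ 1 / (k ! : ℝ)) {R : ℝ} (hR : 0 ≤ R) :
    Summable fun k => ‖c k‖ * R ^ k := by
  refine (Real.summable_pow_div_factorial R).of_nonneg_of_le (fun k => by positivity) fun k => ?_
  rw [div_eq_inv_mul, ← one_div]
  gcongr
  exact hc k

theorem summable_mul_pow (hc : ∀ k, ‖c k‖ ≤ 1 / (k ! : ℝ)) (q : ℂ) :
    Summable fun k => c k * q ^ k :=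
  .of_norm <| by simpa only [norm_mul, norm_pow] using summable_norm_mul_pow hc (norm_nonneg q)

theorem hasSum_natCast_mul_pow_pred (hc : ∀ k, ‖c k‖ ≤ 1 / (k ! : ℝ)) (q : ℂ) :
    HasSum (fun k : ℕ => c k * (k * q ^ (k - 1))) (seriesSum (derivCoeff c) q) := by
  rw [← hasSum_nat_add_iff' 1]
  simp only [Finset.range_one, Finset.sum_singleton, Nat.cast_zero, zero_mul, mul_zero, sub_zero]
  refine (summable_mul_pow (norm_derivCoeff_le hc) q).hasSum.congr_fun fun k => ?_
  rw [derivCoeff, Nat.add_sub_cancel]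
  push_cast
  ring

theorem hasDerivAt_seriesSum (hc : ∀ k, ‖c k‖ ≤ 1 / (k ! : ℝ)) (q : ℂ) :
    HasDerivAt (seriesSum c) (seriesSum (derivCoeff c) q) q := by
  have hbound : Summable fun k : ℕ => ‖c k‖ * (k * (‖q‖ + 1) ^ (k - 1)) := by
    rw [← summable_nat_add_iff 1]
    refine (summable_norm_mul_pow (norm_derivCoeff_le hc)
      (by positivity : 0 ≤ ‖q‖ + 1)).congr fun k => ?_
    rw [derivCoeff, norm_mul, norm_natCast_add_one, Nat.add_sub_cancel]
    push_cast
    ring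
  refine (hasDerivAt_tsum_of_isPreconnected (t := Metric.ball (0 : ℂ) (‖q‖ + 1)) (y₀ := q)
    hbound Metric.isOpen_ball (convex_ball _ _).isPreconnected
    (fun k y _ => (hasDerivAt_pow k y).const_mul (c k)) (fun k y hy => ?_) (by simp)
    (summable_mul_pow hc q) (by simp)).congr_deriv (hasSum_natCast_mul_pow_pred hc q).tsum_eq
  have : ‖y‖ ≤ ‖q‖ + 1 := (mem_ball_zero_iff.1 hy).le
  rw [norm_mul, norm_mul, norm_pow, Complex.norm_natCast]
  gcongr

theorem hasDerivAt_mul_seriesSum (hc : ∀ k, ‖c k‖ ≤ 1 / (k ! : ℝ)) (q : ℂ) :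
    HasDerivAt (fun q => q * seriesSum c q) (seriesSum (fun k => ((k : ℂ) + 1) * c k) q) q := by
  refine ((hasDerivAt_id q).fun_mul (hasDerivAt_seriesSum hc q)).congr_deriv (Eq.symm ?_)
  refine ((((summable_mul_pow hc q).hasSum).mul_left 1).add
    ((hasSum_natCast_mul_pow_pred hc q).mul_left q)).congr_fun (fun k => ?_) |>.tsum_eq
  rcases k with _ | k
  · simp
  · rw [Nat.add_sub_cancel]
    ring

theorem seriesSum_zero (c : ℕ → ℂ) : seriesSum c 0 = c 0 := by
  rw [seriesSum, tsum_eq_single 0 fun k hk => by simp [hk], pow_zero, mul_one]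

theorem hasDerivAt_seriesSum_sq_div_four (hc : ∀ k, ‖c k‖ ≤ 1 / (k ! : ℝ)) (z : ℂ) :
    HasDerivAt (fun z => seriesSum c (z ^ 2 / 4)) (z / 2 * seriesSum (derivCoeff c) (z ^ 2 / 4))
      z := by
  refine ((hasDerivAt_seriesSum hc (z ^ 2 / 4)).comp z
    ((hasDerivAt_pow 2 z).div_const 4)).congr_deriv ?_
  push_cast
  ring

/-- The coefficients of `I₀(z)` as a power series in `z² / 4`. -/
noncomputable def coeffI (k : ℕ) : ℂ := 1 / (k ! : ℂ) ^ 2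

/-- The coefficients of the regular part of `K₀(z)` as a power series in `z² / 4`. -/
noncomputable def coeffH (k : ℕ) : ℂ := ((harmonic k : ℚ) : ℂ) / (k ! : ℂ) ^ 2

theorem norm_coeffI_le (k : ℕ) : ‖coeffI k‖ ≤ 1 / (k ! : ℝ) := by
  have hone : (1 : ℝ) ≤ k ! := by exact_mod_cast k.factorial_pos
  rw [coeffI, norm_div, norm_one, norm_pow, Complex.norm_natCast]
  exact one_div_le_one_div_of_le (by positivity) (le_self_pow₀ hone two_ne_zero)

theorem harmonic_le_natCast (k : ℕ) : harmonic k ≤ k := by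
  refine (Finset.sum_le_card_nsmul _ _ 1 fun i _ => ?_).trans_eq (by simp)
  exact inv_le_one_of_one_le₀ (by exact_mod_cast i.succ_pos)

theorem norm_coeffH_le (k : ℕ) : ‖coeffH k‖ ≤ 1 / (k ! : ℝ) := by
  have hnonneg : (0 : ℚ) ≤ harmonic k := Finset.sum_nonneg fun i _ => by positivity
  have hle : (harmonic k : ℝ) ≤ k ! := by
    exact_mod_cast (harmonic_le_natCast k).trans (by exact_mod_cast k.self_le_factorial)
  rw [coeffH, norm_div, norm_pow, Complex.norm_natCast, Complex.norm_ratCast,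
    abs_of_nonneg (by exact_mod_cast hnonneg), div_le_div_iff₀ (by positivity) (by positivity)]
  nlinarith [(Nat.cast_nonneg (k !) : (0 : ℝ) ≤ k !)]

theorem succ_mul_derivCoeff_coeffI (k : ℕ) :
    ((k : ℂ) + 1) * derivCoeff coeffI k = coeffI k := by
  have hsucc : (k : ℂ) + 1 ≠ 0 := Nat.cast_add_one_ne_zero k
  have hfact : (k ! : ℂ) ≠ 0 := Nat.cast_ne_zero.2 k.factorial_ne_zero
  rw [derivCoeff, coeffI, coeffI, Nat.factorial_succ]
  push_cast
  field_simp

theorem succ_mul_derivCoeff_coeffH (k : ℕ) :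
    ((k : ℂ) + 1) * derivCoeff coeffH k = coeffH k + derivCoeff coeffI k := by
  have hsucc : (k : ℂ) + 1 ≠ 0 := Nat.cast_add_one_ne_zero k
  have hfact : (k ! : ℂ) ≠ 0 := Nat.cast_ne_zero.2 k.factorial_ne_zero
  rw [derivCoeff, derivCoeff, coeffH, coeffH, coeffI, Nat.factorial_succ, harmonic_succ]
  push_cast
  field_simp

theorem besselI0_eq_seriesSum (z : ℂ) : besselI0 z = seriesSum coeffI (z ^ 2 / 4) :=
  tsum_congr fun k => by rw [coeffI]; ring

theorem besselK0_eq_seriesSum (z : ℂ) : besselK0 z =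
    -(Complex.log (z / 2) + Real.eulerMascheroniConstant) * besselI0 z +
      seriesSum coeffH (z ^ 2 / 4) := by
  rw [besselK0]
  congr 1
  exact tsum_congr fun k => by rw [coeffH]; ring

end BesselSeries

section BesselEquation

/-- The modified Bessel equation of order `0` on the slit plane, written with the Euler operator
`θ = z d/dz` as the first-order system `θ f = g`, `θ g = z² f`. -/
structure IsBesselSolution (f g : ℂ → ℂ) : Prop where
  hasDerivAt : ∀ z ∈ Complex.slitPlane, HasDerivAt f (g z / z) z
  hasDerivAt_euler : ∀ z ∈ Complex.slitPlane, HasDerivAt g (z * f z) z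

/-- `z I₀'(z)`. -/
noncomputable def eulerI0 (z : ℂ) : ℂ := 2 * (z ^ 2 / 4 * seriesSum (derivCoeff coeffI) (z ^ 2 / 4))

/-- `z K₀'(z)`. -/
noncomputable def eulerK0 (z : ℂ) : ℂ :=
  -besselI0 z - (Complex.log (z / 2) + Real.eulerMascheroniConstant) * eulerI0 z +
    2 * (z ^ 2 / 4 * seriesSum (derivCoeff coeffH) (z ^ 2 / 4))

theorem hasDerivAt_besselI0 (z : ℂ) :
    HasDerivAt besselI0 (z / 2 * seriesSum (derivCoeff coeffI) (z ^ 2 / 4)) z := by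
  rw [funext besselI0_eq_seriesSum]
  exact hasDerivAt_seriesSum_sq_div_four norm_coeffI_le z

theorem hasDerivAt_euler_seriesSum {c : ℕ → ℂ} (hc : ∀ k, ‖c k‖ ≤ 1 / (k ! : ℝ)) (z : ℂ) :
    HasDerivAt (fun z => 2 * (z ^ 2 / 4 * seriesSum c (z ^ 2 / 4)))
      (z * seriesSum (fun k => ((k : ℂ) + 1) * c k) (z ^ 2 / 4)) z := by
  refine (((hasDerivAt_mul_seriesSum hc (z ^ 2 / 4)).comp z
    ((hasDerivAt_pow 2 z).div_const 4)).const_mul 2).congr_deriv ?_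
  push_cast
  ring

theorem hasDerivAt_eulerI0 (z : ℂ) : HasDerivAt eulerI0 (z * besselI0 z) z := by
  have h := hasDerivAt_euler_seriesSum (norm_derivCoeff_le norm_coeffI_le) z
  simp only [succ_mul_derivCoeff_coeffI] at h
  rwa [besselI0_eq_seriesSum]

theorem isBesselSolution_besselI0 : IsBesselSolution besselI0 eulerI0 where
  hasDerivAt z hz := (hasDerivAt_besselI0 z).congr_deriv <| by
    have := Complex.slitPlane_ne_zero hz
    rw [eulerI0]
    field_simp
    norm_num
  hasDerivAt_euler z _ := hasDerivAt_eulerI0 z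

theorem hasDerivAt_log_half {z : ℂ} (hz : z ∈ Complex.slitPlane) :
    HasDerivAt (fun z => Complex.log (z / 2) + Real.eulerMascheroniConstant) z⁻¹ z := by
  have hhalf : z / 2 ∈ Complex.slitPlane := by
    simpa [Complex.mem_slitPlane_iff] using Complex.mem_slitPlane_iff.1 hz
  have := Complex.slitPlane_ne_zero hz
  refine ((((hasDerivAt_id z).div_const 2).clog hhalf).add_const _).congr_deriv ?_
  simp only [id]
  field_simp

theorem isBesselSolution_besselK0 : IsBesselSolution besselK0 eulerK0 where
  hasDerivAt z hz := by
    have hz0 := Complex.slitPlane_ne_zero hz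
    rw [funext besselK0_eq_seriesSum]
    refine (((hasDerivAt_log_half hz).fun_neg.fun_mul (hasDerivAt_besselI0 z)).fun_add
      (hasDerivAt_seriesSum_sq_div_four norm_coeffH_le z)).congr_deriv ?_
    rw [eulerK0, eulerI0]
    field_simp
    ring
  hasDerivAt_euler z hz := by
    have hz0 := Complex.slitPlane_ne_zero hz
    have hH := hasDerivAt_euler_seriesSum (norm_derivCoeff_le norm_coeffH_le) z
    simp only [succ_mul_derivCoeff_coeffH] at hH
    have hsum : seriesSum (fun k => coeffH k + derivCoeff coeffI k) (z ^ 2 / 4) =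
        seriesSum coeffH (z ^ 2 / 4) + seriesSum (derivCoeff coeffI) (z ^ 2 / 4) := by
      simp only [seriesSum, add_mul]
      exact (summable_mul_pow norm_coeffH_le _).tsum_add
        (summable_mul_pow (norm_derivCoeff_le norm_coeffI_le) _)
    refine (((hasDerivAt_besselI0 z).fun_neg.fun_sub
      ((hasDerivAt_log_half hz).fun_mul (hasDerivAt_eulerI0 z))).fun_add hH).congr_deriv ?_
    rw [hsum, besselK0_eq_seriesSum, eulerI0]
    field_simp
    ring

end BesselEquation

section BesselUniqueness

theorem tendsto_log_half_mul_nhds_zero {f : ℂ → ℂ} (hf : DifferentiableAt ℂ f 0) (hf0 : f 0 = 0) :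
    Tendsto (fun x : ℝ => (Complex.log (x / 2) + Real.eulerMascheroniConstant) * f x)
      (𝓝[>] 0) (𝓝 0) := by
  have hlog : Tendsto (fun x : ℝ => x * (Real.log (x / 2) + Real.eulerMascheroniConstant))
      (𝓝[>] 0) (𝓝 0) := by
    have hcont : Continuous fun x : ℝ =>
        2 * (x / 2 * Real.log (x / 2)) + x * Real.eulerMascheroniConstant := by
      have := Real.continuous_mul_log.comp (continuous_id.div_const (2 : ℝ))
      simp only [Function.comp_def, id] at this
      fun_prop
    refine ((hcont.tendsto' 0 0 (by simp)).mono_left nhdsWithin_le_nhds).congr fun x => by ring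
  have hslope : Tendsto (fun x : ℝ => (x : ℂ)⁻¹ * f x) (𝓝[>] 0) (𝓝 (deriv f 0)) := by
    have hreal : Tendsto (fun x : ℝ => (x : ℂ)) (𝓝[>] 0) (𝓝[≠] 0) :=
      tendsto_nhdsWithin_iff.2 ⟨(Complex.continuous_ofReal.tendsto' 0 0 (by simp)).mono_left
        nhdsWithin_le_nhds, eventually_nhdsWithin_of_forall fun x hx =>
          Complex.ofReal_ne_zero.2 (ne_of_gt hx)⟩
    refine ((hasDerivAt_iff_tendsto_slope.1 hf.hasDerivAt).comp hreal).congr fun x => ?_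
    simp [slope_def_field, hf0, div_eq_inv_mul]
  have hmul := ((Complex.continuous_ofReal.tendsto' 0 0 (by simp)).comp hlog).mul hslope
  rw [zero_mul] at hmul
  refine hmul.congr' ?_
  filter_upwards [self_mem_nhdsWithin] with x hx
  have hx0 : (x : ℂ) ≠ 0 := Complex.ofReal_ne_zero.2 (ne_of_gt hx)
  rw [Function.comp_apply, Complex.ofReal_mul, Complex.ofReal_add,
    Complex.ofReal_log (div_nonneg (le_of_lt hx) zero_le_two)]
  push_cast
  field_simp

theorem tendsto_ofReal_of_continuousAt {f : ℂ → ℂ} (hf : ContinuousAt f 0) :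
    Tendsto (fun x : ℝ => f x) (𝓝[>] 0) (𝓝 (f 0)) :=
  hf.tendsto.comp ((Complex.continuous_ofReal.tendsto' 0 0 (by simp)).mono_left nhdsWithin_le_nhds)

theorem tendsto_besselI0_zero : Tendsto (fun x : ℝ => besselI0 x) (𝓝[>] 0) (𝓝 1) := by
  have hzero : besselI0 0 = 1 := by simp [besselI0_eq_seriesSum, seriesSum_zero, coeffI]
  exact hzero ▸ tendsto_ofReal_of_continuousAt (hasDerivAt_besselI0 0).continuousAt

theorem tendsto_besselK0_add_log_zero :
    Tendsto (fun x : ℝ => besselK0 x + (Complex.log (x / 2) + Real.eulerMascheroniConstant))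
      (𝓝[>] 0) (𝓝 0) := by
  have hI := tendsto_log_half_mul_nhds_zero (f := fun z => besselI0 z - 1)
    ((hasDerivAt_besselI0 0).differentiableAt.sub_const 1)
    (by simp [besselI0_eq_seriesSum, seriesSum_zero, coeffI])
  have hH := tendsto_ofReal_of_continuousAt
    (hasDerivAt_seriesSum_sq_div_four norm_coeffH_le 0).continuousAt
  rw [zero_pow two_ne_zero, zero_div, seriesSum_zero, show coeffH 0 = 0 by simp [coeffH]] at hH
  have hdiff := hH.sub hI
  rw [sub_zero] at hdiff
  refine hdiff.congr fun x => ?_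
  rw [besselK0_eq_seriesSum]
  ring

theorem tendsto_wronskian_besselI0_besselK0 :
    Tendsto (fun x : ℝ => besselI0 x * eulerK0 x - eulerI0 x * besselK0 x) (𝓝[>] 0) (𝓝 (-1)) := by
  have hI := tendsto_besselI0_zero
  have hlogI := tendsto_log_half_mul_nhds_zero (hasDerivAt_eulerI0 0).differentiableAt
    (by simp [eulerI0])
  have heulerI := tendsto_ofReal_of_continuousAt (hasDerivAt_eulerI0 0).continuousAt
  have hH := tendsto_ofReal_of_continuousAt
    (hasDerivAt_seriesSum_sq_div_four norm_coeffH_le 0).continuousAt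
  have heulerH := tendsto_ofReal_of_continuousAt
    (hasDerivAt_euler_seriesSum (norm_derivCoeff_le norm_coeffH_le) 0).continuousAt
  rw [show eulerI0 0 = 0 by simp [eulerI0]] at heulerI
  have hlim := (hI.mul ((hI.neg.sub hlogI).add heulerH)).sub
    ((heulerI.mul hH).sub (hlogI.mul hI))
  refine (hlim.congr fun x => ?_).trans (by simp)
  rw [eulerK0, besselK0_eq_seriesSum]
  ring

variable {f g f₁ g₁ f₂ g₂ : ℂ → ℂ}

theorem IsBesselSolution.sub (h₁ : IsBesselSolution f₁ g₁) (h₂ : IsBesselSolution f₂ g₂) :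
    IsBesselSolution (fun z => f₁ z - f₂ z) (fun z => g₁ z - g₂ z) where
  hasDerivAt z hz :=
    ((h₁.hasDerivAt z hz).fun_sub (h₂.hasDerivAt z hz)).congr_deriv (sub_div _ _ _).symm
  hasDerivAt_euler z hz :=
    ((h₁.hasDerivAt_euler z hz).fun_sub (h₂.hasDerivAt_euler z hz)).congr_deriv
      (mul_sub _ _ _).symm

theorem IsBesselSolution.wronskian_eq (h₁ : IsBesselSolution f₁ g₁) (h₂ : IsBesselSolution f₂ g₂)
    {z w : ℂ} (hz : z ∈ Complex.slitPlane) (hw : w ∈ Complex.slitPlane) :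
    f₁ z * g₂ z - g₁ z * f₂ z = f₁ w * g₂ w - g₁ w * f₂ w := by
  have hderiv : ∀ z ∈ Complex.slitPlane,
      HasDerivAt (fun z => f₁ z * g₂ z - g₁ z * f₂ z) 0 z := fun z hz =>
    (((h₁.hasDerivAt z hz).fun_mul (h₂.hasDerivAt_euler z hz)).fun_sub
      ((h₁.hasDerivAt_euler z hz).fun_mul (h₂.hasDerivAt z hz))).congr_deriv (by ring)
  exact Complex.isOpen_slitPlane.is_const_of_deriv_eq_zero
    (Complex.starConvex_one_slitPlane.isPathConnected
      Complex.one_mem_slitPlane).isConnected.isPreconnected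
    (fun z hz => (hderiv z hz).differentiableAt.differentiableWithinAt)
    (fun z hz => (hderiv z hz).deriv) hz hw

theorem wronskian_besselI0_besselK0 {z : ℂ} (hz : z ∈ Complex.slitPlane) :
    besselI0 z * eulerK0 z - eulerI0 z * besselK0 z = -1 := by
  refine tendsto_nhds_unique (tendsto_const_nhds.congr' ?_) tendsto_wronskian_besselI0_besselK0
  filter_upwards [self_mem_nhdsWithin] with x hx
  exact isBesselSolution_besselI0.wronskian_eq isBesselSolution_besselK0 hz
    (Complex.ofReal_mem_slitPlane.2 hx)

theorem IsBesselSolution.exists_eq_add (h : IsBesselSolution f g) :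
    ∃ a b, ∀ z ∈ Complex.slitPlane, f z = a * besselI0 z + b * besselK0 z := by
  refine ⟨-(f 1 * eulerK0 1 - g 1 * besselK0 1), f 1 * eulerI0 1 - g 1 * besselI0 1,
    fun z hz => ?_⟩
  have hI := h.wronskian_eq isBesselSolution_besselI0 hz Complex.one_mem_slitPlane
  have hK := h.wronskian_eq isBesselSolution_besselK0 hz Complex.one_mem_slitPlane
  linear_combination f z * wronskian_besselI0_besselK0 hz - besselI0 z * hK + besselK0 z * hI

theorem not_tendsto_besselK0_nhds (l : ℂ) :
    ¬ Tendsto (fun x : ℝ => besselK0 x) (𝓝[>] 0) (𝓝 l) := by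
  intro hK
  have hlog := (Complex.continuous_re.tendsto _).comp (tendsto_besselK0_add_log_zero.sub hK)
  refine not_tendsto_nhds_of_tendsto_atBot (tendsto_atBot_add_const_right _
    Real.eulerMascheroniConstant (Real.tendsto_log_nhdsGT_zero.comp (f := fun x : ℝ => x / 2) ?_))
    _ (hlog.congr' ?_)
  · exact tendsto_nhdsWithin_iff.2 ⟨((continuous_id.div_const (2 : ℝ)).tendsto' 0 0
      (by simp)).mono_left nhdsWithin_le_nhds,
      eventually_nhdsWithin_of_forall fun x hx => half_pos (show 0 < x from hx)⟩
  · filter_upwards with x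
    have hhalf : ((x : ℂ) / 2) = ((x / 2 : ℝ) : ℂ) := by push_cast; rfl
    simp only [Function.comp_apply, add_sub_cancel_left, Complex.add_re, hhalf,
      Complex.log_ofReal_re, Complex.ofReal_re]

theorem IsBesselSolution.eq_zero (h : IsBesselSolution f g)
    (hlim : Tendsto (fun x : ℝ => f x) (𝓝[>] 0) (𝓝 0)) {z : ℂ} (hz : z ∈ Complex.slitPlane) :
    f z = 0 := by
  obtain ⟨a, b, hab⟩ := h.exists_eq_add
  have hfx : (fun x : ℝ => f x) =ᶠ[𝓝[>] 0] fun x : ℝ => a * besselI0 x + b * besselK0 x := by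
    filter_upwards [self_mem_nhdsWithin] with x hx using hab x (Complex.ofReal_mem_slitPlane.2 hx)
  have hI := tendsto_besselI0_zero.const_mul a
  have hb : b = 0 := by
    by_contra hb
    refine not_tendsto_besselK0_nhds _
      ((((hlim.congr' hfx).sub hI).const_mul b⁻¹).congr fun x => ?_)
    rw [add_sub_cancel_left, inv_mul_cancel_left₀ hb]
  simp only [hb, zero_mul, add_zero] at hfx hab
  have ha : a = 0 := by simpa using tendsto_nhds_unique hI (hlim.congr' hfx)
  rw [hab z hz, ha, zero_mul]

end BesselUniqueness

section LaplaceRepresentation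

/-- The weight `e^{-τ} τ^{-1/2}` of the Laplace-type representation of `K₀`. -/
noncomputable def gammaWeight (τ : ℝ) : ℝ := Real.exp (-τ) / √τ

theorem gammaWeight_nonneg (τ : ℝ) : 0 ≤ gammaWeight τ := by
  rw [gammaWeight]
  positivity

theorem integrableOn_gammaWeight : IntegrableOn gammaWeight (Ioi 0) := by
  refine (Real.GammaIntegral_convergent one_half_pos).congr_fun (fun τ hτ => ?_) measurableSet_Ioi
  beta_reduce
  rw [show (1 / 2 : ℝ) - 1 = -(1 / 2) by norm_num, Real.rpow_neg (le_of_lt hτ),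
    ← Real.sqrt_eq_rpow, ← div_eq_mul_inv, gammaWeight]

/-- The integrals `∫ e^{-τ} τ^{-1/2} (τ + 2 w)^{-a} dτ`. -/
noncomputable def laplaceMoment (a : ℝ) (w : ℂ) : ℂ :=
  ∫ τ in Ioi (0 : ℝ), (gammaWeight τ : ℂ) * ((τ : ℂ) + 2 * w) ^ ((-a : ℝ) : ℂ)

theorem ofReal_add_mem_slitPlane {τ : ℝ} (hτ : 0 ≤ τ) {w : ℂ} (hw : w ∈ Complex.slitPlane) :
    (τ : ℂ) + 2 * w ∈ Complex.slitPlane := by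
  rw [Complex.mem_slitPlane_iff] at hw ⊢
  refine hw.imp (fun hre => ?_) fun him => by simpa using him
  simp only [Complex.add_re, Complex.ofReal_re, Complex.mul_re, Complex.re_ofNat,
    Complex.im_ofNat, zero_mul, sub_zero]
  positivity

theorem le_norm_ofReal_add {w₀ w : ℂ} {δ τ : ℝ} (hδ : Metric.ball w₀ (2 * δ) ⊆ Complex.slitPlane)
    (hw : w ∈ Metric.ball w₀ δ) (hτ : 0 ≤ τ) : 2 * δ ≤ ‖(τ : ℂ) + 2 * w‖ := by
  have hfar : ((-(τ / 2) : ℝ) : ℂ) ∉ Metric.ball w₀ (2 * δ) := fun hmem => by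
    linarith [Complex.ofReal_mem_slitPlane.1 (hδ hmem)]
  rw [Metric.mem_ball, not_lt] at hfar
  rw [Metric.mem_ball] at hw
  have hdist : dist ((-(τ / 2) : ℝ) : ℂ) w = 1 / 2 * ‖(τ : ℂ) + 2 * w‖ := by
    rw [dist_eq_norm, show ((-(τ / 2) : ℝ) : ℂ) - w = (-(1 / 2) : ℝ) * ((τ : ℂ) + 2 * w) by
      push_cast; ring, norm_mul, Complex.norm_real]
    norm_num
  linarith [dist_triangle ((-(τ / 2) : ℝ) : ℂ) w w₀]

theorem continuousOn_ofReal_add_cpow {w : ℂ} (hw : w ∈ Complex.slitPlane) (c : ℂ) :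
    ContinuousOn (fun τ : ℝ => ((τ : ℂ) + 2 * w) ^ c) (Ici 0) :=
  ContinuousOn.cpow_const (by fun_prop) fun _ hτ => ofReal_add_mem_slitPlane hτ hw

theorem aestronglyMeasurable_laplaceMoment {w : ℂ} (hw : w ∈ Complex.slitPlane) (c : ℂ) :
    AEStronglyMeasurable (fun τ : ℝ => (gammaWeight τ : ℂ) * ((τ : ℂ) + 2 * w) ^ c)
      (volume.restrict (Ioi 0)) :=
  integrableOn_gammaWeight.ofReal.aestronglyMeasurable.mul
    (((continuousOn_ofReal_add_cpow hw c).mono Ioi_subset_Ici_self).aestronglyMeasurable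
      measurableSet_Ioi)

theorem exists_ball_norm_laplaceMoment_le {w₀ : ℂ} (hw₀ : w₀ ∈ Complex.slitPlane) :
    ∃ δ > 0, Metric.ball w₀ δ ⊆ Complex.slitPlane ∧ ∀ a : ℝ, 0 ≤ a → ∀ w ∈ Metric.ball w₀ δ,
      ∀ τ ∈ Ioi (0 : ℝ), ‖(gammaWeight τ : ℂ) * ((τ : ℂ) + 2 * w) ^ ((-a : ℝ) : ℂ)‖ ≤
        gammaWeight τ * (2 * δ) ^ (-a) := by
  obtain ⟨ε, hε, hball⟩ := Metric.isOpen_iff.1 Complex.isOpen_slitPlane w₀ hw₀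
  refine ⟨ε / 2, half_pos hε, (Metric.ball_subset_ball (half_le_self hε.le)).trans hball,
    fun a ha w hw τ hτ => ?_⟩
  have hτ0 : 0 < τ := hτ
  rw [norm_mul, Complex.norm_real, Real.norm_of_nonneg (gammaWeight_nonneg τ),
    Complex.norm_cpow_real]
  refine mul_le_mul_of_nonneg_left (Real.rpow_le_rpow_of_nonpos (by positivity)
    (le_norm_ofReal_add ?_ hw hτ0.le) (neg_nonpos.2 ha)) (gammaWeight_nonneg τ)
  rwa [mul_div_cancel₀ _ two_ne_zero]

theorem integrableOn_laplaceMoment {w : ℂ} (hw : w ∈ Complex.slitPlane) {a : ℝ} (ha : 0 ≤ a) :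
    IntegrableOn (fun τ : ℝ => (gammaWeight τ : ℂ) * ((τ : ℂ) + 2 * w) ^ ((-a : ℝ) : ℂ))
      (Ioi 0) := by
  obtain ⟨δ, hδ, -, hbound⟩ := exists_ball_norm_laplaceMoment_le hw
  exact (integrableOn_gammaWeight.mul_const _).mono' (aestronglyMeasurable_laplaceMoment hw _)
    ((ae_restrict_mem measurableSet_Ioi).mono (hbound a ha w (Metric.mem_ball_self hδ)))

theorem hasDerivAt_laplaceMoment {w : ℂ} (hw : w ∈ Complex.slitPlane) {a : ℝ} (ha : 0 ≤ a) :
    HasDerivAt (laplaceMoment a) (-(2 * a) * laplaceMoment (a + 1) w) w := by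
  obtain ⟨δ, hδ, hball, hbound⟩ := exists_ball_norm_laplaceMoment_le hw
  have key := hasDerivAt_integral_of_dominated_loc_of_deriv_le
    (μ := volume.restrict (Ioi (0 : ℝ))) (x₀ := w) (s := Metric.ball w δ)
    (F := fun w (τ : ℝ) => (gammaWeight τ : ℂ) * ((τ : ℂ) + 2 * w) ^ ((-a : ℝ) : ℂ))
    (F' := fun w (τ : ℝ) => -(2 * a) *
      ((gammaWeight τ : ℂ) * ((τ : ℂ) + 2 * w) ^ ((-(a + 1) : ℝ) : ℂ)))
    (bound := fun τ => 2 * a * (gammaWeight τ * (2 * δ) ^ (-(a + 1))))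
    (Metric.ball_mem_nhds w hδ)
    (eventually_of_mem (Metric.ball_mem_nhds w hδ) fun z hz =>
      aestronglyMeasurable_laplaceMoment (hball hz) _)
    (integrableOn_laplaceMoment hw ha)
    ((aestronglyMeasurable_laplaceMoment hw _).const_mul _)
    ((ae_restrict_mem measurableSet_Ioi).mono fun τ hτ z hz => ?_)
    ((integrableOn_gammaWeight.mul_const _).const_mul _)
    ((ae_restrict_mem measurableSet_Ioi).mono fun τ hτ z hz => ?_)
  · exact key.2.congr_deriv (by rw [integral_const_mul, laplaceMoment])
  · rw [norm_mul, norm_neg, norm_mul, Complex.norm_ofNat, Complex.norm_real,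
      Real.norm_of_nonneg ha]
    exact mul_le_mul_of_nonneg_left (hbound _ (by positivity) z hz τ hτ) (by positivity)
  · refine (((((hasDerivAt_id z).const_mul 2).const_add (τ : ℂ)).cpow_const
      (c := ((-a : ℝ) : ℂ)) (ofReal_add_mem_slitPlane (le_of_lt hτ) (hball hz))).const_mul
      (gammaWeight τ : ℂ)).congr_deriv ?_
    rw [show ((-(a + 1) : ℝ) : ℂ) = ((-a : ℝ) : ℂ) - 1 by push_cast; ring]
    push_cast
    simp only [id]
    ring

theorem hasDerivAt_exp_mul_sqrt_mul_cpow {w : ℂ} (hw : w ∈ Complex.slitPlane) {τ : ℝ}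
    (hτ : 0 < τ) :
    HasDerivAt (fun τ : ℝ => ((Real.exp (-τ) * √τ : ℝ) : ℂ) * (τ + 2 * w) ^ ((-(3 / 2) : ℝ) : ℂ))
      (3 * w * (gammaWeight τ * (τ + 2 * w) ^ ((-(5 / 2) : ℝ) : ℂ)) +
        2 * w * (gammaWeight τ * (τ + 2 * w) ^ ((-(3 / 2) : ℝ) : ℂ)) -
        (gammaWeight τ * (τ + 2 * w) ^ ((-(1 / 2) : ℝ) : ℂ) +
          gammaWeight τ * (τ + 2 * w) ^ ((-(3 / 2) : ℝ) : ℂ))) τ := by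
  have hS := ofReal_add_mem_slitPlane hτ.le hw
  have hreal : HasDerivAt (fun τ => Real.exp (-τ) * √τ) (gammaWeight τ * (1 / 2 - τ)) τ := by
    refine ((hasDerivAt_neg τ).exp.fun_mul (Real.hasDerivAt_sqrt hτ.ne')).congr_deriv ?_
    have := Real.sqrt_ne_zero'.2 hτ
    rw [gammaWeight]
    field_simp
    rw [Real.sq_sqrt hτ.le]
    ring
  have hlift (a : ℝ) : ((τ : ℂ) + 2 * w) ^ ((-a : ℝ) : ℂ) =
      (τ + 2 * w) ^ ((-(a + 1) : ℝ) : ℂ) * (τ + 2 * w) := by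
    nth_rw 3 [← Complex.cpow_one ((τ : ℂ) + 2 * w)]
    rw [← Complex.cpow_add _ _ (Complex.slitPlane_ne_zero hS)]
    push_cast
    ring_nf
  have hpow := (((hasDerivAt_id (τ : ℂ)).add_const (2 * w)).cpow_const
    (c := ((-(3 / 2) : ℝ) : ℂ)) hS).comp_ofReal
  refine (hreal.ofReal_comp.mul hpow).congr_deriv ?_
  rw [id, show ((-(3 / 2) : ℝ) : ℂ) - 1 = ((-(5 / 2) : ℝ) : ℂ) by push_cast; ring, hlift (1 / 2),
    show (1 / 2 + 1 : ℝ) = 3 / 2 by norm_num, hlift (3 / 2),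
    show (3 / 2 + 1 : ℝ) = 5 / 2 by norm_num, show Real.exp (-τ) * √τ = gammaWeight τ * τ by
      rw [gammaWeight, div_mul_eq_mul_div, mul_div_assoc, Real.div_sqrt]]
  push_cast
  ring

theorem tendsto_exp_mul_sqrt_mul_cpow_atTop {w : ℂ} (hw : w ∈ Complex.slitPlane) :
    Tendsto (fun τ : ℝ => ((Real.exp (-τ) * √τ : ℝ) : ℂ) * (τ + 2 * w) ^ ((-(3 / 2) : ℝ) : ℂ))
      atTop (𝓝 0) := by
  obtain ⟨δ, hδ, -, hbound⟩ := exists_ball_norm_laplaceMoment_le hw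
  have hlim : Tendsto (fun τ : ℝ => τ ^ 1 * Real.exp (-τ) * (2 * δ) ^ (-(3 / 2) : ℝ)) atTop
      (𝓝 0) := by
    simpa using (Real.tendsto_pow_mul_exp_neg_atTop_nhds_zero 1).mul_const
      ((2 * δ) ^ (-(3 / 2) : ℝ))
  refine squeeze_zero_norm' ?_ hlim
  filter_upwards [eventually_ge_atTop 1] with τ hτ
  have hτ0 : 0 < τ := one_pos.trans_le hτ
  have hweight : gammaWeight τ ≤ Real.exp (-τ) :=
    div_le_self (Real.exp_pos _).le (Real.one_le_sqrt.2 hτ)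
  calc _ = τ * ‖(gammaWeight τ : ℂ) * ((τ : ℂ) + 2 * w) ^ ((-(3 / 2) : ℝ) : ℂ)‖ := by
        rw [show Real.exp (-τ) * √τ = τ * gammaWeight τ by
          rw [gammaWeight, mul_div_left_comm, Real.div_sqrt], Complex.ofReal_mul, mul_assoc,
          norm_mul, Complex.norm_real, Real.norm_of_nonneg hτ0.le]
    _ ≤ τ * (Real.exp (-τ) * (2 * δ) ^ (-(3 / 2) : ℝ)) := by
        gcongr
        exact (hbound (3 / 2) (by norm_num) w (Metric.mem_ball_self hδ) τ hτ0).trans (by gcongr)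
    _ = τ ^ 1 * Real.exp (-τ) * (2 * δ) ^ (-(3 / 2) : ℝ) := by rw [pow_one, mul_assoc]

theorem laplaceMoment_recurrence {w : ℂ} (hw : w ∈ Complex.slitPlane) :
    3 * w * laplaceMoment (5 / 2) w + 2 * w * laplaceMoment (3 / 2) w =
      laplaceMoment (1 / 2) w + laplaceMoment (3 / 2) w := by
  have h₁ := integrableOn_laplaceMoment hw (a := 1 / 2) (by norm_num)
  have h₃ := integrableOn_laplaceMoment hw (a := 3 / 2) (by norm_num)
  have h₅ := integrableOn_laplaceMoment hw (a := 5 / 2) (by norm_num)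
  have hint := ((h₅.const_mul (3 * w)).add (h₃.const_mul (2 * w))).sub (h₁.add h₃)
  have hcont : ContinuousWithinAt (fun τ : ℝ => ((Real.exp (-τ) * √τ : ℝ) : ℂ) *
      (τ + 2 * w) ^ ((-(3 / 2) : ℝ) : ℂ)) (Ici 0) 0 :=
    (ContinuousOn.mul (by fun_prop) (continuousOn_ofReal_add_cpow hw _)) 0 self_mem_Ici
  have htop := tendsto_exp_mul_sqrt_mul_cpow_atTop hw
  have key := integral_Ioi_of_hasDerivAt_of_tendsto hcont
    (fun τ hτ => hasDerivAt_exp_mul_sqrt_mul_cpow hw hτ) hint htop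
  rw [Real.sqrt_zero, mul_zero, Complex.ofReal_zero, zero_mul, sub_zero] at key
  rw [← sub_eq_zero, ← key]
  simp only [laplaceMoment, ← integral_const_mul]
  rw [← integral_add (h₅.const_mul _) (h₃.const_mul _), ← integral_add h₁ h₃]
  exact (integral_sub ((h₅.const_mul _).add (h₃.const_mul _)) (h₁.add h₃)).symm

/-- The Laplace-type integral `e^{-w} ∫ e^{-τ} τ^{-1/2} (τ + 2 w)^{-1/2} dτ`, a formula for
`K₀(w)` from which its decay can be read off. -/
noncomputable def besselLaplace (w : ℂ) : ℂ := Complex.exp (-w) * laplaceMoment (1 / 2) w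

theorem isBesselSolution_besselLaplace :
    IsBesselSolution besselLaplace fun w =>
      w * (Complex.exp (-w) * (-laplaceMoment (1 / 2) w - laplaceMoment (3 / 2) w)) := by
  have h₁ {w : ℂ} (hw : w ∈ Complex.slitPlane) :
      HasDerivAt (laplaceMoment (1 / 2)) (-laplaceMoment (3 / 2) w) w := by
    have h := hasDerivAt_laplaceMoment hw one_half_pos.le
    norm_num at h
    exact h
  have h₃ {w : ℂ} (hw : w ∈ Complex.slitPlane) :
      HasDerivAt (laplaceMoment (3 / 2)) (-3 * laplaceMoment (5 / 2) w) w := by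
    have h := hasDerivAt_laplaceMoment hw (a := 3 / 2) (by norm_num)
    norm_num at h
    simpa using h
  have hexp (w : ℂ) : HasDerivAt (fun w => Complex.exp (-w)) (-Complex.exp (-w)) w := by
    simpa using (hasDerivAt_neg w).cexp
  refine ⟨fun w hw => ?_, fun w hw => ?_⟩
  · refine ((hexp w).mul (h₁ hw)).congr_deriv ?_
    rw [mul_div_cancel_left₀ _ (Complex.slitPlane_ne_zero hw)]
    ring
  · refine ((hasDerivAt_id w).mul ((hexp w).mul ((h₁ hw).neg.sub (h₃ hw)))).congr_deriv ?_
    simp only [besselLaplace, id, Pi.mul_apply, Pi.sub_apply, Pi.neg_apply]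
    linear_combination Complex.exp (-w) * laplaceMoment_recurrence hw

end LaplaceRepresentation

section LaplaceAsymptotics

theorem integrableOn_exp_neg_mul_log :
    IntegrableOn (fun τ : ℝ => Real.exp (-τ) * Real.log τ) (Ioi 0) := by
  have hone := Real.GammaIntegral_convergent (s := 2) (by norm_num)
  have hsqrt := (Real.GammaIntegral_convergent one_half_pos).const_mul 2
  have hlog {τ : ℝ} (hτ : 0 < τ) :
      |Real.log τ| ≤ τ ^ ((2 : ℝ) - 1) + 2 * τ ^ ((1 / 2 : ℝ) - 1) := by
    have hpow : 0 ≤ τ ^ ((1 / 2 : ℝ) - 1) := by positivity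
    have hneg := Real.log_le_rpow_div (inv_nonneg.2 hτ.le) one_half_pos
    rw [Real.log_inv, Real.inv_rpow hτ.le, ← Real.rpow_neg hτ.le,
      show (-(1 / 2) : ℝ) = 1 / 2 - 1 by norm_num] at hneg
    rw [show (2 : ℝ) - 1 = 1 by norm_num, Real.rpow_one, abs_le]
    constructor
    · linarith
    · linarith [Real.log_le_sub_one_of_pos hτ]
  refine (hone.add hsqrt).mono' (ContinuousOn.aestronglyMeasurable
    ((Continuous.continuousOn (by fun_prop)).mul
      (Real.continuousOn_log.mono fun τ hτ => ne_of_gt hτ)) measurableSet_Ioi) ?_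
  filter_upwards [ae_restrict_mem measurableSet_Ioi] with τ hτ
  rw [Real.norm_eq_abs, abs_mul, Real.abs_exp, Pi.add_apply]
  linarith [mul_le_mul_of_nonneg_left (hlog hτ) (Real.exp_pos (-τ)).le]

theorem integral_exp_neg_mul_log :
    ∫ τ in Ioi (0 : ℝ), Real.exp (-τ) * Real.log τ = -Real.eulerMascheroniConstant := by
  have hGamma : Complex.GammaIntegral =ᶠ[𝓝 1] Complex.Gamma := by
    filter_upwards [(isOpen_lt continuous_const Complex.continuous_re).mem_nhds
      (show (0 : ℝ) < (1 : ℂ).re by simp)] with z hz using (Complex.Gamma_eq_integral hz).symm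
  have hderiv := (Complex.hasDerivAt_Gamma_one.congr_of_eventuallyEq hGamma).unique
    (Complex.hasDerivAt_GammaIntegral (s := 1) (by simp))
  have hreal : ∫ t : ℝ in Ioi 0, (t : ℂ) ^ ((1 : ℂ) - 1) * (Real.log t * Real.exp (-t)) =
      ((∫ τ in Ioi (0 : ℝ), Real.exp (-τ) * Real.log τ : ℝ) : ℂ) := by
    rw [← integral_complex_ofReal]
    exact integral_congr_ae (Eventually.of_forall fun t => by simp [mul_comm])
  rw [hreal] at hderiv
  exact_mod_cast hderiv.symm

/-- The primitive `2 log (√τ + √(τ + 2 x))` of `τ ↦ τ^{-1/2} (τ + 2 x)^{-1/2}`. -/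
noncomputable def logSqrtAdd (x τ : ℝ) : ℝ := 2 * Real.log (√τ + √(τ + 2 * x))

theorem hasDerivAt_logSqrtAdd {x τ : ℝ} (hx : 0 ≤ x) (hτ : 0 < τ) :
    HasDerivAt (logSqrtAdd x) ((√τ)⁻¹ * (√(τ + 2 * x))⁻¹) τ := by
  have : 0 < √τ := Real.sqrt_pos.2 hτ
  have : 0 < √(τ + 2 * x) := Real.sqrt_pos.2 (by positivity)
  refine ((((Real.hasDerivAt_sqrt hτ.ne').fun_add
    (((hasDerivAt_id' τ).add_const (2 * x)).sqrt (by positivity))).log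
      (by positivity)).const_mul 2).congr_deriv ?_
  field_simp
  ring

theorem abs_logSqrtAdd_le {x τ : ℝ} (hx : x ∈ Icc 0 1) (hτ : 0 < τ) :
    |logSqrtAdd x τ| ≤ |Real.log τ| + 2 * (τ + 2) := by
  obtain ⟨hx0, hx1⟩ := hx
  have ha : 0 < √τ := Real.sqrt_pos.2 hτ
  have hb : 0 ≤ √(τ + 2 * x) := Real.sqrt_nonneg _
  have hlower := Real.log_le_log ha (le_add_of_nonneg_right hb)
  rw [Real.log_sqrt hτ.le] at hlower
  have hupper := Real.log_le_sub_one_of_pos (add_pos_of_pos_of_nonneg ha hb)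
  have hsum : √τ + √(τ + 2 * x) ≤ τ + 2 := by
    nlinarith [Real.sq_sqrt hτ.le, Real.sq_sqrt (show 0 ≤ τ + 2 * x by positivity),
      sq_nonneg (√τ - 1), sq_nonneg (√(τ + 2 * x) - 1)]
  rw [logSqrtAdd, abs_le]
  constructor <;> linarith [neg_abs_le (Real.log τ), abs_nonneg (Real.log τ)]

theorem integrableOn_exp_neg_mul_abs_log_add :
    IntegrableOn (fun τ : ℝ => Real.exp (-τ) * (|Real.log τ| + 2 * (τ + 2))) (Ioi 0) := by
  have hone := (Real.GammaIntegral_convergent (s := 2) (by norm_num)).const_mul 2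
  have hzero := (Real.GammaIntegral_convergent one_pos).const_mul 4
  refine IntegrableOn.congr_fun ((integrableOn_exp_neg_mul_log.abs.add hone).add hzero)
    (fun τ _ => ?_) measurableSet_Ioi
  simp only [Pi.add_apply, abs_mul, Real.abs_exp, sub_self, Real.rpow_zero,
    show (2 : ℝ) - 1 = 1 by norm_num, Real.rpow_one]
  ring

theorem aestronglyMeasurable_exp_neg_mul_logSqrtAdd {x : ℝ} (hx : 0 ≤ x) :
    AEStronglyMeasurable (fun τ => Real.exp (-τ) * logSqrtAdd x τ) (volume.restrict (Ioi 0)) :=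
  ContinuousOn.aestronglyMeasurable ((Continuous.continuousOn (by fun_prop)).mul
    fun _ hτ => (hasDerivAt_logSqrtAdd hx hτ).continuousAt.continuousWithinAt) measurableSet_Ioi

theorem ae_norm_exp_neg_mul_logSqrtAdd_le {x : ℝ} (hx : x ∈ Icc 0 1) :
    ∀ᵐ τ ∂volume.restrict (Ioi (0 : ℝ)),
      ‖Real.exp (-τ) * logSqrtAdd x τ‖ ≤ Real.exp (-τ) * (|Real.log τ| + 2 * (τ + 2)) := by
  filter_upwards [ae_restrict_mem measurableSet_Ioi] with τ hτ
  rw [norm_mul, Real.norm_of_nonneg (Real.exp_pos _).le, Real.norm_eq_abs]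
  exact mul_le_mul_of_nonneg_left (abs_logSqrtAdd_le hx hτ) (Real.exp_pos _).le

theorem integrableOn_exp_neg_mul_logSqrtAdd {x : ℝ} (hx : x ∈ Icc 0 1) :
    IntegrableOn (fun τ => Real.exp (-τ) * logSqrtAdd x τ) (Ioi 0) :=
  integrableOn_exp_neg_mul_abs_log_add.mono'
    (aestronglyMeasurable_exp_neg_mul_logSqrtAdd hx.1) (ae_norm_exp_neg_mul_logSqrtAdd_le hx)

theorem integral_exp_neg_mul_logSqrtAdd_zero :
    ∫ τ in Ioi (0 : ℝ), Real.exp (-τ) * logSqrtAdd 0 τ =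
      2 * Real.log 2 - Real.eulerMascheroniConstant :=
  calc ∫ τ in Ioi (0 : ℝ), Real.exp (-τ) * logSqrtAdd 0 τ
      = ∫ τ in Ioi (0 : ℝ), (Real.exp (-τ) * (2 * Real.log 2) + Real.exp (-τ) * Real.log τ) := by
        refine setIntegral_congr_fun measurableSet_Ioi fun τ hτ => ?_
        have hτ0 : 0 < τ := hτ
        rw [logSqrtAdd, mul_zero, add_zero, ← two_mul,
          Real.log_mul two_ne_zero (Real.sqrt_pos.2 hτ0).ne', Real.log_sqrt hτ0.le]
        ring
    _ = 2 * Real.log 2 - Real.eulerMascheroniConstant := by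
        rw [integral_add ((integrableOn_exp_neg_Ioi 0).mul_const _) integrableOn_exp_neg_mul_log,
          integral_mul_const, integral_exp_neg_Ioi_zero, integral_exp_neg_mul_log, one_mul,
          sub_eq_add_neg]

theorem tendsto_integral_exp_neg_mul_logSqrtAdd :
    Tendsto (fun x => ∫ τ in Ioi (0 : ℝ), Real.exp (-τ) * logSqrtAdd x τ) (𝓝[>] 0)
      (𝓝 (2 * Real.log 2 - Real.eulerMascheroniConstant)) := by
  rw [← integral_exp_neg_mul_logSqrtAdd_zero]
  have hsmall : ∀ᶠ x : ℝ in 𝓝[>] 0, x ∈ Icc 0 1 :=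
    mem_of_superset (Ioo_mem_nhdsGT one_pos) Ioo_subset_Icc_self
  refine tendsto_integral_filter_of_dominated_convergence _
    (hsmall.mono fun x hx => aestronglyMeasurable_exp_neg_mul_logSqrtAdd hx.1)
    (hsmall.mono fun x hx => ae_norm_exp_neg_mul_logSqrtAdd_le hx)
    integrableOn_exp_neg_mul_abs_log_add ?_
  filter_upwards [ae_restrict_mem measurableSet_Ioi] with τ hτ
  have hpos : √τ + √(τ + 2 * 0) ≠ 0 := by
    have : 0 < √τ := Real.sqrt_pos.2 hτ
    positivity
  exact ((((by fun_prop : ContinuousAt (fun x : ℝ => √τ + √(τ + 2 * x)) 0).log hpos).const_mul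
    2).const_mul (Real.exp (-τ))).tendsto.mono_left nhdsWithin_le_nhds

theorem continuousAt_logSqrtAdd_zero {x : ℝ} (hx : 0 < x) : ContinuousAt (logSqrtAdd x) 0 := by
  have hpos : √0 + √(0 + 2 * x) ≠ 0 := by
    have : 0 < √(0 + 2 * x) := Real.sqrt_pos.2 (by positivity)
    positivity
  exact ((by fun_prop : ContinuousAt (fun τ : ℝ => √τ + √(τ + 2 * x)) 0).log hpos).const_mul 2

theorem laplaceMoment_half_ofReal {x : ℝ} (hx : x ∈ Ioc 0 1) :
    laplaceMoment (1 / 2) x =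
      ((-Real.log (2 * x) + ∫ τ in Ioi (0 : ℝ), Real.exp (-τ) * logSqrtAdd x τ : ℝ) : ℂ) := by
  have hkernel : ∀ τ ∈ Ioi (0 : ℝ), (gammaWeight τ : ℂ) * (τ + 2 * x) ^ ((-(1 / 2) : ℝ) : ℂ) =
      ((Real.exp (-τ) * ((√τ)⁻¹ * (√(τ + 2 * x))⁻¹) : ℝ) : ℂ) := fun τ hτ => by
    have hτx : 0 ≤ τ + 2 * x := by linarith [mem_Ioi.1 hτ, hx.1]
    rw [show (τ : ℂ) + 2 * x = ((τ + 2 * x : ℝ) : ℂ) by push_cast; ring,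
      ← Complex.ofReal_cpow hτx, Real.rpow_neg hτx, ← Real.sqrt_eq_rpow, ← Complex.ofReal_mul,
      gammaWeight, div_eq_mul_inv, mul_assoc]
  have hint : IntegrableOn (fun τ => Real.exp (-τ) * ((√τ)⁻¹ * (√(τ + 2 * x))⁻¹)) (Ioi 0) := by
    have h := ((integrableOn_laplaceMoment (Complex.ofReal_mem_slitPlane.2 hx.1)
      one_half_pos.le).congr_fun hkernel measurableSet_Ioi).re
    simpa only [IntegrableOn, RCLike.re_eq_complex_re, Complex.ofReal_re] using h
  have hlog : IntegrableOn (fun τ => Real.exp (-τ) * logSqrtAdd x τ) (Ioi 0) :=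
    integrableOn_exp_neg_mul_logSqrtAdd (Ioc_subset_Icc_self hx)
  have hderiv : ∀ τ ∈ Ioi (0 : ℝ), HasDerivAt (fun τ => Real.exp (-τ) * logSqrtAdd x τ)
      (Real.exp (-τ) * ((√τ)⁻¹ * (√(τ + 2 * x))⁻¹) - Real.exp (-τ) * logSqrtAdd x τ) τ :=
    fun τ hτ => ((hasDerivAt_neg τ).exp.mul (hasDerivAt_logSqrtAdd hx.1.le hτ)).congr_deriv
      (by ring)
  have hcont : ContinuousAt (fun τ => Real.exp (-τ) * logSqrtAdd x τ) 0 :=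
    (by fun_prop : ContinuousAt (fun τ : ℝ => Real.exp (-τ)) 0).mul
      (continuousAt_logSqrtAdd_zero hx.1)
  have hparts := integral_Ioi_of_hasDerivAt_of_tendsto hcont.continuousWithinAt hderiv
    (hint.sub hlog) (tendsto_zero_of_hasDerivAt_of_integrableOn_Ioi hderiv (hint.sub hlog) hlog)
  rw [integral_sub hint hlog, sub_eq_iff_eq_add, logSqrtAdd, Real.sqrt_zero, zero_add, zero_add,
    Real.log_sqrt (mul_nonneg zero_le_two hx.1.le), mul_div_cancel₀ _ two_ne_zero, neg_zero,
    Real.exp_zero, one_mul, zero_sub] at hparts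
  rw [laplaceMoment, setIntegral_congr_fun measurableSet_Ioi hkernel, integral_complex_ofReal,
    hparts]

theorem tendsto_besselLaplace_add_log_zero :
    Tendsto (fun x : ℝ => besselLaplace x + (Complex.log (x / 2) + Real.eulerMascheroniConstant))
      (𝓝[>] 0) (𝓝 0) := by
  have hexp : Differentiable ℂ fun z : ℂ => Complex.exp (-z) := by fun_prop
  have hlog := tendsto_log_half_mul_nhds_zero (f := fun z => 1 - Complex.exp (-z))
    ((hexp 0).const_sub 1) (by simp)
  have hone := tendsto_ofReal_of_continuousAt (hexp 0).continuousAt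
  have hrem := (Complex.continuous_ofReal.tendsto _).comp
    (tendsto_integral_exp_neg_mul_logSqrtAdd.add_const
      (Real.eulerMascheroniConstant - 2 * Real.log 2))
  have hlim := hlog.add (hone.mul hrem)
  simp only [neg_zero, Complex.exp_zero, sub_add_sub_cancel, sub_self, Complex.ofReal_zero,
    mul_zero, add_zero] at hlim
  refine hlim.congr' ?_
  filter_upwards [Ioo_mem_nhdsGT one_pos] with x hx
  have hsplit : Real.log (2 * x) = Real.log (x / 2) + 2 * Real.log 2 := by
    rw [Real.log_mul two_ne_zero hx.1.ne', Real.log_div hx.1.ne' two_ne_zero]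
    ring
  rw [besselLaplace, laplaceMoment_half_ofReal (Ioo_subset_Ioc_self hx), hsplit,
    show (x : ℂ) / 2 = ((x / 2 : ℝ) : ℂ) by push_cast; rfl,
    ← Complex.ofReal_log (div_nonneg hx.1.le zero_le_two)]
  simp only [Function.comp_apply]
  push_cast
  ring

theorem besselLaplace_eq_besselK0 {w : ℂ} (hw : w ∈ Complex.slitPlane) :
    besselLaplace w = besselK0 w := by
  refine sub_eq_zero.1
    ((isBesselSolution_besselLaplace.sub isBesselSolution_besselK0).eq_zero ?_ hw)
  simpa using tendsto_besselLaplace_add_log_zero.sub tendsto_besselK0_add_log_zero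

theorem mem_slitPlane_of_im_le_re {w : ℂ} (hw : w ≠ 0) (h : w.im ≤ w.re) :
    w ∈ Complex.slitPlane := by
  rw [Complex.mem_slitPlane_iff]
  by_contra! hcon
  rw [hcon.2] at h
  exact hw (Complex.ext (le_antisymm hcon.1 h) hcon.2)

theorem norm_le_norm_ofReal_add {w : ℂ} (h : w.im ≤ w.re) {τ : ℝ} (hτ : 0 ≤ τ) :
    ‖w‖ ≤ ‖(τ : ℂ) + 2 * w‖ := by
  rw [← sq_le_sq₀ (norm_nonneg _) (norm_nonneg _), ← Complex.normSq_eq_norm_sq,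
    ← Complex.normSq_eq_norm_sq, Complex.normSq_apply, Complex.normSq_apply]
  simp only [Complex.add_re, Complex.add_im, Complex.ofReal_re, Complex.ofReal_im, Complex.mul_re,
    Complex.mul_im, Complex.re_ofNat, Complex.im_ofNat, zero_mul, sub_zero, add_zero, zero_add]
  rcases le_total 0 w.re with hre | hre
  · nlinarith [mul_nonneg hτ hre]
  · nlinarith [sq_nonneg (τ + 2 * w.re)]

theorem exists_norm_besselK0_le : ∃ C, 0 ≤ C ∧ ∀ w : ℂ, w ≠ 0 → w.im ≤ w.re →
    ‖besselK0 w‖ ≤ C * (Real.exp (-w.re) * ‖w‖ ^ (-(1 / 2) : ℝ)) := by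
  refine ⟨∫ τ in Ioi (0 : ℝ), gammaWeight τ, integral_nonneg gammaWeight_nonneg,
    fun w hw h => ?_⟩
  have hmoment : ‖laplaceMoment (1 / 2) w‖ ≤
      ∫ τ in Ioi (0 : ℝ), gammaWeight τ * ‖w‖ ^ (-(1 / 2) : ℝ) := by
    refine norm_integral_le_of_norm_le (integrableOn_gammaWeight.mul_const _) ?_
    filter_upwards [ae_restrict_mem measurableSet_Ioi] with τ hτ
    rw [norm_mul, Complex.norm_real, Real.norm_of_nonneg (gammaWeight_nonneg τ),
      Complex.norm_cpow_real]
    exact mul_le_mul_of_nonneg_left (Real.rpow_le_rpow_of_nonpos (norm_pos_iff.2 hw)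
      (norm_le_norm_ofReal_add h (le_of_lt hτ)) (by norm_num)) (gammaWeight_nonneg τ)
  rw [integral_mul_const] at hmoment
  rw [← besselLaplace_eq_besselK0 (mem_slitPlane_of_im_le_re hw h), besselLaplace, norm_mul,
    Complex.norm_exp, Complex.neg_re, mul_left_comm]
  exact mul_le_mul_of_nonneg_left hmoment (Real.exp_pos _).le

end LaplaceAsymptotics

/-! ### The transfer operator -/

section TransferOperator

theorem IsRootKernel.analyticAt_comp_cpow_half {ξ C : ℝ} {k : ℂ → ℂ} (hk : IsRootKernel ξ C k)
    {z : ℂ} (hz : z ∈ Complex.slitPlane) : AnalyticAt ℂ (fun z : ℂ => k (z ^ (1 / 2 : ℂ))) z := by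
  refine DifferentiableOn.analyticAt (fun w hw => ?_) (Complex.isOpen_slitPlane.mem_nhds hz)
  exact ((hk.differentiableAt _ (re_cpow_half_nonneg w)
    (cpow_half_ne_zero (Complex.slitPlane_ne_zero hw))).comp w
      (differentiableAt_id.cpow_const hw)).differentiableWithinAt

/-- The principal value `e^{-iπ/4}` of `√(1/i)`. -/
noncomputable def invSqrtI : ℂ := Complex.exp (-(Real.pi / 4 : ℂ) * Complex.I)

theorem invSqrtI_eq : invSqrtI = ((√2 / 2 : ℝ) : ℂ) * (1 - Complex.I) := by
  rw [invSqrtI, show (-(Real.pi / 4 : ℂ)) = ((-(Real.pi / 4) : ℝ) : ℂ) by push_cast; rfl,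
    Complex.exp_mul_I, ← Complex.ofReal_cos, ← Complex.ofReal_sin, Real.cos_neg, Real.sin_neg,
    Real.cos_pi_div_four, Real.sin_pi_div_four]
  push_cast
  ring

theorem invSqrtI_ne_zero : invSqrtI ≠ 0 := Complex.exp_ne_zero _

theorem norm_invSqrtI_mul (s : ℂ) : ‖invSqrtI * s‖ = ‖s‖ := by
  rw [invSqrtI, show (-(Real.pi / 4 : ℂ)) = ((-(Real.pi / 4) : ℝ) : ℂ) by push_cast; rfl,
    norm_mul, Complex.norm_exp_ofReal_mul_I, one_mul]

theorem invSqrtI_mul_re (s : ℂ) : (invSqrtI * s).re = √2 / 2 * (s.re + s.im) := by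
  rw [invSqrtI_eq, mul_assoc, Complex.re_ofReal_mul, sub_mul, one_mul, Complex.sub_re,
    Complex.I_mul_re, sub_neg_eq_add]

theorem invSqrtI_mul_im (s : ℂ) : (invSqrtI * s).im = √2 / 2 * (s.im - s.re) := by
  rw [invSqrtI_eq, mul_assoc, Complex.im_ofReal_mul, sub_mul, one_mul, Complex.sub_im,
    Complex.I_mul_im]

theorem invSqrtI_mul_mul_I (u : ℂ) :
    invSqrtI * (u * Complex.I) = Complex.exp (Complex.I * (Real.pi / 4 : ℂ)) * u := by
  have hexp : invSqrtI * Complex.I = Complex.exp (Complex.I * (Real.pi / 4 : ℂ)) := by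
    calc invSqrtI * Complex.I
        = Complex.exp (-(Real.pi / 4 : ℂ) * Complex.I) * Complex.exp (Real.pi / 2 * Complex.I) := by
          rw [Complex.exp_pi_div_two_mul_I, invSqrtI]
      _ = Complex.exp (Complex.I * (Real.pi / 4 : ℂ)) := by
          rw [← Complex.exp_add]
          ring_nf
  rw [← hexp]
  ring

theorem invSqrtI_mul_im_le_re {s : ℂ} (hs : 0 ≤ s.re) :
    (invSqrtI * s).im ≤ (invSqrtI * s).re := by
  rw [invSqrtI_mul_re, invSqrtI_mul_im]
  gcongr
  linarith

theorem neg_sqrt_le_invSqrtI_mul_re {s : ℂ} {ξ : ℝ} (hs : 0 ≤ s.re) (hξ : -ξ ≤ (s ^ 2).re) :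
    -√ξ ≤ (invSqrtI * s).re := by
  rw [invSqrtI_mul_re]
  rw [sq, Complex.mul_re] at hξ
  have hle : √2 / 2 ≤ 1 := by linarith [Real.sqrt_two_lt_three_halves]
  rcases le_total 0 (s.re + s.im) with h | h
  · exact (neg_nonpos.2 (Real.sqrt_nonneg ξ)).trans (by positivity)
  · have hsqrt : -(s.re + s.im) ≤ √ξ := Real.le_sqrt_of_sq_le (by nlinarith)
    nlinarith

theorem norm_exp_neg_mul_invSqrtI_mul_le {d ξ : ℝ} (hd : 0 ≤ d) {s : ℂ} (hs : 0 ≤ s.re)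
    (hξ : -ξ ≤ (s ^ 2).re) :
    ‖Complex.exp (-(d : ℂ) * (invSqrtI * s))‖ ≤ Real.exp (d * √ξ) := by
  rw [Complex.norm_exp, ← Complex.ofReal_neg, Complex.re_ofReal_mul, Real.exp_le_exp, neg_mul,
    ← mul_neg]
  exact mul_le_mul_of_nonneg_left (neg_le.1 (neg_sqrt_le_invSqrtI_mul_re hs hξ)) hd

theorem transferOfRoot_one (d : ℝ) (s : ℂ) : transferOfRoot 1 d s =
    1 / (2 * (invSqrtI * s)) * Complex.exp (-(d : ℂ) * (invSqrtI * s)) := rfl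

theorem transferOfRoot_two (d : ℝ) (s : ℂ) : transferOfRoot 2 d s =
    1 / (2 * (Real.pi : ℂ)) * besselK0 ((d : ℂ) * (invSqrtI * s)) := rfl

theorem transferOfRoot_three (d : ℝ) (s : ℂ) : transferOfRoot 3 d s =
    1 / (4 * (Real.pi : ℂ) * (d : ℂ)) * Complex.exp (-(d : ℂ) * (invSqrtI * s)) := rfl

theorem isRootKernel_transferOfRoot_one {d : ℝ} (hd : 0 ≤ d) (ξ : ℝ) :
    IsRootKernel ξ (Real.exp (d * √ξ)) (transferOfRoot 1 d) where
  differentiableAt s _ hs0 := by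
    have hne : 2 * (invSqrtI * s) ≠ 0 := mul_ne_zero two_ne_zero (mul_ne_zero invSqrtI_ne_zero hs0)
    simp only [funext (transferOfRoot_one d)]
    fun_prop (disch := assumption)
  norm_le s hs _ hξ := by
    have hinv : ‖1 / (2 * (invSqrtI * s))‖ ≤ 1 + ‖s‖⁻¹ := by
      rw [norm_div, norm_one, norm_mul, Complex.norm_ofNat, norm_invSqrtI_mul, one_div, mul_inv]
      linarith [inv_nonneg.2 (norm_nonneg s)]
    rw [transferOfRoot_one, norm_mul, mul_comm]
    exact mul_le_mul (norm_exp_neg_mul_invSqrtI_mul_le hd hs hξ) hinv (norm_nonneg _)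
      (Real.exp_pos _).le

theorem isRootKernel_transferOfRoot_three {d : ℝ} (hd : 0 ≤ d) (ξ : ℝ) :
    IsRootKernel ξ (‖(1 / (4 * Real.pi * d) : ℂ)‖ * Real.exp (d * √ξ)) (transferOfRoot 3 d) where
  differentiableAt s _ _ := by
    simp only [funext (transferOfRoot_three d)]
    fun_prop
  norm_le s hs _ hξ := by
    rw [transferOfRoot_three, norm_mul]
    exact (mul_le_mul_of_nonneg_left (norm_exp_neg_mul_invSqrtI_mul_le hd hs hξ)
      (norm_nonneg _)).trans (le_mul_of_one_le_right (by positivity)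
        (le_add_of_nonneg_right (inv_nonneg.2 (norm_nonneg s))))

theorem rpow_neg_half_le {t : ℝ} (ht : 0 < t) : t ^ (-(1 / 2) : ℝ) ≤ 1 + t⁻¹ := by
  have hinv : 0 < t⁻¹ := inv_pos.2 ht
  rw [Real.rpow_neg ht.le, ← Real.inv_rpow ht.le, ← Real.sqrt_eq_rpow]
  exact Real.sqrt_le_iff.2 ⟨by positivity, by nlinarith⟩

theorem exists_isRootKernel_transferOfRoot_two {d : ℝ} (hd : 0 < d) (ξ : ℝ) :
    ∃ C, 0 ≤ C ∧ IsRootKernel ξ C (transferOfRoot 2 d) := by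
  obtain ⟨C, hC, hK⟩ := exists_norm_besselK0_le
  have hdom {s : ℂ} (hs : 0 ≤ s.re) : ((d : ℂ) * (invSqrtI * s)).im ≤ (d * (invSqrtI * s)).re := by
    rw [Complex.re_ofReal_mul, Complex.im_ofReal_mul]
    exact mul_le_mul_of_nonneg_left (invSqrtI_mul_im_le_re hs) hd.le
  have hne {s : ℂ} (hs0 : s ≠ 0) : (d : ℂ) * (invSqrtI * s) ≠ 0 :=
    mul_ne_zero (Complex.ofReal_ne_zero.2 hd.ne') (mul_ne_zero invSqrtI_ne_zero hs0)
  refine ⟨‖(1 / (2 * Real.pi) : ℂ)‖ * (C * (Real.exp (d * √ξ) * (1 + d⁻¹))), by positivity,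
    fun s hs hs0 => ?_, fun s hs hs0 hξ => ?_⟩
  · simp only [funext (transferOfRoot_two d)]
    have hlin : DifferentiableAt ℂ (fun s : ℂ => (d : ℂ) * (invSqrtI * s)) s := by fun_prop
    exact (((isBesselSolution_besselK0.hasDerivAt _
      (mem_slitPlane_of_im_le_re (hne hs0) (hdom hs))).differentiableAt).comp s
        hlin).const_mul _
  · have hs' : 0 < ‖s‖ := norm_pos_iff.2 hs0
    have hpow : (d * ‖s‖) ^ (-(1 / 2) : ℝ) ≤ (1 + d⁻¹) * (1 + ‖s‖⁻¹) := by
      refine (rpow_neg_half_le (by positivity)).trans ?_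
      rw [mul_inv]
      nlinarith [inv_pos.2 hd, inv_pos.2 hs']
    have hexp : -(d * (invSqrtI * s).re) ≤ d * √ξ := by
      rw [← mul_neg]
      exact mul_le_mul_of_nonneg_left (neg_le.1 (neg_sqrt_le_invSqrtI_mul_re hs hξ)) hd.le
    have hbound := hK _ (hne hs0) (hdom hs)
    rw [Complex.re_ofReal_mul, norm_mul, norm_invSqrtI_mul, Complex.norm_real,
      Real.norm_of_nonneg hd.le] at hbound
    rw [transferOfRoot_two, norm_mul, mul_assoc, mul_assoc, mul_assoc]
    refine mul_le_mul_of_nonneg_left (hbound.trans ?_) (norm_nonneg _)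
    gcongr

theorem exists_isRootKernel_transferOfRoot {D : ℕ} (hD : D = 1 ∨ D = 2 ∨ D = 3) {d : ℝ}
    (hd : 0 ≤ d) (hd' : D = 1 ∨ 0 < d) (ξ : ℝ) :
    ∃ C, 0 ≤ C ∧ IsRootKernel ξ C (transferOfRoot D d) := by
  rcases hD with rfl | rfl | rfl
  · exact ⟨_, (Real.exp_pos _).le, isRootKernel_transferOfRoot_one hd ξ⟩
  · exact exists_isRootKernel_transferOfRoot_two (hd'.resolve_left (by norm_num)) ξ
  · exact ⟨_, by positivity, isRootKernel_transferOfRoot_three hd ξ⟩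

theorem jumpG_eq_transferOfRoot_sub (D : ℕ) (d lam : ℝ) : jumpG D d lam =
    transferOfRoot D d (-(√lam * Complex.I)) - transferOfRoot D d (√lam * Complex.I) := by
  rw [jumpG, transferPolar, transferPolar, Complex.exp_pi_div_two_mul_I, Complex.ofReal_neg,
    neg_div, neg_mul, Complex.exp_neg, Complex.exp_pi_div_two_mul_I, Complex.inv_I, mul_neg]

theorem exp_I_mul_pi_div_four_sq :
    Complex.exp (Complex.I * (Real.pi / 4 : ℂ)) ^ 2 = Complex.I := by
  rw [← Complex.exp_nat_mul]
  refine Eq.trans ?_ Complex.exp_pi_div_two_mul_I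
  push_cast
  ring_nf

theorem jumpG_one (d : ℝ) {lam : ℝ} (hlam : 0 < lam) : jumpG 1 d lam =
    Complex.I * Complex.exp (Complex.I * (Real.pi / 4 : ℂ)) / (√lam : ℂ) *
      Complex.cosh ((d : ℂ) * Complex.exp (Complex.I * (Real.pi / 4 : ℂ)) * (√lam : ℂ)) := by
  have hsqrt : (√lam : ℂ) ≠ 0 := Complex.ofReal_ne_zero.2 (Real.sqrt_ne_zero'.2 hlam)
  rw [jumpG_eq_transferOfRoot_sub]
  simp only [transferOfRoot_one, mul_neg, invSqrtI_mul_mul_I]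
  set ω := Complex.exp (Complex.I * (Real.pi / 4 : ℂ))
  have hω0 : ω ≠ 0 := Complex.exp_ne_zero _
  have hinv : (1 : ℂ) / (2 * (ω * √lam)) = -(Complex.I * ω / (2 * √lam)) := by
    field_simp
    rw [exp_I_mul_pi_div_four_sq, Complex.I_mul_I, neg_neg]
  rw [div_neg, hinv, neg_neg, neg_mul, neg_neg, Complex.cosh, ← mul_assoc]
  ring

theorem jumpG_three (d lam : ℝ) : jumpG 3 d lam =
    1 / (2 * (Real.pi : ℂ) * (d : ℂ)) *
      Complex.sinh ((d : ℂ) * Complex.exp (Complex.I * (Real.pi / 4 : ℂ)) * (√lam : ℂ)) := by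
  rw [jumpG_eq_transferOfRoot_sub]
  simp only [transferOfRoot_three, mul_neg, invSqrtI_mul_mul_I]
  rw [neg_mul, neg_neg, Complex.sinh, ← mul_assoc]
  ring

theorem besselK0_neg_sub {z : ℂ} (hz : 0 < z.im) :
    besselK0 (-z) - besselK0 z = Real.pi * Complex.I * besselI0 z := by
  have hhalf : 0 < (z / 2).im := by simpa using hz
  have hlog : Complex.log (-z / 2) = Complex.log (z / 2) - Real.pi * Complex.I := by
    rw [neg_div, Complex.log, Complex.log, norm_neg, Complex.arg_neg_eq_arg_sub_pi_of_im_pos hhalf]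
    push_cast
    ring
  rw [besselK0, besselK0, hlog, besselI0, besselI0, neg_sq]
  ring

theorem besselJ0_eq_besselI0 (z : ℂ) : besselJ0 z = besselI0 (z * Complex.I) := by
  rw [besselJ0, besselI0, mul_pow, Complex.I_sq]
  exact tsum_congr fun k => by rw [← mul_pow, neg_one_mul, mul_neg_one, neg_div]

theorem jumpG_two {d lam : ℝ} (hd : 0 < d) (hlam : 0 < lam) : jumpG 2 d lam =
    Complex.I / 2 * besselJ0 (Complex.exp (-(Complex.I * (Real.pi / 4 : ℂ))) *
      (√lam : ℂ) * (d : ℂ)) := by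
  have harg : Complex.exp (-(Complex.I * (Real.pi / 4 : ℂ))) * √lam * d * Complex.I =
      d * (Complex.exp (Complex.I * (Real.pi / 4 : ℂ)) * √lam) := by
    rw [← invSqrtI_mul_mul_I, invSqrtI, neg_mul, mul_comm Complex.I]
    ring
  have him : 0 < ((d : ℂ) * (Complex.exp (Complex.I * (Real.pi / 4 : ℂ)) * √lam)).im := by
    rw [← invSqrtI_mul_mul_I, Complex.im_ofReal_mul, invSqrtI_mul_im, Complex.im_ofReal_mul,
      Complex.re_ofReal_mul, Complex.I_im, Complex.I_re, mul_zero, mul_one, sub_zero]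
    positivity
  have hpi : (Real.pi : ℂ) ≠ 0 := Complex.ofReal_ne_zero.2 Real.pi_ne_zero
  rw [jumpG_eq_transferOfRoot_sub]
  simp only [transferOfRoot_two, mul_neg, invSqrtI_mul_mul_I]
  rw [← mul_sub, besselK0_neg_sub him, besselJ0_eq_besselI0, harg]
  field_simp

end TransferOperator

/-! ### Runge-Kutta convolution quadrature -/

section InverseSpectrum

variable {ι : Type*} [Fintype ι] [DecidableEq ι] {B : Matrix ι ι ℂ}

theorem isUnit_det_of_spectrum_re_pos (hre : ∀ μ ∈ spectrum ℂ B, 0 < μ.re) : IsUnit B.det := by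
  simpa using isUnit_det_sub_smul_one (z := 0) fun h0 => lt_irrefl _ (hre 0 h0)

theorem spectrum_inv_re_pos (hre : ∀ μ ∈ spectrum ℂ B, 0 < μ.re) :
    ∀ μ ∈ spectrum ℂ B⁻¹, 0 < μ.re := by
  intro μ hμ
  have hinv : μ⁻¹ ∈ spectrum ℂ B := spectrum.inv₀_mem_iff
    (a := Matrix.nonsingInvUnit B (isUnit_det_of_spectrum_re_pos hre)).2 hμ
  have hpos := hre _ hinv
  rw [Complex.inv_re] at hpos
  by_contra! hneg
  exact hpos.not_ge (div_nonpos_of_nonpos_of_nonneg hneg (Complex.normSq_nonneg _))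

theorem mul_mem_spectrum_iff {c z : ℂ} (hc : c ≠ 0) :
    c * z ∈ spectrum ℂ B ↔ z ∈ spectrum ℂ (c⁻¹ • B) := by
  have h := spectrum.smul_mem_smul_iff (a := c⁻¹ • B) (s := z) (r := Units.mk0 c hc)
  rwa [Units.smul_def, Units.smul_def, Units.val_mk0, smul_inv_smul₀ hc, smul_eq_mul] at h

end InverseSpectrum

theorem exists_isDecayingWeight_rankOneCoeff {ι : Type*} [Fintype ι] [DecidableEq ι]
    {B : Matrix ι ι ℂ} {ρ : ℝ} (hB : spectrum ℂ B ⊆ apolloniusDisc ρ) (u v : ι → ℂ) {n : ℕ}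
    (hn : 1 ≤ n) (i j : ι) :
    ∃ C, 0 ≤ C ∧
      IsDecayingWeight ρ C fun z => rankOneCoeff (B - z • (1 : Matrix ι ι ℂ)) u v n i j := by
  obtain ⟨C, hC⟩ := exists_norm_rankOneCoeff_le u v (isOpen_apolloniusDisc ρ).isClosed_compl
    (disjoint_compl_left_iff_subset.2 hB) i j
  refine ⟨|C| ^ (n + 1), by positivity,
    fun z hz => differentiableAt_rankOneCoeff n i j (notMem_subset hB hz), fun z hz => ?_⟩
  have hbase : 1 ≤ 1 + ‖z‖ := le_add_of_nonneg_right (norm_nonneg z)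
  calc _ ≤ (C / (1 + ‖z‖)) ^ (n + 1) := hC n z hz
    _ ≤ |C / (1 + ‖z‖)| ^ (n + 1) := (le_abs_self _).trans_eq (abs_pow _ _)
    _ = |C| ^ (n + 1) / (1 + ‖z‖) ^ (n + 1) := by
        rw [abs_div, abs_of_pos (zero_lt_one.trans_le hbase), div_pow]
    _ ≤ |C| ^ (n + 1) / (1 + ‖z‖) ^ 2 := by
        gcongr
        omega

namespace RKMethod

variable {m : ℕ} {M : RKMethod m}

theorem bC_eq_single_vecMul_AC (hA : IsUnit M.AC.det)
    (hb : M.b ᵥ* M.A⁻¹ = Pi.single (Fin.last m) 1) :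
    M.bC = Pi.single (Fin.last m) 1 ᵥ* M.AC := by
  have hdet : IsUnit M.A.det := by
    have hmap : M.AC.det = Complex.ofRealHom M.A.det := (Complex.ofRealHom.map_det M.A).symm
    rwa [hmap, isUnit_map_iff] at hA
  have hlast : M.b = M.A (Fin.last m) := by
    rw [← Matrix.vecMul_one M.b, ← Matrix.nonsing_inv_mul _ hdet, ← Matrix.vecMul_vecMul, hb,
      Matrix.single_one_vecMul]
    rfl
  rw [Matrix.single_one_vecMul]
  ext i
  rw [bC, hlast]
  rfl

theorem symbol_eq_inv_sub (hA : IsUnit M.AC.det)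
    (hb : M.b ᵥ* M.A⁻¹ = Pi.single (Fin.last m) 1) {ζ : ℂ} (hζ : ζ ≠ 1) :
    M.symbol ζ =
      M.AC⁻¹ - ζ • Matrix.vecMulVec (M.AC⁻¹ *ᵥ 1) (Pi.single (Fin.last m) 1) := by
  have hζ' : 1 - ζ ≠ 0 := sub_ne_zero.2 hζ.symm
  set P : Matrix (Fin (m + 1)) (Fin (m + 1)) ℂ := Matrix.vecMulVec 1 (Pi.single (Fin.last m) 1)
    with hP
  have hidem : P * P = P := by
    rw [hP, Matrix.vecMulVec_mul_vecMulVec, single_one_dotProduct, Pi.one_apply, one_smul]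
  have hfactor : M.AC + (ζ / (1 - ζ)) • Matrix.vecMulVec 1 M.bC =
      (1 + (ζ / (1 - ζ)) • P) * M.AC := by
    rw [add_mul, one_mul, smul_mul_assoc, hP, Matrix.vecMulVec_mul, bC_eq_single_vecMul_AC hA hb]
  have hinv : (1 + (ζ / (1 - ζ)) • P) * (1 - ζ • P) = 1 := by
    have hscalar : ζ / (1 - ζ) - ζ - ζ / (1 - ζ) * ζ = 0 := by field_simp; ring
    calc (1 + (ζ / (1 - ζ)) • P) * (1 - ζ • P)
        = 1 + (ζ / (1 - ζ) - ζ - ζ / (1 - ζ) * ζ) • P := by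
          rw [add_mul, one_mul, mul_sub, mul_one, smul_mul_smul_comm, hidem]
          module
      _ = 1 := by rw [hscalar, zero_smul, add_zero]
  rw [symbol, hfactor, Matrix.mul_inv_rev, Matrix.inv_eq_right_inv hinv, mul_sub, mul_one,
    mul_smul_comm, hP, Matrix.mul_vecMulVec]

theorem eventually_hasSum_resolvent (hA : IsUnit M.AC.det)
    (hb : M.b ᵥ* M.A⁻¹ = Pi.single (Fin.last m) 1) {z : ℂ} (hz : z ∉ spectrum ℂ M.AC⁻¹) :
    ∀ᶠ ζ : ℂ in 𝓝 0, IsUnit (M.symbol ζ - z • (1 : Matrix (Fin (m + 1)) (Fin (m + 1)) ℂ)) ∧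
      HasSum (fun n => ζ ^ n • rankOneCoeff (M.AC⁻¹ - z • (1 : Matrix _ _ ℂ)) (M.AC⁻¹ *ᵥ 1)
        (Pi.single (Fin.last m) 1) n) (M.resolvent z ζ) := by
  filter_upwards [eventually_norm_mul_invForm_lt_one (M.AC⁻¹ *ᵥ 1) (Pi.single (Fin.last m) 1)
    (isClosed_singleton (x := z)) (disjoint_singleton_left.2 hz),
    isOpen_ne.mem_nhds (zero_ne_one (α := ℂ))] with ζ hζ hζ1
  have hdet := isUnit_det_sub_smul_one hz
  rw [resolvent, symbol_eq_inv_sub hA hb hζ1, sub_right_comm]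
  exact ⟨isUnit_sub_smul_vecMulVec hdet (hζ z rfl), hasSum_rankOneCoeff hdet (hζ z rfl)⟩

theorem E_eq_rankOneCoeff (hA : IsUnit M.AC.det)
    (hb : M.b ᵥ* M.A⁻¹ = Pi.single (Fin.last m) 1) {z : ℂ} (hz : z ∉ spectrum ℂ M.AC⁻¹) (n : ℕ) :
    M.E n z = rankOneCoeff (M.AC⁻¹ - z • (1 : Matrix _ _ ℂ)) (M.AC⁻¹ *ᵥ 1)
      (Pi.single (Fin.last m) 1) n :=
  congrFun (powerCoeff_eq_of_hasSum
    ((eventually_hasSum_resolvent hA hb hz).mono fun _ h => h.2)) n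

theorem eventually_hasSum_E (hA : IsUnit M.AC.det)
    (hb : M.b ᵥ* M.A⁻¹ = Pi.single (Fin.last m) 1) {z : ℂ} (hz : z ∉ spectrum ℂ M.AC⁻¹) :
    ∀ᶠ ζ : ℂ in 𝓝 0, IsUnit (M.symbol ζ - z • (1 : Matrix (Fin (m + 1)) (Fin (m + 1)) ℂ)) ∧
      HasSum (fun n => ζ ^ n • M.E n z) (M.resolvent z ζ) := by
  simpa only [E_eq_rankOneCoeff hA hb hz] using eventually_hasSum_resolvent hA hb hz

section StepSize

variable {h : ℝ} {ρ : ℝ}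

theorem rankOneCoeff_inv_smul_eq (hA : IsUnit M.AC.det)
    (hb : M.b ᵥ* M.A⁻¹ = Pi.single (Fin.last m) 1) (hh : h ≠ 0) {z : ℂ}
    (hz : z ∉ spectrum ℂ ((h : ℂ)⁻¹ • M.AC⁻¹)) (n : ℕ) :
    rankOneCoeff ((h : ℂ)⁻¹ • M.AC⁻¹ - z • (1 : Matrix _ _ ℂ)) ((h : ℂ)⁻¹ • (M.AC⁻¹ *ᵥ 1))
      (Pi.single (Fin.last m) 1) n = (h : ℂ) • M.E n (h * z) := by
  have hh' : (h : ℂ) ≠ 0 := Complex.ofReal_ne_zero.2 hh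
  have hz' : h * z ∉ spectrum ℂ M.AC⁻¹ := (mul_mem_spectrum_iff hh').not.2 hz
  have hscale : (h : ℂ)⁻¹ • M.AC⁻¹ - z • (1 : Matrix (Fin (m + 1)) (Fin (m + 1)) ℂ) =
      (h : ℂ)⁻¹ • (M.AC⁻¹ - (h * z) • (1 : Matrix _ _ ℂ)) := by
    rw [smul_sub, smul_smul, inv_mul_cancel_left₀ hh']
  rw [hscale, rankOneCoeff_smul_smul _ _ _ (inv_ne_zero hh') (isUnit_det_sub_smul_one hz'),
    inv_inv, E_eq_rankOneCoeff hA hb hz']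

theorem eventually_hasSum_cqMatrix_cayleyIntegral (hA : IsUnit M.AC.det)
    (hb : M.b ᵥ* M.A⁻¹ = Pi.single (Fin.last m) 1) (hh : h ≠ 0) (hρ : ρ ∈ Ioo (0 : ℝ) 1)
    (hsub : spectrum ℂ ((h : ℂ)⁻¹ • M.AC⁻¹) ⊆ apolloniusDisc ρ) {f : ℂ → ℂ}
    (hf : ∀ z : ℂ, 0 < z.re → AnalyticAt ℂ f z) :
    ∀ᶠ ζ : ℂ in 𝓝 0, IsMatrixFunction f ((h : ℂ)⁻¹ • M.symbol ζ) (M.cqMatrix f h ζ) ∧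
      HasSum (fun n => ζ ^ n • Matrix.of fun i j =>
        (h : ℂ) * cayleyIntegral ρ fun z => f z * M.E n (h * z) i j) (M.cqMatrix f h ζ) := by
  have hcoeff (n : ℕ) (i j : Fin (m + 1)) :
      (cayleyIntegral ρ fun z => f z * rankOneCoeff ((h : ℂ)⁻¹ • M.AC⁻¹ - z • (1 : Matrix _ _ ℂ))
        ((h : ℂ)⁻¹ • (M.AC⁻¹ *ᵥ 1)) (Pi.single (Fin.last m) 1) n i j) =
        h * cayleyIntegral ρ fun z => f z * M.E n (h * z) i j := by
    rw [cayleyIntegral, cayleyIntegral, ← intervalIntegral.integral_const_mul]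
    refine intervalIntegral.integral_congr fun θ _ => ?_
    have hθ := notMem_subset hsub (cayleyContour_notMem_apolloniusDisc hρ θ)
    simp only [rankOneCoeff_inv_smul_eq hA hb hh hθ, Matrix.smul_apply, smul_eq_mul]
    ring
  filter_upwards [eventually_hasSum_matrixFunction_cayleyIntegral ((h : ℂ)⁻¹ • (M.AC⁻¹ *ᵥ 1))
    (Pi.single (Fin.last m) 1) hf hρ hsub, isOpen_ne.mem_nhds (zero_ne_one (α := ℂ))] with ζ hζ hζ1
  simpa only [cqMatrix, symbol_eq_inv_sub hA hb hζ1, smul_sub, smul_comm _ ζ, hcoeff,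
    ← Matrix.smul_vecMulVec] using hζ

theorem W_eq_cayleyIntegral (hA : IsUnit M.AC.det)
    (hb : M.b ᵥ* M.A⁻¹ = Pi.single (Fin.last m) 1) (hh : h ≠ 0) (hρ : ρ ∈ Ioo (0 : ℝ) 1)
    (hsub : spectrum ℂ ((h : ℂ)⁻¹ • M.AC⁻¹) ⊆ apolloniusDisc ρ) {f : ℂ → ℂ}
    (hf : ∀ z : ℂ, 0 < z.re → AnalyticAt ℂ f z) (n : ℕ) :
    M.W f h n = Matrix.of fun i j =>
      (h : ℂ) * cayleyIntegral ρ fun z => f z * M.E n (h * z) i j :=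
  congrFun (powerCoeff_eq_of_hasSum
    ((eventually_hasSum_cqMatrix_cayleyIntegral hA hb hh hρ hsub hf).mono fun _ h => h.2)) n

theorem exists_spectrum_subset_apolloniusDisc (hA : ∀ μ ∈ spectrum ℂ M.AC, 0 < μ.re)
    (hh : 0 < h) :
    ∃ ρ ∈ Ioo (0 : ℝ) 1, spectrum ℂ ((h : ℂ)⁻¹ • M.AC⁻¹) ⊆ apolloniusDisc ρ := by
  refine exists_subset_apolloniusDisc (Matrix.finite_spectrum _) fun z hz => ?_
  have hpos := spectrum_inv_re_pos hA _
    ((mul_mem_spectrum_iff (Complex.ofReal_ne_zero.2 hh.ne')).2 hz)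
  rw [Complex.re_ofReal_mul] at hpos
  exact pos_of_mul_pos_right hpos hh.le

theorem eventually_hasSum_W (hA : ∀ μ ∈ spectrum ℂ M.AC, 0 < μ.re)
    (hb : M.b ᵥ* M.A⁻¹ = Pi.single (Fin.last m) 1) (hh : 0 < h) {f : ℂ → ℂ}
    (hf : ∀ z : ℂ, 0 < z.re → AnalyticAt ℂ f z) :
    ∀ᶠ ζ : ℂ in 𝓝 0, IsMatrixFunction f ((h : ℂ)⁻¹ • M.symbol ζ) (M.cqMatrix f h ζ) ∧
      HasSum (fun n => ζ ^ n • M.W f h n) (M.cqMatrix f h ζ) := by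
  obtain ⟨ρ, hρ, hsub⟩ := exists_spectrum_subset_apolloniusDisc hA hh
  have hdet := isUnit_det_of_spectrum_re_pos hA
  simpa only [W_eq_cayleyIntegral hdet hb hh.ne' hρ hsub hf] using
    eventually_hasSum_cqMatrix_cayleyIntegral hdet hb hh.ne' hρ hsub hf

theorem exists_isDecayingWeight_E (hA : IsUnit M.AC.det)
    (hb : M.b ᵥ* M.A⁻¹ = Pi.single (Fin.last m) 1) (hh : h ≠ 0)
    (hsub : spectrum ℂ ((h : ℂ)⁻¹ • M.AC⁻¹) ⊆ apolloniusDisc ρ) {n : ℕ} (hn : 1 ≤ n)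
    (i j : Fin (m + 1)) :
    ∃ C, 0 ≤ C ∧ IsDecayingWeight ρ C fun z => M.E n (h * z) i j := by
  obtain ⟨C, hC, hq⟩ := exists_isDecayingWeight_rankOneCoeff hsub ((h : ℂ)⁻¹ • (M.AC⁻¹ *ᵥ 1))
    (Pi.single (Fin.last m) 1) hn i j
  have hE {z : ℂ} (hz : z ∉ spectrum ℂ ((h : ℂ)⁻¹ • M.AC⁻¹)) :
      M.E n (h * z) i j = (h : ℂ)⁻¹ * rankOneCoeff
        ((h : ℂ)⁻¹ • M.AC⁻¹ - z • (1 : Matrix _ _ ℂ)) ((h : ℂ)⁻¹ • (M.AC⁻¹ *ᵥ 1))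
        (Pi.single (Fin.last m) 1) n i j := by
    rw [rankOneCoeff_inv_smul_eq hA hb hh hz, Matrix.smul_apply, smul_eq_mul,
      inv_mul_cancel_left₀ (Complex.ofReal_ne_zero.2 hh)]
  refine ⟨‖(h : ℂ)⁻¹‖ * C, by positivity, fun z hz => ?_, fun z hz => ?_⟩
  · refine ((hq.differentiableAt z hz).const_mul (h : ℂ)⁻¹).congr_of_eventuallyEq ?_
    filter_upwards [(Matrix.finite_spectrum ((h : ℂ)⁻¹ • M.AC⁻¹)).isClosed.isOpen_compl.mem_nhds
      (notMem_subset hsub hz)] with w hw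
    exact hE hw
  · rw [hE (notMem_subset hsub hz), norm_mul, mul_div_assoc]
    gcongr
    exact hq.norm_le z hz

end StepSize

theorem omega_eq_verticalIntegral_add_integral (hA : ∀ μ ∈ spectrum ℂ M.AC, 0 < μ.re)
    (hb : M.b ᵥ* M.A⁻¹ = Pi.single (Fin.last m) 1) {k : ℂ → ℂ} {h ξ C : ℝ}
    (hk : IsRootKernel ξ C k) (hC : 0 ≤ C) (hh : 0 < h) (hξ : 0 < ξ) {f : ℂ → ℂ}
    (hf : ∀ z, f z = k (z ^ (1 / 2 : ℂ))) {G : ℝ → ℂ}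
    (hG : ∀ lam, G lam = k (-(√lam * Complex.I)) - k (√lam * Complex.I)) {n : ℕ} (hn : 1 ≤ n)
    (i : Fin (m + 1)) :
    IntegrableOn (fun y : ℝ => f (-(ξ : ℂ) + Complex.I * (y : ℂ)) *
        M.e n ((h : ℂ) * (-(ξ : ℂ) + Complex.I * (y : ℂ))) i) (Ioi 0) ∧
      IntegrableOn (fun y : ℝ => f (-(ξ : ℂ) - Complex.I * (y : ℂ)) *
        M.e n ((h : ℂ) * (-(ξ : ℂ) - Complex.I * (y : ℂ))) i) (Ioi 0) ∧
      IntervalIntegrable (fun lam : ℝ => G lam * M.e n (-(h : ℂ) * (lam : ℂ)) i) volume 0 ξ ∧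
      M.omega f h n i =
        (h : ℂ) / (2 * (Real.pi : ℂ) * Complex.I) *
          verticalIntegral ξ (fun z => f z * M.e n ((h : ℂ) * z) i) +
        (h : ℂ) / (2 * (Real.pi : ℂ) * Complex.I) *
          ∫ lam in (0 : ℝ)..ξ, G lam * M.e n (-(h : ℂ) * (lam : ℂ)) i := by
  have hdet := isUnit_det_of_spectrum_re_pos hA
  have hf' (z : ℂ) (hz : 0 < z.re) : AnalyticAt ℂ f z := by
    rw [funext hf]
    exact hk.analyticAt_comp_cpow_half (.inl hz)
  obtain ⟨ρ, hρ, hsub⟩ := exists_spectrum_subset_apolloniusDisc hA hh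
  obtain ⟨C', hC', hq⟩ := exists_isDecayingWeight_E hdet hb hh.ne' hsub hn (Fin.last m) i
  have homega (r : ℝ) (hr : r ∈ Ioo ρ 1) : cayleyIntegral r (fun z => f z * M.e n (h * z) i) =
      (h : ℂ)⁻¹ * M.omega f h n i := by
    rw [omega, W_eq_cayleyIntegral hdet hb hh.ne' ⟨hρ.1.trans hr.1, hr.2⟩
      (hsub.trans (apolloniusDisc_mono hr.1.le)) hf' n, Matrix.of_apply,
      inv_mul_cancel_left₀ (Complex.ofReal_ne_zero.2 hh.ne')]
    rfl
  obtain ⟨hupper, hlower, hjump, hrepr⟩ := hk.eq_verticalIntegral_add_integral hq hρ hξ hC hC'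
    (fun z => by rw [← hf]; rfl) homega
    (jump := fun lam => G lam * M.e n (-(h : ℂ) * (lam : ℂ)) i)
    (fun lam => by rw [← hG, neg_mul, ← mul_neg]; rfl)
  refine ⟨hupper, hlower, hjump, ?_⟩
  rw [inv_mul_eq_iff_eq_mul₀ (Complex.ofReal_ne_zero.2 hh.ne')] at hrepr
  rw [hrepr]
  ring

end RKMethod

end SchrodingerCQ

theorem theorem3p3_general {m : ℕ} (M : SchrodingerCQ.RKMethod m)
    (hA : ∀ μ ∈ spectrum ℂ M.AC, 0 < μ.re) (hb : M.b ᵥ* M.A⁻¹ = Pi.single (Fin.last m) 1)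
    {D : ℕ} (hD : D = 1 ∨ D = 2 ∨ D = 3) {d : ℝ} (hd : 0 ≤ d) (hd' : D = 1 ∨ 0 < d)
    {h ξ : ℝ} (hh : 0 < h) (hξ : 0 < ξ) :
    (∀ᶠ ζ in 𝓝 (0 : ℂ),
      SchrodingerCQ.IsMatrixFunction (SchrodingerCQ.transferK D d)
        ((h : ℂ)⁻¹ • M.symbol ζ) (M.cqMatrix (SchrodingerCQ.transferK D d) h ζ) ∧
      HasSum (fun n : ℕ => ζ ^ n • M.W (SchrodingerCQ.transferK D d) h n)
        (M.cqMatrix (SchrodingerCQ.transferK D d) h ζ)) ∧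
    (∀ z : ℂ, z.re ≤ 0 → ∀ᶠ ζ in 𝓝 (0 : ℂ),
      IsUnit (M.symbol ζ - z • (1 : Matrix (Fin (m + 1)) (Fin (m + 1)) ℂ)) ∧
      HasSum (fun n : ℕ => ζ ^ n • M.E n z) (M.resolvent z ζ)) ∧
    (∀ n : ℕ, 1 ≤ n → ∀ i : Fin (m + 1),
      IntegrableOn (fun y : ℝ =>
        SchrodingerCQ.transferK D d (-(ξ : ℂ) + Complex.I * (y : ℂ)) *
          M.e n ((h : ℂ) * (-(ξ : ℂ) + Complex.I * (y : ℂ))) i) (Ioi 0) ∧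
      IntegrableOn (fun y : ℝ =>
        SchrodingerCQ.transferK D d (-(ξ : ℂ) - Complex.I * (y : ℂ)) *
          M.e n ((h : ℂ) * (-(ξ : ℂ) - Complex.I * (y : ℂ))) i) (Ioi 0) ∧
      IntervalIntegrable (fun lam : ℝ =>
        SchrodingerCQ.jumpG D d lam * M.e n (-(h : ℂ) * (lam : ℂ)) i) volume 0 ξ ∧
      M.omega (SchrodingerCQ.transferK D d) h n i =
        (h : ℂ) / (2 * (Real.pi : ℂ) * Complex.I) *
          SchrodingerCQ.verticalIntegral ξ
            (fun z => SchrodingerCQ.transferK D d z * M.e n ((h : ℂ) * z) i) +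
        (h : ℂ) / (2 * (Real.pi : ℂ) * Complex.I) *
          ∫ lam in (0 : ℝ)..ξ,
            SchrodingerCQ.jumpG D d lam * M.e n (-(h : ℂ) * (lam : ℂ)) i) ∧
    (∀ lam : ℝ, 0 < lam →
      (D = 1 → SchrodingerCQ.jumpG D d lam =
        Complex.I * Complex.exp (Complex.I * (Real.pi / 4 : ℂ)) / (Real.sqrt lam : ℂ) *
          Complex.cosh ((d : ℂ) * Complex.exp (Complex.I * (Real.pi / 4 : ℂ)) *
            (Real.sqrt lam : ℂ))) ∧
      (D = 2 → SchrodingerCQ.jumpG D d lam =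
        Complex.I / 2 *
          SchrodingerCQ.besselJ0 (Complex.exp (-(Complex.I * (Real.pi / 4 : ℂ))) *
            (Real.sqrt lam : ℂ) * (d : ℂ))) ∧
      (D = 3 → SchrodingerCQ.jumpG D d lam =
        1 / (2 * (Real.pi : ℂ) * (d : ℂ)) *
          Complex.sinh ((d : ℂ) * Complex.exp (Complex.I * (Real.pi / 4 : ℂ)) *
            (Real.sqrt lam : ℂ)))) := by
  have hdet := SchrodingerCQ.isUnit_det_of_spectrum_re_pos hA
  obtain ⟨C, hC, hk⟩ := SchrodingerCQ.exists_isRootKernel_transferOfRoot hD hd hd' ξ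
  refine ⟨SchrodingerCQ.RKMethod.eventually_hasSum_W hA hb hh fun z hz =>
      hk.analyticAt_comp_cpow_half (.inl hz),
    fun z hz => SchrodingerCQ.RKMethod.eventually_hasSum_E hdet hb fun hμ =>
      hz.not_gt (SchrodingerCQ.spectrum_inv_re_pos hA z hμ),
    fun n hn i => SchrodingerCQ.RKMethod.omega_eq_verticalIntegral_add_integral hA hb hk hC hh hξ
      (fun _ => rfl) (SchrodingerCQ.jumpG_eq_transferOfRoot_sub D d) hn i,
    fun lam hlam => ⟨?_, ?_, ?_⟩⟩
  · rintro rfl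
    exact SchrodingerCQ.jumpG_one d hlam
  · rintro rfl
    exact SchrodingerCQ.jumpG_two (hd'.resolve_left (by decide)) hlam
  · rintro rfl
    exact SchrodingerCQ.jumpG_three d lam

theorem theorem3p3 {m : ℕ} (M : SchrodingerCQ.RKMethod m) (hM : M.Admissible)
    (D : ℕ) (hD : D = 1 ∨ D = 2 ∨ D = 3)
    (x : EuclideanSpace ℝ (Fin D)) (hx : D = 1 ∨ x ≠ 0)
    (h ξ : ℝ) (hh : 0 < h) (hξ : 0 < ξ) :
    -- the expansions that define the weights and the vectors `e_n` are meaningful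
    (∀ᶠ ζ in 𝓝 (0 : ℂ),
      SchrodingerCQ.IsMatrixFunction (SchrodingerCQ.transferK D ‖x‖)
        ((h : ℂ)⁻¹ • M.symbol ζ) (M.cqMatrix (SchrodingerCQ.transferK D ‖x‖) h ζ) ∧
      HasSum (fun n : ℕ => ζ ^ n • M.W (SchrodingerCQ.transferK D ‖x‖) h n)
        (M.cqMatrix (SchrodingerCQ.transferK D ‖x‖) h ζ)) ∧
    (∀ z : ℂ, z.re ≤ 0 → ∀ᶠ ζ in 𝓝 (0 : ℂ),
      IsUnit (M.symbol ζ - z • (1 : Matrix (Fin (m + 1)) (Fin (m + 1)) ℂ)) ∧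
      HasSum (fun n : ℕ => ζ ^ n • M.E n z) (M.resolvent z ζ)) ∧
    -- the integral representation of the weights, with absolutely convergent integrals
    (∀ n : ℕ, 1 ≤ n → ∀ i : Fin (m + 1),
      IntegrableOn (fun y : ℝ =>
        SchrodingerCQ.transferK D ‖x‖ (-(ξ : ℂ) + Complex.I * (y : ℂ)) *
          M.e n ((h : ℂ) * (-(ξ : ℂ) + Complex.I * (y : ℂ))) i) (Ioi 0) ∧
      IntegrableOn (fun y : ℝ =>
        SchrodingerCQ.transferK D ‖x‖ (-(ξ : ℂ) - Complex.I * (y : ℂ)) *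
          M.e n ((h : ℂ) * (-(ξ : ℂ) - Complex.I * (y : ℂ))) i) (Ioi 0) ∧
      IntervalIntegrable (fun lam : ℝ =>
        SchrodingerCQ.jumpG D ‖x‖ lam * M.e n (-(h : ℂ) * (lam : ℂ)) i) volume 0 ξ ∧
      M.omega (SchrodingerCQ.transferK D ‖x‖) h n i =
        (h : ℂ) / (2 * (Real.pi : ℂ) * Complex.I) *
          SchrodingerCQ.verticalIntegral ξ
            (fun z => SchrodingerCQ.transferK D ‖x‖ z * M.e n ((h : ℂ) * z) i) +
        (h : ℂ) / (2 * (Real.pi : ℂ) * Complex.I) *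
          ∫ lam in (0 : ℝ)..ξ,
            SchrodingerCQ.jumpG D ‖x‖ lam * M.e n (-(h : ℂ) * (lam : ℂ)) i) ∧
    -- the explicit form of the jump
    (∀ lam : ℝ, 0 < lam →
      (D = 1 → SchrodingerCQ.jumpG D ‖x‖ lam =
        Complex.I * Complex.exp (Complex.I * (Real.pi / 4 : ℂ)) / (Real.sqrt lam : ℂ) *
          Complex.cosh ((‖x‖ : ℂ) * Complex.exp (Complex.I * (Real.pi / 4 : ℂ)) *
            (Real.sqrt lam : ℂ))) ∧
      (D = 2 → SchrodingerCQ.jumpG D ‖x‖ lam =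
        Complex.I / 2 *
          SchrodingerCQ.besselJ0 (Complex.exp (-(Complex.I * (Real.pi / 4 : ℂ))) *
            (Real.sqrt lam : ℂ) * (‖x‖ : ℂ))) ∧
      (D = 3 → SchrodingerCQ.jumpG D ‖x‖ lam =
        1 / (2 * (Real.pi : ℂ) * (‖x‖ : ℂ)) *
          Complex.sinh ((‖x‖ : ℂ) * Complex.exp (Complex.I * (Real.pi / 4 : ℂ)) *
            (Real.sqrt lam : ℂ)))) :=
  theorem3p3_general M hM.eigenvalues_pos hM.stifflyAccurate hD (norm_nonneg x)
    (hx.imp_right norm_pos_iff.2) hh hξ
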